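/- For nonzero integers $b_1,\dots,b_n$ write $[b_1,\dots,b_n]=\cfrac{1}{b_1+\cfrac{1}{b_2+\dots+\cfrac{1}{b_n}}}$, evaluated in $\mathbb{Q}\cup\{\infty\}$ with $1/0=\infty$, $1/\infty=0$, $\infty+x=\infty$. The natural diagram $D[b_1,\dots,b_n]$ is obtained from the four-strand braid $A^{b_1}B^{b_2}A^{b_3}\cdots$ (read from left to right), where $A$ is the right-handed half twist of the two middle strands and $B$ is the left-handed half twist of the two upper strands. On the left, the first strand (from the top) is joined to the second and the third to the fourth. On the right the same pairs are joined if $n$ is odd, while the second strand is joined to the third and the first to the fourth if $n$ is even. If the value $p/q$ of the continued fraction (in lowest terms) has even denominator, the diagram represents a two-component link in $\mathbb{R}^3$ whose two arcs on the far left belong to different components; $D^+[b_1,\dots,b_n]$ denotes this diagram with both of these arcs oriented upwards. Let $p,q$ be coprime integers with $q\neq0$ even, and suppose that $p/q=[b_1,\dots,b_n]=[c_1,\dots,c_m]$, where all $b_i$ and $c_i$ are nonzero integers. Then the oriented links represented by $D^+[b_1,\dots,b_n]$ and $D^+[c_1,\dots,c_m]$ are equivalent: there is a smooth isotopy of $\mathbb{R}^3$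 (a smooth family of diffeomorphisms $H_t$, $0\le t\le1$, with $H_0=\mathrm{id}$) such that $H_1$ takes the first oriented link onto the second one, preserving orientations. -/

import Mathlib

open Set
open scoped ContDiff

noncomputable section

/-! ### Continued fractions with values in `ℚ ∪ {∞}` -/

/-- `x ↦ 1 / x` on `ℚ ∪ {∞}` with `1 / 0 = ∞` and `1 / ∞ = 0`. Here `⊤` stands for the (unsigned)
point `∞`; the order of `WithTop ℚ` plays no role, and its addition satisfies `∞ + x = ∞`. -/
def recip : WithTop ℚ → WithTop ℚ
  | ⊤ => 0
  | (x : ℚ) => if x = 0 then ⊤ else ((x⁻¹ : ℚ) : WithTop ℚ)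

/-- `[b₁, …, bₙ] = 1 / (b₁ + 1 / (b₂ + ⋯ + 1 / bₙ))`. -/
def contFrac : List ℤ → WithTop ℚ
  | [] => 0
  | b :: l => recip (((b : ℚ) : WithTop ℚ) + contFrac l)

/-! ### Oriented links in space

Coordinates are `(x, y, z)`; the plane of the diagrams is the `(x, y)`-plane, with `x` pointing to
the right and `y` pointing upwards, and it is viewed from the side `z > 0`. -/

/-- Three-dimensional space (only its smooth structure is used). -/
abbrev Space : Type := ℝ × ℝ × ℝ

/-- An oriented link, recorded as the set of all pairs `(P, v)` with `P` a point of the link and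
`v` a nonzero tangent vector at `P` that points in the direction of the orientation. -/
abbrev OrientedCurves : Type := Set (Space × Space)

/-- The arc `γ (I)`, oriented by increasing parameter if `s = 1`, and by decreasing parameter if
`s = -1`. -/
def orientedArc (γ : ℝ → Space) (I : Set ℝ) (s : ℝ) : OrientedCurves :=
  {u | ∃ t ∈ I, ∃ c : ℝ, 0 < c ∧ u = (γ t, (c * s) • deriv γ t)}

/-- Equivalence of oriented links: there is a smooth isotopy `H t`, `0 ≤ t ≤ 1`, of space, starting
at the identity, such that `H 1` takes the first link onto the second one, with its orientation
(components may be interchanged). -/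
def OrientedIsotopic (K K' : OrientedCurves) : Prop :=
  ∃ H : ℝ → Space ≃ Space,
    ContDiffOn ℝ ∞ (fun u : ℝ × Space => H u.1 u.2) (Icc 0 1 ×ˢ univ) ∧
    (∀ t ∈ Icc (0 : ℝ) 1, ContDiff ℝ ∞ (H t) ∧ ContDiff ℝ ∞ (H t).symm) ∧
    (∀ P, H 0 P = P) ∧
    (fun u : Space × Space => (H 1 u.1, fderiv ℝ (H 1) u.1 u.2)) '' K = K'

/-! ### Natural diagrams

The link of `[b₁, …, bₙ]` consists of a braid on four strands over `0 ≤ x ≤ n`, of two arcs closing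
it on the left and of two arcs closing it on the right. The strands have the positions `0, 1, 2, 3`
from top to bottom. The block number `k` (counted from `0`) lies over `k ≤ x ≤ k + 1`. It is a power
of `A`, a twist of the two middle strands, if `k` is even, and a power of `B`, a twist of the two
upper strands, if `k` is odd. -/

/-- The `y`-coordinate of the four positions: `3/2, 1/2, -1/2, -3/2`. -/
def height (j : Fin 4) : ℝ := 3 / 2 - (j : ℕ)

/-- The position of the upper one of the two strands twisted in block `k`. The other one is just
below it. -/
def upperPos (k : ℕ) : Fin 4 := if Even k then 1 else 0

/-- The `y`-coordinate of the axis of the twist in block `k`. -/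
def axisHeight (k : ℕ) : ℝ := if Even k then 0 else 1

/-- The angle of rotation (from the `y`-axis towards the `z`-axis) of the two twisted strands in
block `k`. In total it amounts to `b` half twists, right-handed ones for `A ^ b` with `b > 0`, and
left-handed ones for `B ^ b` with `b > 0`. -/
def twistAngle (k : ℕ) (b : ℤ) (x : ℝ) : ℝ :=
  (-1) ^ k * b * Real.pi * Real.smoothTransition (x - k)

/-- The strand of block `k` (with `b` half twists) which starts at position `j`. -/
def strand (k : ℕ) (b : ℤ) (j : Fin 4) (x : ℝ) : Space :=
  if j = upperPos k ∨ j = upperPos k + 1 then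
    (x, axisHeight k + (height j - axisHeight k) * Real.cos (twistAngle k b x),
      (height j - axisHeight k) * Real.sin (twistAngle k b x))
  else (x, height j, 0)

/-- A smooth odd function, equal to `-1` for `t ≤ -1` and to `1` for `t ≥ 1`, and strictly
increasing in between. -/
def smoothSign (t : ℝ) : ℝ := 2 * Real.smoothTransition ((t + 1) / 2) - 1

/-- An arc closing the braid on the left: over `-1 ≤ t ≤ 1` it runs upwards from `(0, m - 1/2, 0)`
to `(0, m + 1/2, 0)`, through the half-plane `x ≤ 0`. It is horizontal at its ends. -/
def leftCap (m t : ℝ) : Space := (t ^ 2 - 1, m + smoothSign t / 2, 0)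

/-- An arc closing a braid with `n` blocks on the right: over `-1 ≤ t ≤ 1` it runs upwards from
`(n, m - r, 0)` to `(n, m + r, 0)`, through the half-plane `x ≥ n`, up to `x = n + w`. It is
horizontal at its ends. -/
def rightCap (n : ℕ) (m r w t : ℝ) : Space := (n + w * (1 - t ^ 2), m + r * smoothSign t, 0)

/-- The directions (`1`: to the right, `-1`: to the left) of the strands at the left end of block
`k`, when both left arcs are oriented upwards. -/
def dir (b : List ℤ) : ℕ → Fin 4 → ℝ
  | 0 => ![1, -1, 1, -1]
  | k + 1 => if Odd (b.getD k 0)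
      then fun j => dir b k (Equiv.swap (upperPos k) (upperPos k + 1) j)
      else dir b k

/-- The arcs closing the braid on the right, with their orientations. They join the positions
`0, 1` and `2, 3` if `n` is odd, and `1, 2` and `0, 3` if `n` is even. An arc is oriented upwards
if and only if its lower end is the end of a strand directed to the right. -/
def rightClosure (b : List ℤ) : OrientedCurves :=
  if Odd b.length then
    orientedArc (rightCap b.length 1 (1 / 2) 1) (Icc (-1) 1) (dir b b.length 1) ∪
    orientedArc (rightCap b.length (-1) (1 / 2) 1) (Icc (-1) 1) (dir b b.length 3)
  else
    orientedArc (rightCap b.length 0 (1 / 2) 1) (Icc (-1) 1) (dir b b.length 2) ∪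
    orientedArc (rightCap b.length 0 (3 / 2) 2) (Icc (-1) 1) (dir b b.length 3)

/-- The oriented link with the diagram `D⁺[b₁, …, bₙ]`: the two vertical leftmost fragments of the
natural diagram are both oriented upwards. This determines the orientation if the diagram
represents a two-component link, because these fragments then belong to different components. -/
def positiveNaturalLink (b : List ℤ) : OrientedCurves :=
  orientedArc (leftCap 1) (Icc (-1) 1) 1 ∪
  orientedArc (leftCap (-1)) (Icc (-1) 1) 1 ∪
  (⋃ k ∈ Finset.range b.length, ⋃ j : Fin 4,
    orientedArc (strand k (b.getD k 0) j) (Icc (k : ℝ) (k + 1)) (dir b k j)) ∪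
  rightClosure b

end

/-! Conway's argument for rational tangles, carried out with orientations. The plane `x = 0` cuts
the link into two fixed left caps and a tangle in `x ≥ 0`. Two tangles count as equal if a
diffeomorphism of space that fixes `x ≤ 0` pointwise carries one onto the other, for all admissible
directions of the four ends. Such a diffeomorphism keeps the left caps and is the identity on an
open set, so conjugating it with homotheties yields an isotopy of the links
(`orientedIsotopic_of_diffeo`). It remains to see that the tangle class depends only on `p / q`.

Prepending blocks lets the powers of `A` and `B` act on tangle classes. Five geometric facts
suffice: exponents add (`twist_twist`); `A` and `B⁻¹` satisfy the braid relation (`twist_braid`);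
`A` fixes the tangle `0` (`twist_capZero`); `B` fixes the tangle `∞` (`twist_capInf`); and `A^{±1} ∞
= B^{±1} 0` (`twist_one_capInf`, `twist_neg_one_capInf`). The rotations about an axis are explicit.
The braid relation and the last fact are obtained by deforming both sides linearly to a common
model, a half turn of three strands or a pair of hooks; `exists_diffeo_of_linear_homotopy` turns a
linear homotopy through embeddings into an ambient diffeomorphism.

The rest is algebra (`FractionAction`). The Euclidean algorithm defines a point for every fraction,
and the relations show that `A b` sends the point of `p / q` to that of `p / (q + b p)`, and `B b`
to that of `(p + b q) / q`. The delicate case is a change of sign, where the half turn `A B⁻¹ A`,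
acting as `v ↦ -1 / v`, connects positive with negative fractions. Induction along the continued
fraction then identifies the tangle class with the point of `p / q` (`of_tangle`).

Orientations are functions of the directions of the four ends. Which directions are admissible
depends on `p` and `q` modulo `2` only (`tangle_valid`); for even `q` they include the alternating
directions imposed by two upward left caps. -/

noncomputable section

open Filter Topology NNReal

/-! ### Diffeomorphisms -/

section Diffeomorphisms

variable {E : Type*} [NormedAddCommGroup E] [NormedSpace ℝ E]

/-- A bijection that is smooth together with its inverse. -/
def IsDiffeo (g : E ≃ E) : Prop := ContDiff ℝ ∞ g ∧ ContDiff ℝ ∞ g.symm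

theorem IsDiffeo.refl : IsDiffeo (Equiv.refl E) := ⟨contDiff_id, contDiff_id⟩

theorem IsDiffeo.symm {g : E ≃ E} (hg : IsDiffeo g) : IsDiffeo g.symm := ⟨hg.2, hg.1⟩

theorem IsDiffeo.trans {g h : E ≃ E} (hg : IsDiffeo g) (hh : IsDiffeo h) :
    IsDiffeo (g.trans h) := ⟨hh.1.comp hg.1, hg.2.comp hh.2⟩

theorem IsDiffeo.differentiable {g : E ≃ E} (hg : IsDiffeo g) : Differentiable ℝ g :=
  hg.1.differentiable (by simp)

/-- A smooth perturbation of the identity with a Lipschitz constant less than `1` is a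
diffeomorphism. -/
theorem exists_diffeo_add [CompleteSpace E] (D : E → E) (hD : ContDiff ℝ ∞ D) (K : ℝ≥0)
    (hK : K < 1) (hL : LipschitzWith K D) :
    ∃ g : E ≃ E, IsDiffeo g ∧ ∀ P, g P = P + D P := by
  have hN : ‖((ContinuousLinearEquiv.refl ℝ E).symm : E →L[ℝ] E)‖₊ ≤ 1 :=
    ContinuousLinearMap.norm_id_le
  have hcond : Subsingleton E ∨
      K < ‖((ContinuousLinearEquiv.refl ℝ E).symm : E →L[ℝ] E)‖₊⁻¹ := by
    rcases subsingleton_or_nontrivial E with h | h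
    · exact Or.inl h
    · right
      have : ‖((ContinuousLinearEquiv.refl ℝ E).symm : E →L[ℝ] E)‖₊ = 1 := by
        have : ‖ContinuousLinearMap.id ℝ E‖₊ = 1 := by
          ext; simp
        exact this
      rw [this, inv_one]
      exact hK
  -- The inverse function theorem in its global form: closeness to the identity, with constant below
  -- `1`, on the whole space gives a homeomorphism of the space.
  have happ : ApproximatesLinearOn (fun P => P + D P)
      ((ContinuousLinearEquiv.refl ℝ E : E ≃L[ℝ] E) : E →L[ℝ] E) univ K := by
    intro x _ y _
    have := hL.dist_le_mul x y
    rw [dist_eq_norm, dist_eq_norm] at this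
    refine le_trans (le_of_eq ?_) this
    congr 1
    simp only [ContinuousLinearEquiv.coe_refl, ContinuousLinearMap.id_apply]
    abel
  let G : E ≃ₜ E := ApproximatesLinearOn.toHomeomorph _ happ hcond
  have hG : ∀ P, G P = P + D P := fun P => rfl
  have hGd : ContDiff ℝ ∞ G := contDiff_id.add hD
  have hder : ∀ P, ∃ f : E ≃L[ℝ] E, HasFDerivAt G (f : E →L[ℝ] E) P := by
    intro P
    have h1 : HasFDerivAt G (ContinuousLinearMap.id ℝ E + fderiv ℝ D P) P :=
      (hasFDerivAt_id P).add ((hD.differentiable (by simp)) P).hasFDerivAt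
    have h2 : ‖-fderiv ℝ D P‖ < 1 := by
      rw [norm_neg]
      exact lt_of_le_of_lt (norm_fderiv_le_of_lipschitz ℝ hL) (by exact_mod_cast hK)
    -- Neumann series: `id + D'` is invertible because `‖D'‖ < 1`. This makes the inverse smooth.
    let u := Units.oneSub (-fderiv ℝ D P) h2
    refine ⟨ContinuousLinearEquiv.unitsEquiv ℝ E u, ?_⟩
    convert h1 using 1
    ext v
    simp [u]
  choose f hf using hder
  exact ⟨G.toEquiv, ⟨hGd, G.contDiff_symm hf hGd⟩, hG⟩

end Diffeomorphisms

/-- The action of a map on points with a tangent vector. -/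
def push (g : Space → Space) (u : Space × Space) : Space × Space := (g u.1, fderiv ℝ g u.1 u.2)

theorem push_id : push (Equiv.refl Space) = id := by
  funext u
  simp only [push, Equiv.coe_refl, fderiv_id, id]
  rfl

theorem push_trans {g h : Space ≃ Space} (hg : IsDiffeo g) (hh : IsDiffeo h) :
    push (g.trans h) = push h ∘ push g := by
  funext u
  simp only [push, Equiv.coe_trans, Function.comp]
  rw [fderiv_comp u.1 (hh.differentiable _) (hg.differentiable _)]
  rfl

theorem push_image_trans {g h : Space ≃ Space} (hg : IsDiffeo g) (hh : IsDiffeo h)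
    (K : OrientedCurves) : push (g.trans h) '' K = push h '' (push g '' K) := by
  rw [push_trans hg hh, image_comp]

theorem push_symm_image {g : Space ≃ Space} (hg : IsDiffeo g) (K : OrientedCurves) :
    push g.symm '' (push g '' K) = K := by
  rw [← push_image_trans hg hg.symm, Equiv.self_trans_symm, push_id, image_id]

/-- A diffeomorphism of space that is the identity near a point is isotopic to the identity, by the
conjugates of `g` with the homotheties centred at the point. -/
theorem orientedIsotopic_of_diffeo {g : Space ≃ Space} (hg : IsDiffeo g) (P₀ : Space)
    (hloc : ∀ᶠ P in 𝓝 P₀, g P = P) (K : OrientedCurves) :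
    OrientedIsotopic K (push g '' K) := by
  have key : ∀ t : ℝ, t ≠ 0 → ∃ e : Space ≃ Space,
      (∀ P, e P = P₀ + t⁻¹ • (g (P₀ + t • (P - P₀)) - P₀)) ∧
      (∀ P, e.symm P = P₀ + t⁻¹ • (g.symm (P₀ + t • (P - P₀)) - P₀)) := by
    intro t ht
    refine ⟨⟨fun P => P₀ + t⁻¹ • (g (P₀ + t • (P - P₀)) - P₀),
      fun P => P₀ + t⁻¹ • (g.symm (P₀ + t • (P - P₀)) - P₀), fun P => ?_, fun P => ?_⟩,
      fun P => rfl, fun P => rfl⟩ <;>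
    simp [smul_smul, ht]
  choose! e he hes using key
  let H : ℝ → Space ≃ Space := fun t => if t = 0 then Equiv.refl _ else e t
  have H0 : H 0 = Equiv.refl _ := by simp [H]
  have Hne : ∀ t, t ≠ 0 → H t = e t := fun t ht => by simp [H, ht]
  have hH1 : (H 1 : Space → Space) = g := by
    funext P
    rw [Hne 1 one_ne_zero, he 1 one_ne_zero]
    simp
  refine ⟨H, ?_, ?_, ?_, ?_⟩
  · apply ContDiff.contDiffOn
    rw [contDiff_iff_contDiffAt]
    rintro ⟨t, P⟩
    by_cases ht : t = 0
    · subst ht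
      have h1 : ContinuousAt (fun u : ℝ × Space => P₀ + u.1 • (u.2 - P₀)) (0, P) := by fun_prop
      -- For small `t` the homothety moves a neighbourhood of `P` into the region where `g` is the
      -- identity. Hence the family is constant near `(0, P)`, and the factor `t⁻¹` does no harm
      -- there.
      have h2 : ∀ᶠ u : ℝ × Space in 𝓝 (0, P),
          g (P₀ + u.1 • (u.2 - P₀)) = P₀ + u.1 • (u.2 - P₀) := by
        refine h1.eventually (p := fun P => g P = P) ?_
        simpa using hloc
      have h3 : (fun u : ℝ × Space => H u.1 u.2) =ᶠ[𝓝 (0, P)] fun u => u.2 := by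
        filter_upwards [h2] with u hu
        by_cases hu0 : u.1 = 0
        · rw [hu0, H0]; rfl
        · rw [Hne _ hu0, he _ hu0, hu]
          simp [smul_smul, hu0]
      exact contDiffAt_snd.congr_of_eventuallyEq h3
    · have h3 : (fun u : ℝ × Space => H u.1 u.2) =ᶠ[𝓝 (t, P)]
          fun u => P₀ + (u.1)⁻¹ • (g (P₀ + u.1 • (u.2 - P₀)) - P₀) := by
        have : ∀ᶠ u : ℝ × Space in 𝓝 (t, P), u.1 ≠ 0 :=
          continuousAt_fst.eventually_ne ht
        filter_upwards [this] with u hu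
        rw [Hne _ hu, he _ hu]
      refine ContDiffAt.congr_of_eventuallyEq ?_ h3
      have hc : ContDiff ℝ ∞ fun u : ℝ × Space => g (P₀ + u.1 • (u.2 - P₀)) :=
        hg.1.comp (by fun_prop)
      exact contDiffAt_const.add
        ((contDiffAt_fst.inv ht).smul (hc.contDiffAt.sub contDiffAt_const))
  · intro t _
    by_cases ht : t = 0
    · rw [ht, H0]; exact ⟨contDiff_id, contDiff_id⟩
    · rw [Hne t ht]
      constructor
      · have : (e t : Space → Space) = fun P => P₀ + t⁻¹ • (g (P₀ + t • (P - P₀)) - P₀) :=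
          funext (he t ht)
        rw [this]
        have hc : ContDiff ℝ ∞ fun P : Space => g (P₀ + t • (P - P₀)) :=
          hg.1.comp (by fun_prop)
        exact contDiff_const.add ((hc.sub contDiff_const).const_smul _)
      · have : ((e t).symm : Space → Space) =
            fun P => P₀ + t⁻¹ • (g.symm (P₀ + t • (P - P₀)) - P₀) := funext (hes t ht)
        rw [this]
        have hc : ContDiff ℝ ∞ fun P : Space => g.symm (P₀ + t • (P - P₀)) :=
          hg.2.comp (by fun_prop)
        exact contDiff_const.add ((hc.sub contDiff_const).const_smul _)
  · intro P; rw [H0]; rfl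
  · rw [hH1]; rfl

/-! ### Ambient extension of linear homotopies of arcs. -/

section LinearIsotopy

open Manifold

variable {E : Type*} [NormedAddCommGroup E] [NormedSpace ℝ E]

/-- The local inverse of an embedded arc near one of its points, extended to the ambient space. -/
theorem exists_local_left_inverse (γ : ℝ → E) (hγ : ContDiff ℝ ∞ γ) {a b : ℝ}
    (hinj : InjOn γ (Icc a b)) (himm : ∀ t ∈ Icc a b, deriv γ t ≠ 0) {t₀ : ℝ}
    (ht₀ : t₀ ∈ Icc a b) :
    ∃ U ∈ 𝓝 (γ t₀), ∃ π : E → ℝ, ContDiffOn ℝ ∞ π U ∧ ∀ t ∈ Icc a b, γ t ∈ U → π (γ t) = t := by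
  -- A functional that does not kill the tangent vector makes `l ∘ γ` a local diffeomorphism of the
  -- line; its inverse after `l` is the wanted function.
  obtain ⟨l, hl⟩ := SeparatingDual.exists_ne_zero (R := ℝ) (himm t₀ ht₀)
  let f : ℝ → ℝ := fun t => l (γ t)
  have hf : ContDiff ℝ ∞ f := l.contDiff.comp hγ
  have hfd : ∀ t, HasDerivAt f (deriv f t) t := fun t =>
    (hf.differentiable (by simp) t).hasDerivAt
  have hf0 : deriv f t₀ ≠ 0 := by
    have h : HasDerivAt f (l (deriv γ t₀)) t₀ :=
      l.hasFDerivAt.comp_hasDerivAt t₀ ((hγ.differentiable (by simp) t₀).hasDerivAt)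
    rw [h.deriv]; exact hl
  let e := hf.contDiffAt.toOpenPartialHomeomorph f ((hfd t₀).hasFDerivAt_equiv hf0) (by simp)
  have hef : ∀ t, e t = f t := fun t => rfl
  have ht₀e : t₀ ∈ e.source := hf.contDiffAt.mem_toOpenPartialHomeomorph_source _ _
  let V : Set ℝ := {t | deriv f t ≠ 0}
  have hV : IsOpen V := by
    have : Continuous (deriv f) := hf.continuous_deriv (by simp)
    exact isOpen_ne_fun this continuous_const
  let S : Set ℝ := e.source ∩ V
  have hS : IsOpen S := e.open_source.inter hV
  let T : Set ℝ := e.target ∩ e.symm ⁻¹' V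
  have hT : IsOpen T := e.symm.isOpen_inter_preimage hV
  have hC : IsClosed (γ '' (Icc a b \ S)) :=
    ((isCompact_Icc.diff hS).image hγ.continuous).isClosed
  -- Deleting the compact image of the remote parameters prevents other portions of the arc from
  -- returning into the neighbourhood; injectivity keeps `γ t₀` inside.
  refine ⟨l ⁻¹' T ∩ (γ '' (Icc a b \ S))ᶜ, ?_, fun P => e.symm (l P), ?_, ?_⟩
  · refine (((hT.preimage l.continuous).inter hC.isOpen_compl)).mem_nhds ⟨?_, ?_⟩
    · refine ⟨e.map_source ht₀e, ?_⟩
      change e.symm (e t₀) ∈ V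
      rw [e.left_inv ht₀e]
      exact hf0
    · rintro ⟨t, ⟨ht, htS⟩, hte⟩
      exact htS (hinj ht ht₀ hte ▸ ⟨ht₀e, hf0⟩)
  · rintro P ⟨hP, -⟩
    have h1 : ContDiffAt ℝ ∞ e.symm (l P) :=
      e.contDiffAt_symm_deriv hP.2 hP.1 (hfd _) hf.contDiffAt
    exact (h1.comp P l.contDiff.contDiffAt).contDiffWithinAt
  · rintro t ht ⟨-, hU⟩
    have htS : t ∈ S := by
      by_contra h
      exact hU ⟨t, ⟨ht, h⟩, rfl⟩
    exact e.left_inv htS.1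

variable [FiniteDimensional ℝ E]

/-- Smooth Urysohn lemma in a vector space. -/
theorem exists_contDiff_zero_one {s t : Set E} (hs : IsClosed s) (ht : IsClosed t)
    (hd : Disjoint s t) :
    ∃ f : E → ℝ, ContDiff ℝ ∞ f ∧ (∀ x ∈ s, f x = 0) ∧ (∀ x ∈ t, f x = 1) := by
  obtain ⟨f, h0, h1, -⟩ := exists_contMDiffMap_zero_one_of_isClosed (n := ⊤) 𝓘(ℝ, E) hs ht hd
  exact ⟨f, f.contMDiff.contDiff, h0, h1⟩

/-- An embedded arc has a smooth left inverse on the whole space. -/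
theorem exists_left_inverse (γ : ℝ → E) (hγ : ContDiff ℝ ∞ γ) {a b : ℝ}
    (hinj : InjOn γ (Icc a b)) (himm : ∀ t ∈ Icc a b, deriv γ t ≠ 0) :
    ∃ π : E → ℝ, ContDiff ℝ ∞ π ∧ ∀ t ∈ Icc a b, π (γ t) = t := by
  have hcl : IsClosed (γ '' Icc a b) := (isCompact_Icc.image hγ.continuous).isClosed
  -- The admissible values at `P` form a convex set (a single number on the arc, the whole line off
  -- it), so local solutions are glued by a partition of unity.
  obtain ⟨π, hπ⟩ := exists_contMDiffMap_forall_mem_convex_of_local (n := ⊤) 𝓘(ℝ, E)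
    (t := fun P : E => {r : ℝ | ∀ t ∈ Icc a b, γ t = P → r = t}) (fun P => by
      intro r hr r' hr' u v _ _ huv t ht htP
      rw [hr t ht htP, hr' t ht htP, smul_eq_mul, smul_eq_mul, ← add_mul, huv, one_mul])
    (fun P => by
      by_cases hP : P ∈ γ '' Icc a b
      · obtain ⟨t₀, ht₀, rfl⟩ := hP
        obtain ⟨U, hU, π, hπ, h⟩ := exists_local_left_inverse γ hγ hinj himm ht₀
        exact ⟨U, hU, π, hπ.contMDiffOn, fun Q hQ t ht htQ => by
          subst htQ; exact h t ht hQ⟩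
      · exact ⟨_, hcl.isOpen_compl.mem_nhds hP, fun _ => 0, contMDiffOn_const,
          fun Q hQ t ht htQ => (hQ ⟨t, ht, htQ⟩).elim⟩)
  exact ⟨π, π.contMDiff.contDiff, fun t ht => hπ (γ t) t ht rfl⟩

/-- If the linear homotopy `γ + s • δ` of a family of arcs consists of embeddings, then it is
realized by a diffeomorphism of the space. This diffeomorphism fixes a given closed set which is
avoided by the moving parts of the arcs. -/
theorem exists_diffeo_of_linear_homotopy {ι : Type*} [Finite ι] (γ δ : ι → ℝ → E)
    (hγ : ∀ i, ContDiff ℝ ∞ (γ i)) (hδ : ∀ i, ContDiff ℝ ∞ (δ i)) {a b a' b' : ℝ}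
    (hδ0 : ∀ i, ∀ t ∈ Icc a b, t ∉ Icc a' b' → δ i t = 0) {W : Set E} (hW : IsClosed W)
    (hinj : ∀ s ∈ Icc (0 : ℝ) 1, ∀ i j, ∀ t ∈ Icc a b, ∀ u ∈ Icc a b,
      γ i t + s • δ i t = γ j u + s • δ j u → i = j ∧ t = u)
    (himm : ∀ s ∈ Icc (0 : ℝ) 1, ∀ i, ∀ t ∈ Icc a b, deriv (fun t => γ i t + s • δ i t) t ≠ 0)
    (hdis : ∀ s ∈ Icc (0 : ℝ) 1, ∀ i, ∀ t ∈ Icc a b ∩ Icc a' b', γ i t + s • δ i t ∉ W) :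
    ∃ g : E ≃ E, IsDiffeo g ∧ (∀ P ∈ W, g P = P) ∧
      ∀ i, ∀ t ∈ Icc a b, g (γ i t) = γ i t + δ i t := by
  have := Fintype.ofFinite ι
  classical
  let R : ℝ → ℝ → Prop := fun s s' => ∃ g : E ≃ E, IsDiffeo g ∧ (∀ P ∈ W, g P = P) ∧
    ∀ i, ∀ t ∈ Icc a b, g (γ i t + s • δ i t) = γ i t + s' • δ i t
  suffices h : R 0 1 by simpa [R] using h
  -- By connectedness of `[0, 1]` it is enough to go from a time `s` to nearby times `s'`, together
  -- with transitivity and symmetry of `R`.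
  refine isPreconnected_Icc.induction₂ R (s := Icc (0 : ℝ) 1) ?_ ?_ ?_ (by simp) (by simp)
  · intro s hs
    have hΓ : ∀ i, ContDiff ℝ ∞ (fun t => γ i t + s • δ i t) := fun i =>
      (hγ i).add ((hδ i).const_smul s)
    have hπ : ∀ i, ∃ π : E → ℝ, ContDiff ℝ ∞ π ∧ ∀ t ∈ Icc a b, π (γ i t + s • δ i t) = t :=
      fun i => exists_left_inverse _ (hΓ i)
        (fun t ht u hu h => (hinj s hs i i t ht u hu h).2) (himm s hs i)
    choose π hπs hπl using hπ
    have hcpt : ∀ i, IsCompact ((fun t => γ i t + s • δ i t) '' Icc a b) := fun i =>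
      isCompact_Icc.image (hΓ i).continuous
    have hcpt' : ∀ i, IsCompact ((fun t => γ i t + s • δ i t) '' (Icc a b ∩ Icc a' b')) :=
      fun i => (isCompact_Icc.inter_right isClosed_Icc).image (hΓ i).continuous
    have hχ : ∀ i, ∃ χ : E → ℝ, ContDiff ℝ ∞ χ ∧ HasCompactSupport χ ∧ (∀ P ∈ W, χ P = 0) ∧
        (∀ j ≠ i, ∀ t ∈ Icc a b, χ (γ j t + s • δ j t) = 0) ∧
        (∀ t ∈ Icc a b ∩ Icc a' b', χ (γ i t + s • δ i t) = 1) := by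
      intro i
      obtain ⟨r, hr⟩ := (hcpt' i).isBounded.subset_ball 0
      obtain ⟨χ, h1, h2, h3⟩ := exists_contDiff_zero_one
        (s := W ∪ (⋃ j ∈ {j | j ≠ i}, (fun t => γ j t + s • δ j t) '' Icc a b) ∪
          (Metric.ball 0 r)ᶜ) (t := (fun t => γ i t + s • δ i t) '' (Icc a b ∩ Icc a' b'))
        ((hW.union ((toFinite _).isClosed_biUnion fun j _ => (hcpt j).isClosed)).union
          Metric.isOpen_ball.isClosed_compl) (hcpt' i).isClosed (by
          rw [disjoint_right]
          rintro _ ⟨t, ht, rfl⟩ ((h | h) | h)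
          · exact hdis s hs i t ht h
          · obtain ⟨j, hj, u, hu, huj⟩ := mem_iUnion₂.1 h
            exact hj (hinj s hs _ _ u hu t ht.1 huj).1
          · exact h (hr ⟨t, ht, rfl⟩))
      refine ⟨χ, h1, ?_, fun P hP => h2 P (Or.inl (Or.inl hP)), fun j hj t ht =>
        h2 _ (Or.inl (Or.inr (mem_iUnion₂.2 ⟨j, hj, t, ht, rfl⟩))), fun t ht => h3 _ ⟨t, ht, rfl⟩⟩
      refine HasCompactSupport.intro (isCompact_closedBall (0 : E) r) fun P hP => h2 P (Or.inr ?_)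
      exact fun h => hP (Metric.ball_subset_closedBall h)
    choose χ hχs hχc hχW hχo hχi using hχ
    -- A compactly supported field that extends the velocities `δ i` from the arcs at time `s` and
    -- vanishes on `W`. It has a Lipschitz constant `C`, so `P ↦ P + (s' - s) D P` is a
    -- diffeomorphism once `|s' - s| C < 1`.
    let D : E → E := fun P => ∑ i, χ i P • δ i (π i P)
    have hD : ContDiff ℝ ∞ D := ContDiff.sum fun i _ => (hχs i).smul ((hδ i).comp (hπs i))
    have hDc : HasCompactSupport D := by
      refine HasCompactSupport.intro (K := ⋃ i, tsupport (χ i))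
        (isCompact_iUnion fun i => hχc i) fun P hP => ?_
      refine Finset.sum_eq_zero fun i _ => ?_
      rw [image_eq_zero_of_notMem_tsupport fun h => hP (mem_iUnion.2 ⟨i, h⟩), zero_smul]
    have hDW : ∀ P ∈ W, D P = 0 := fun P hP =>
      Finset.sum_eq_zero fun i _ => by rw [hχW i P hP, zero_smul]
    have hDγ : ∀ i, ∀ t ∈ Icc a b, D (γ i t + s • δ i t) = δ i t := by
      intro i t ht
      have : D (γ i t + s • δ i t) =
          χ i (γ i t + s • δ i t) • δ i (π i (γ i t + s • δ i t)) := by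
        refine Finset.sum_eq_single i (fun j _ hj => ?_) (by simp)
        rw [hχo j i hj.symm t ht, zero_smul]
      rw [this, hπl i t ht]
      -- The cut-off equals `1` only on the moving portion of the arc; elsewhere `δ` is zero anyway.
      -- This permits the arcs to end in `W`.
      by_cases h : t ∈ Icc a' b'
      · rw [hχi i t ⟨ht, h⟩, one_smul]
      · rw [hδ0 i t ht h, smul_zero]
    obtain ⟨C, hC⟩ := hD.lipschitzWith_of_hasCompactSupport (𝕂 := ℝ) hDc (by simp)
    have hsmall : ∀ᶠ s' in 𝓝[Icc 0 1] s, ‖s' - s‖₊ * C < 1 := by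
      apply mem_nhdsWithin_of_mem_nhds
      have : ContinuousAt (fun s' : ℝ => ‖s' - s‖₊ * C) s := by fun_prop
      refine this.eventually_lt continuousAt_const ?_
      simp
    filter_upwards [hsmall] with s' hs'
    obtain ⟨g, hg, hgD⟩ := exists_diffeo_add (fun P => (s' - s) • D P) (hD.const_smul _) _ hs'
      ((lipschitzWith_smul (s' - s)).comp hC)
    refine ⟨g, hg, fun P hP => ?_, fun i t ht => ?_⟩
    · rw [hgD, hDW P hP, smul_zero, add_zero]
    · rw [hgD, hDγ i t ht, sub_smul]
      abel
  · rintro s s' s'' _ _ _ ⟨g, hg, hgW, hgγ⟩ ⟨g', hg', hgW', hgγ'⟩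
    refine ⟨g.trans g', hg.trans hg', fun P hP => ?_, fun i t ht => ?_⟩
    · rw [Equiv.trans_apply, hgW P hP, hgW' P hP]
    · rw [Equiv.trans_apply, hgγ i t ht, hgγ' i t ht]
  · rintro s s' _ _ ⟨g, hg, hgW, hgγ⟩
    refine ⟨g.symm, hg.symm, fun P hP => ?_, fun i t ht => ?_⟩
    · rw [Equiv.symm_apply_eq, hgW P hP]
    · rw [Equiv.symm_apply_eq, hgγ i t ht]

end LinearIsotopy

/-! ### Oriented arcs -/

/-- A convex set with interior points determines derivatives up to its boundary. This allows curves
to be cut along a plane `x = a` without losing control of the tangent vectors at the cut. -/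
theorem push_congr {g h : Space → Space} {S : Set Space} (hS : Convex ℝ S)
    (hS' : (interior S).Nonempty) (hg : Differentiable ℝ g) (hh : Differentiable ℝ h)
    (hgh : EqOn g h S) {u : Space × Space} (hu : u.1 ∈ S) : push g u = push h u := by
  have hU := uniqueDiffOn_convex hS hS' u.1 hu
  simp only [push, hgh hu]
  rw [← (hg u.1).fderivWithin hU, ← (hh u.1).fderivWithin hU, fderivWithin_congr hgh (hgh hu)]

theorem push_orientedArc {g : Space → Space} (hg : Differentiable ℝ g) {γ : ℝ → Space}
    (hγ : Differentiable ℝ γ) (I : Set ℝ) (s : ℝ) :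
    push g '' orientedArc γ I s = orientedArc (g ∘ γ) I s := by
  have hd : ∀ t, deriv (g ∘ γ) t = fderiv ℝ g (γ t) (deriv γ t) := fun t =>
    fderiv_comp_deriv t (hg _) (hγ t)
  ext u
  constructor
  · rintro ⟨_, ⟨t, ht, c, hc, rfl⟩, rfl⟩
    exact ⟨t, ht, c, hc, by simp [push, hd]⟩
  · rintro ⟨t, ht, c, hc, rfl⟩
    exact ⟨_, ⟨t, ht, c, hc, rfl⟩, by simp [push, hd]⟩

/-- One-sided derivatives determine the tangent vectors at the two ends, so the behaviour of the
curves outside the closed interval is irrelevant. -/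
theorem orientedArc_congr {γ γ' : ℝ → Space} (hγ : Differentiable ℝ γ) (hγ' : Differentiable ℝ γ')
    {a b : ℝ} (hab : a < b) (h : EqOn γ γ' (Icc a b)) (s : ℝ) :
    orientedArc γ (Icc a b) s = orientedArc γ' (Icc a b) s := by
  have hd : ∀ t ∈ Icc a b, deriv γ t = deriv γ' t := by
    intro t ht
    have hU := uniqueDiffOn_Icc hab t ht
    rw [← (hγ t).derivWithin hU, ← (hγ' t).derivWithin hU, derivWithin_congr h (h ht)]
  ext u
  constructor
  · rintro ⟨t, ht, c, hc, rfl⟩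
    exact ⟨t, ht, c, hc, by rw [h ht, hd t ht]⟩
  · rintro ⟨t, ht, c, hc, rfl⟩
    exact ⟨t, ht, c, hc, by rw [h ht, hd t ht]⟩

theorem orientedArc_union (γ : ℝ → Space) (I J : Set ℝ) (s : ℝ) :
    orientedArc γ (I ∪ J) s = orientedArc γ I s ∪ orientedArc γ J s := by
  ext u
  simp only [orientedArc, mem_ofPred_eq, mem_union]
  constructor
  · rintro ⟨t, ht | ht, h⟩
    · exact Or.inl ⟨t, ht, h⟩
    · exact Or.inr ⟨t, ht, h⟩
  · rintro (⟨t, ht, h⟩ | ⟨t, ht, h⟩)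
    · exact ⟨t, Or.inl ht, h⟩
    · exact ⟨t, Or.inr ht, h⟩

theorem orientedArc_Icc_union (γ : ℝ → Space) {a b c : ℝ} (hab : a ≤ b) (hbc : b ≤ c) (s : ℝ) :
    orientedArc γ (Icc a c) s = orientedArc γ (Icc a b) s ∪ orientedArc γ (Icc b c) s := by
  rw [← orientedArc_union, Icc_union_Icc_eq_Icc hab hbc]

/-- A change of parameter whose derivative has the sign `ε`. -/
theorem orientedArc_comp {γ : ℝ → Space} {φ : ℝ → ℝ} (hγ : Differentiable ℝ γ)
    (hφ : Differentiable ℝ φ) {I : Set ℝ} {ε : ℝ} (hε : ε * ε = 1)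
    (h : ∀ t ∈ I, 0 < ε * deriv φ t) (s : ℝ) :
    orientedArc (γ ∘ φ) I s = orientedArc γ (φ '' I) (ε * s) := by
  have hd : ∀ t, deriv (γ ∘ φ) t = deriv φ t • deriv γ (φ t) := fun t =>
    deriv.scomp t (hγ _) (hφ t)
  ext u
  constructor
  · rintro ⟨t, ht, c, hc, rfl⟩
    refine ⟨φ t, ⟨t, ht, rfl⟩, c * (ε * deriv φ t), mul_pos hc (h t ht), ?_⟩
    rw [hd, smul_smul, Function.comp]
    congr 2
    linear_combination (-c * deriv φ t * s) * hε
  · rintro ⟨_, ⟨t, ht, rfl⟩, c, hc, rfl⟩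
    refine ⟨t, ht, c / (ε * deriv φ t), div_pos hc (h t ht), ?_⟩
    rw [hd, smul_smul, Function.comp]
    congr 2
    have h0 := (h t ht).ne'
    have h1 : ε ≠ 0 := left_ne_zero_of_mul h0
    have h2 : deriv φ t ≠ 0 := right_ne_zero_of_mul h0
    field_simp
    linear_combination s * hε

theorem orientedArc_comp_of_eqOn {γ γ' : ℝ → Space} {φ : ℝ → ℝ} (hγ : Differentiable ℝ γ)
    (hγ' : Differentiable ℝ γ') (hφ : Differentiable ℝ φ) {a b : ℝ} (hab : a < b) {I : Set ℝ}
    {ε : ℝ} (hε : ε * ε = 1) (h : ∀ t ∈ Icc a b, 0 < ε * deriv φ t) (hI : φ '' Icc a b = I)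
    (he : ∀ t ∈ Icc a b, γ t = γ' (φ t)) (s : ℝ) :
    orientedArc γ (Icc a b) s = orientedArc γ' I (ε * s) := by
  rw [orientedArc_congr hγ (hγ'.comp hφ) hab he, orientedArc_comp hγ' hφ hε h, hI]

/-- Translation along the `x`-axis. -/
def shift (a : ℝ) : Space ≃ Space := Equiv.addRight ((a, 0, 0) : Space)

theorem shift_apply (a : ℝ) (P : Space) : shift a P = P + (a, 0, 0) := rfl

theorem shift_apply_fst (a : ℝ) (P : Space) : (shift a P).1 = P.1 + a := rfl

theorem shift_symm (a : ℝ) : (shift a).symm = shift (-a) := by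
  ext P <;> simp [shift]

theorem isDiffeo_shift (a : ℝ) : IsDiffeo (shift a) := by
  have : ∀ a, ContDiff ℝ ∞ (shift a) := fun a => contDiff_id.add contDiff_const
  exact ⟨this a, by rw [shift_symm]; exact this _⟩

theorem push_shift_fst (a : ℝ) (u : Space × Space) : (push (shift a) u).1.1 = u.1.1 + a := rfl

theorem shift_zero : shift 0 = Equiv.refl Space := by
  ext P <;> simp [shift]

theorem shift_trans (a b : ℝ) : (shift a).trans (shift b) = shift (a + b) := by
  ext P <;> simp [shift, add_assoc]

theorem push_shift_shift (a b : ℝ) (K : OrientedCurves) :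
    push (shift b) '' (push (shift a) '' K) = push (shift (a + b)) '' K := by
  rw [← push_image_trans (isDiffeo_shift a) (isDiffeo_shift b), shift_trans]

theorem push_shift_zero (K : OrientedCurves) : push (shift 0) '' K = K := by
  rw [shift_zero, push_id, image_id]

theorem convex_fst_le (a : ℝ) : Convex ℝ {P : Space | P.1 ≤ a} :=
  (convex_Iic a).linear_preimage (LinearMap.fst ℝ ℝ (ℝ × ℝ))

theorem convex_le_fst (a : ℝ) : Convex ℝ {P : Space | a ≤ P.1} :=
  (convex_Ici a).linear_preimage (LinearMap.fst ℝ ℝ (ℝ × ℝ))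

theorem interior_fst_le (a : ℝ) : (interior {P : Space | P.1 ≤ a}).Nonempty := by
  refine ⟨(a - 1, 0, 0), mem_interior.2 ⟨{P : Space | P.1 < a}, fun P (hP : P.1 < a) => hP.le, ?_, ?_⟩⟩
  · exact isOpen_lt continuous_fst continuous_const
  · simp

theorem interior_le_fst (a : ℝ) : (interior {P : Space | a ≤ P.1}).Nonempty := by
  refine ⟨(a + 1, 0, 0), mem_interior.2 ⟨{P : Space | a < P.1}, fun P (hP : a < P.1) => hP.le, ?_, ?_⟩⟩
  · exact isOpen_lt continuous_const continuous_fst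
  · simp

theorem push_eq_self_of_fst_le {g : Space ≃ Space} (hg : IsDiffeo g) {a : ℝ}
    (h : ∀ P : Space, P.1 ≤ a → g P = P) {u : Space × Space} (hu : u.1.1 ≤ a) : push g u = u := by
  have := push_congr (convex_fst_le a) (interior_fst_le a) hg.differentiable differentiable_id h hu
  rw [this]
  exact congrFun push_id u

/-- Images of curves in a half-space on which a diffeomorphism is a translation. -/
theorem push_image_of_le_fst {g : Space ≃ Space} (hg : IsDiffeo g) {a c : ℝ}
    (h : ∀ P : Space, a ≤ P.1 → g P = shift c P) {K : OrientedCurves}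
    (hK : ∀ u ∈ K, a ≤ u.1.1) : push g '' K = push (shift c) '' K :=
  image_congr fun u hu => push_congr (convex_le_fst a) (interior_le_fst a) hg.differentiable
    (isDiffeo_shift c).differentiable h (hK u hu)

theorem push_image_of_fst_le {g : Space ≃ Space} (hg : IsDiffeo g) {a : ℝ}
    (h : ∀ P : Space, P.1 ≤ a → g P = P) {K : OrientedCurves}
    (hK : ∀ u ∈ K, u.1.1 ≤ a) : push g '' K = K := by
  rw [image_congr fun u hu => push_eq_self_of_fst_le hg h (hK u hu)]
  exact image_id' K

/-! ### Rotations about axes parallel to the `x`-axis -/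

/-- The rotation about the axis `y = c`, `z = 0` by an angle which depends on `x` and on the square
of the distance from the axis. -/
def axisRotation (c : ℝ) (ψ : ℝ × ℝ → ℝ) (P : Space) : Space :=
  (P.1, c + ((P.2.1 - c) * Real.cos (ψ (P.1, (P.2.1 - c) ^ 2 + P.2.2 ^ 2)) -
      P.2.2 * Real.sin (ψ (P.1, (P.2.1 - c) ^ 2 + P.2.2 ^ 2))),
    (P.2.1 - c) * Real.sin (ψ (P.1, (P.2.1 - c) ^ 2 + P.2.2 ^ 2)) +
      P.2.2 * Real.cos (ψ (P.1, (P.2.1 - c) ^ 2 + P.2.2 ^ 2)))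

theorem axisRotation_neg_axisRotation (c : ℝ) (ψ : ℝ × ℝ → ℝ) (P : Space) :
    axisRotation c (fun v => -ψ v) (axisRotation c ψ P) = P := by
  obtain ⟨x, y, z⟩ := P
  have h : ∀ a : ℝ, (c + ((y - c) * Real.cos a - z * Real.sin a) - c) ^ 2 +
      ((y - c) * Real.sin a + z * Real.cos a) ^ 2 = (y - c) ^ 2 + z ^ 2 := by
    intro a
    linear_combination ((y - c) ^ 2 + z ^ 2) * Real.sin_sq_add_cos_sq a
  simp only [axisRotation, h, Real.cos_neg, Real.sin_neg]
  generalize ψ (x, (y - c) ^ 2 + z ^ 2) = a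
  have := Real.sin_sq_add_cos_sq a
  refine Prod.ext rfl (Prod.ext ?_ ?_)
  · change _ = y
    linear_combination (y - c) * this
  · change _ = z
    linear_combination z * this

theorem contDiff_axisRotation (c : ℝ) {ψ : ℝ × ℝ → ℝ} (hψ : ContDiff ℝ ∞ ψ) :
    ContDiff ℝ ∞ (axisRotation c ψ) := by
  have h : ContDiff ℝ ∞ fun P : Space => ψ (P.1, (P.2.1 - c) ^ 2 + P.2.2 ^ 2) :=
    hψ.comp (by fun_prop)
  unfold axisRotation
  have hc := h.cos
  have hs := h.sin
  fun_prop

def axisRotationEquiv (c : ℝ) (ψ : ℝ × ℝ → ℝ) : Space ≃ Space where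
  toFun := axisRotation c ψ
  invFun := axisRotation c fun v => -ψ v
  left_inv := axisRotation_neg_axisRotation c ψ
  right_inv P := by simpa using axisRotation_neg_axisRotation c (fun v => -ψ v) P

theorem coe_axisRotationEquiv (c : ℝ) (ψ : ℝ × ℝ → ℝ) :
    ⇑(axisRotationEquiv c ψ) = axisRotation c ψ := rfl

theorem coe_axisRotationEquiv_symm (c : ℝ) (ψ : ℝ × ℝ → ℝ) :
    ⇑(axisRotationEquiv c ψ).symm = axisRotation c fun v => -ψ v := rfl

theorem isDiffeo_axisRotationEquiv (c : ℝ) {ψ : ℝ × ℝ → ℝ} (hψ : ContDiff ℝ ∞ ψ) :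
    IsDiffeo (axisRotationEquiv c ψ) := by
  have h : ContDiff ℝ ∞ fun v => -ψ v := hψ.neg
  rw [IsDiffeo, coe_axisRotationEquiv, coe_axisRotationEquiv_symm]
  exact ⟨contDiff_axisRotation c hψ, contDiff_axisRotation c h⟩

theorem axisRotation_eq_self {c : ℝ} {ψ : ℝ × ℝ → ℝ} {P : Space}
    (h : ψ (P.1, (P.2.1 - c) ^ 2 + P.2.2 ^ 2) = 0) : axisRotation c ψ P = P := by
  simp [axisRotation, h]

/-- Rotation of a point given in polar coordinates. -/
theorem axisRotation_polar (c : ℝ) (ψ : ℝ × ℝ → ℝ) (x h a : ℝ) :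
    axisRotation c ψ (x, c + h * Real.cos a, h * Real.sin a) =
      (x, c + h * Real.cos (a + ψ (x, h ^ 2)), h * Real.sin (a + ψ (x, h ^ 2))) := by
  have : (c + h * Real.cos a - c) ^ 2 + (h * Real.sin a) ^ 2 = h ^ 2 := by
    linear_combination h ^ 2 * Real.sin_sq_add_cos_sq a
  simp only [axisRotation, this, Real.cos_add, Real.sin_add]
  refine Prod.ext rfl (Prod.ext ?_ ?_)
  · change c + _ = c + _; ring
  · change _ * _ + _ = _; ring

/-! ### Oriented tangles -/

/-- A family of oriented curves in the half-space `x ≥ 0`, with four ends on the plane `x = 0`.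
The curves depend on the directions of the ends, which are subject to restrictions. -/
structure OTangle where
  valid : Set (Fin 4 → ℝ)
  curves : (Fin 4 → ℝ) → OrientedCurves
  nonneg : ∀ d, ∀ u ∈ curves d, 0 ≤ u.1.1

namespace OTangle

/-- Equivalence of tangles: diffeomorphism, relative to the half-space `x ≤ 0`. -/
def Equivalent (T T' : OTangle) : Prop :=
  T.valid = T'.valid ∧ ∃ g : Space ≃ Space, IsDiffeo g ∧ (∀ P : Space, P.1 ≤ 0 → g P = P) ∧
    ∀ d ∈ T.valid, push g '' T.curves d = T'.curves d

theorem Equivalent.refl (T : OTangle) : T.Equivalent T :=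
  ⟨rfl, Equiv.refl _, IsDiffeo.refl, fun _ _ => rfl, fun d _ => by rw [push_id, image_id]⟩

theorem Equivalent.symm {T T' : OTangle} (h : T.Equivalent T') : T'.Equivalent T := by
  obtain ⟨hv, g, hg, hf, h⟩ := h
  refine ⟨hv.symm, g.symm, hg.symm, fun P hP => ?_, fun d hd => ?_⟩
  · rw [Equiv.symm_apply_eq, hf P hP]
  · rw [← h d (hv ▸ hd), push_symm_image hg]

theorem Equivalent.trans {T T' T'' : OTangle} (h : T.Equivalent T') (h' : T'.Equivalent T'') :
    T.Equivalent T'' := by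
  obtain ⟨hv, g, hg, hf, h⟩ := h
  obtain ⟨hv', g', hg', hf', h'⟩ := h'
  refine ⟨hv.trans hv', g.trans g', hg.trans hg', fun P hP => ?_, fun d hd => ?_⟩
  · rw [Equiv.trans_apply, hf P hP, hf' P hP]
  · rw [push_image_trans hg hg', h d hd, h' d (hv ▸ hd)]

instance setoid : Setoid OTangle :=
  ⟨Equivalent, Equivalent.refl, Equivalent.symm, Equivalent.trans⟩

end OTangle

/-! ### Blocks -/

/-- The strand of a block which starts at position `j` of the plane `x = 0`, with the angle of
rotation `θ`. -/
def blockStrand (k : ℕ) (θ : ℝ → ℝ) (j : Fin 4) (x : ℝ) : Space :=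
  if j = upperPos k ∨ j = upperPos k + 1 then
    (x, axisHeight k + (height j - axisHeight k) * Real.cos (θ x),
      (height j - axisHeight k) * Real.sin (θ x))
  else (x, height j, 0)

theorem blockStrand_fst (k : ℕ) (θ : ℝ → ℝ) (j : Fin 4) (x : ℝ) :
    (blockStrand k θ j x).1 = x := by
  unfold blockStrand; split_ifs <;> rfl

theorem contDiff_blockStrand (k : ℕ) {θ : ℝ → ℝ} (hθ : ContDiff ℝ ∞ θ) (j : Fin 4) :
    ContDiff ℝ ∞ (blockStrand k θ j) := by
  unfold blockStrand
  split_ifs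
  · have h1 := hθ.cos
    have h2 := hθ.sin
    fun_prop
  · fun_prop

theorem differentiable_blockStrand (k : ℕ) {θ : ℝ → ℝ} (hθ : ContDiff ℝ ∞ θ) (j : Fin 4) :
    Differentiable ℝ (blockStrand k θ j) :=
  (contDiff_blockStrand k hθ j).differentiable (by simp)

/-- The permutation of the positions in a block with `b` half twists. -/
def blockPerm (k : ℕ) (b : ℤ) : Fin 4 → Fin 4 :=
  if Odd b then Equiv.swap (upperPos k) (upperPos k + 1) else id

/-- Strands are indexed by their left ends, and `d` gives the directions there; at the right ends
the directions are `d ∘ blockPerm k b`. -/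
def block (k : ℕ) (θ : ℝ → ℝ) (d : Fin 4 → ℝ) : OrientedCurves :=
  ⋃ j, orientedArc (blockStrand k θ j) (Icc 0 1) (d j)

theorem mem_block_fst {k : ℕ} {θ : ℝ → ℝ} {d : Fin 4 → ℝ} {u : Space × Space}
    (hu : u ∈ block k θ d) : u.1.1 ∈ Icc (0 : ℝ) 1 := by
  obtain ⟨j, t, ht, c, -, rfl⟩ := mem_iUnion.1 hu
  simpa [blockStrand_fst] using ht

/-- A tangle preceded by a block with `b` half twists and the angle of rotation `θ`. -/
def profTwist (k : ℕ) (b : ℤ) (θ : ℝ → ℝ) (T : OTangle) : OTangle where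
  valid := {d | d ∘ blockPerm k b ∈ T.valid}
  curves d := block k θ d ∪ push (shift 1) '' T.curves (d ∘ blockPerm k b)
  nonneg := by
    rintro d u (hu | ⟨v, hv, rfl⟩)
    · exact (mem_block_fst hu).1
    · rw [push_shift_fst]
      linarith [T.nonneg _ v hv]

/-- The angle of rotation of the natural diagram, in a block starting at `x = 0`. -/
def naturalAngle (k : ℕ) (b : ℤ) (x : ℝ) : ℝ :=
  (-1) ^ k * b * Real.pi * Real.smoothTransition x

theorem contDiff_naturalAngle (k : ℕ) (b : ℤ) : ContDiff ℝ ∞ (naturalAngle k b) :=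
  contDiff_const.mul Real.smoothTransition.contDiff

def twist (k : ℕ) (b : ℤ) (T : OTangle) : OTangle := profTwist k b (naturalAngle k b) T

/-- The diffeomorphism is conjugated with the unit shift. The result is the identity on `x ≤ 1`,
hence on the added block. -/
theorem twist_congr {k : ℕ} {b : ℤ} {T T' : OTangle} (h : T ≈ T') :
    twist k b T ≈ twist k b T' := by
  obtain ⟨hv, g, hg, hf, h⟩ := h
  refine ⟨?_, ((shift 1).symm.trans g).trans (shift 1),
    ((isDiffeo_shift 1).symm.trans hg).trans (isDiffeo_shift 1), ?_, ?_⟩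
  · simp only [twist, profTwist, hv]
  · intro P hP
    have : g ((shift 1).symm P) = (shift 1).symm P := hf _ (by
      rw [shift_symm, shift_apply_fst]; linarith)
    simp [this]
  · intro d hd
    have hG := ((isDiffeo_shift 1).symm.trans hg).trans (isDiffeo_shift 1)
    change push _ '' (_ ∪ _) = _ ∪ _
    rw [image_union]
    congr 1
    · refine push_image_of_fst_le hG (a := 1) (fun P hP => ?_) fun u hu => (mem_block_fst hu).2
      have : g ((shift 1).symm P) = (shift 1).symm P := hf _ (by
        rw [shift_symm, shift_apply_fst]; linarith)
      simp [this]
    · rw [push_image_trans ((isDiffeo_shift 1).symm.trans hg) (isDiffeo_shift 1),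
        push_image_trans (isDiffeo_shift 1).symm hg, push_symm_image (isDiffeo_shift 1), h _ hd]

/-! ### Change of the angle of rotation -/

/-- With the bound `9 / 4` for the remaining strands, this gap in the squared distance from the axis
leaves room for a radial cut-off that rotates the twisted pair only. -/
theorem height_sub_axisHeight_sq {k : ℕ} {j : Fin 4} (h : j = upperPos k ∨ j = upperPos k + 1) :
    (height j - axisHeight k) ^ 2 = 1 / 4 := by
  unfold upperPos at h
  unfold height axisHeight
  split_ifs at h ⊢ <;> rcases h with rfl | rfl <;>
    norm_num [show ((1 + 1 : Fin 4) : ℕ) = 2 from rfl]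

theorem height_sub_axisHeight_sq' {k : ℕ} {j : Fin 4}
    (h : ¬(j = upperPos k ∨ j = upperPos k + 1)) :
    9 / 4 ≤ (height j - axisHeight k) ^ 2 := by
  unfold upperPos at h
  unfold height axisHeight
  split_ifs at h ⊢ <;> fin_cases j <;> simp at h ⊢ <;> norm_num

theorem axisRotation_blockStrand (k : ℕ) (θ : ℝ → ℝ) (ψ : ℝ × ℝ → ℝ) (j : Fin 4) (x : ℝ)
    (h : ∀ ρ, 9 / 4 ≤ ρ → ψ (x, ρ) = 0) :
    axisRotation (axisHeight k) ψ (blockStrand k θ j x) =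
      blockStrand k (fun x => θ x + ψ (x, 1 / 4)) j x := by
  by_cases hj : j = upperPos k ∨ j = upperPos k + 1
  · simp only [blockStrand, if_pos hj]
    rw [axisRotation_polar, height_sub_axisHeight_sq hj]
  · simp only [blockStrand, if_neg hj]
    apply axisRotation_eq_self
    apply h
    simpa using height_sub_axisHeight_sq' hj

/-- A cut-off function of the squared distance from the axis of a block. -/
def radialCutoff (ρ : ℝ) : ℝ := Real.smoothTransition (5 / 4 - ρ)

theorem contDiff_radialCutoff : ContDiff ℝ ∞ radialCutoff :=
  Real.smoothTransition.contDiff.comp (contDiff_const.sub contDiff_id)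

theorem radialCutoff_of_le {ρ : ℝ} (h : ρ ≤ 1 / 4) : radialCutoff ρ = 1 :=
  Real.smoothTransition.one_of_one_le (by linarith)

theorem radialCutoff_of_ge {ρ : ℝ} (h : 9 / 4 ≤ ρ) : radialCutoff ρ = 0 :=
  Real.smoothTransition.zero_of_nonpos (by linarith)

/-- Each cross-section is rotated about the axis by `θ' - θ`, damped radially before the other
strands are reached. The angle is zero outside `0 < x < 1`, so neither the left half-space nor the
rest of the tangle moves. -/
theorem profTwist_equiv {k : ℕ} {b : ℤ} {θ θ' : ℝ → ℝ} (hθ : ContDiff ℝ ∞ θ)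
    (hθ' : ContDiff ℝ ∞ θ') (h0 : ∀ x ≤ 0, θ x = θ' x) (h1 : ∀ x, 1 ≤ x → θ x = θ' x)
    (T : OTangle) : profTwist k b θ T ≈ profTwist k b θ' T := by
  let ψ : ℝ × ℝ → ℝ := fun v => (θ' v.1 - θ v.1) * radialCutoff v.2
  have hψ : ContDiff ℝ ∞ ψ :=
    ((hθ'.comp contDiff_fst).sub (hθ.comp contDiff_fst)).mul
      (contDiff_radialCutoff.comp contDiff_snd)
  have hg := isDiffeo_axisRotationEquiv (axisHeight k) hψ
  refine ⟨rfl, axisRotationEquiv (axisHeight k) ψ, hg, fun P hP => axisRotation_eq_self ?_,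
    fun d hd => ?_⟩
  · simp [ψ, h0 _ hP]
  · change push _ '' (_ ∪ _) = _ ∪ _
    rw [image_union]
    congr 1
    · unfold block
      rw [image_iUnion]
      congr 1
      funext j
      rw [push_orientedArc hg.differentiable (differentiable_blockStrand k hθ j)]
      congr 1
      funext x
      refine (axisRotation_blockStrand k θ ψ j x fun ρ hρ => ?_).trans ?_
      · simp [ψ, radialCutoff_of_ge hρ]
      · simp [ψ, radialCutoff_of_le, blockStrand]
    · rw [push_image_of_le_fst hg (a := 1) (c := 0) (fun P hP => ?_), push_shift_zero]
      · rintro _ ⟨u, hu, rfl⟩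
        rw [push_shift_fst]
        linarith [T.nonneg _ u hu]
      · rw [shift_zero]
        exact axisRotation_eq_self (by simp [ψ, h1 _ hP])

/-! ### Merging two blocks -/

/-- A diffeomorphism of the line that compresses `[0, 2]` to `[0, 1]`. -/
theorem exists_compression : ∃ f : ℝ ≃ ℝ, IsDiffeo f ∧ (∀ x ≤ 0, f x = x) ∧
    (∀ x, 2 ≤ x → f x = x - 1) ∧ ∀ x, 0 < deriv f x := by
  -- The compression is `x - I⁻¹ ∫₀ˣ B`. The bump is supported in `[0, 2]` and equals `1` on `[1/4,
  -- 7/4]`, so its integral `I` is at least `3 / 2`. Thus the total displacement is `1`, while the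
  -- slope `1 - I⁻¹ B` stays positive.
  let B : ℝ → ℝ := fun x => Real.smoothTransition (4 * x) * Real.smoothTransition (4 * (2 - x))
  have hB : ContDiff ℝ ∞ B :=
    (Real.smoothTransition.contDiff.comp (by fun_prop)).mul
      (Real.smoothTransition.contDiff.comp (by fun_prop))
  have hB0 : ∀ x, 0 ≤ B x := fun x =>
    mul_nonneg (Real.smoothTransition.nonneg _) (Real.smoothTransition.nonneg _)
  have hB1 : ∀ x, B x ≤ 1 := fun x =>
    mul_le_one₀ (Real.smoothTransition.le_one _) (Real.smoothTransition.nonneg _)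
      (Real.smoothTransition.le_one _)
  have hBl : ∀ x ≤ 0, B x = 0 := fun x hx => by
    simp only [B]
    rw [Real.smoothTransition.zero_of_nonpos (by linarith), zero_mul]
  have hBr : ∀ x, 2 ≤ x → B x = 0 := fun x hx => by
    simp only [B]
    rw [Real.smoothTransition.zero_of_nonpos (x := 4 * (2 - x)) (by linarith), mul_zero]
  have hBm : ∀ x ∈ Icc (1 / 4 : ℝ) (7 / 4), B x = 1 := fun x hx => by
    simp only [B]
    rw [Real.smoothTransition.one_of_one_le (by linarith [hx.1]),
      Real.smoothTransition.one_of_one_le (by linarith [hx.2]), one_mul]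
  have hint : ∀ a b, IntervalIntegrable B MeasureTheory.volume a b := fun a b =>
    hB.continuous.intervalIntegrable a b
  let I : ℝ := ∫ t in (0 : ℝ)..2, B t
  have hI : 1 < I := by
    have h1 : ∫ t in (1 / 4 : ℝ)..(7 / 4), B t = 3 / 2 := by
      rw [intervalIntegral.integral_congr (g := fun _ => (1 : ℝ))]
      · simp; norm_num
      · intro x hx
        rw [uIcc_of_le (by norm_num)] at hx
        exact hBm x hx
    have h2 : ∫ t in (1 / 4 : ℝ)..(7 / 4), B t ≤ I :=
      intervalIntegral.integral_mono_interval (by norm_num) (by norm_num) (by norm_num)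
        (Eventually.of_forall hB0) (hint _ _)
    linarith
  let F : ℝ → ℝ := fun x => ∫ t in (0 : ℝ)..x, B t
  have hFd : ∀ x, HasDerivAt F (B x) x := fun x =>
    intervalIntegral.integral_hasDerivAt_right (hint _ _)
      (hB.continuous.stronglyMeasurableAtFilter _ _) hB.continuous.continuousAt
  have hF : ContDiff ℝ ∞ F := by
    rw [contDiff_infty_iff_deriv]
    refine ⟨fun x => (hFd x).differentiableAt, ?_⟩
    rwa [show deriv F = B from funext fun x => (hFd x).deriv]
  let D : ℝ → ℝ := fun x => -(I⁻¹ * F x)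
  have hDd : ∀ x, HasDerivAt D (-(I⁻¹ * B x)) x := fun x => ((hFd x).const_mul _).neg
  have hI' : I⁻¹ < 1 := inv_lt_one_of_one_lt₀ hI
  have hI0 : 0 < I⁻¹ := inv_pos.2 (by linarith)
  obtain ⟨g, hg, hgD⟩ := exists_diffeo_add D (hF.const_smul I⁻¹).neg (.mk I⁻¹ hI0.le)
    (by exact_mod_cast hI') (lipschitzWith_of_nnnorm_deriv_le
      (fun x => (hDd x).differentiableAt) fun x => by
        rw [(hDd x).deriv, ← NNReal.coe_le_coe]
        simp only [coe_nnnorm, norm_neg, norm_mul, Real.norm_eq_abs, abs_of_pos hI0,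
          abs_of_nonneg (hB0 x)]
        exact mul_le_of_le_one_right hI0.le (hB1 x))
  refine ⟨g, hg, fun x hx => ?_, fun x hx => ?_, fun x => ?_⟩
  · have : F x = 0 := by
      simp only [F]
      rw [intervalIntegral.integral_congr (g := fun _ => (0 : ℝ)), intervalIntegral.integral_zero]
      intro t ht
      rw [uIcc_of_ge hx] at ht
      exact hBl t ht.2
    simp [hgD, D, this]
  · have : F x = I := by
      simp only [F]
      rw [← intervalIntegral.integral_add_adjacent_intervals (hint 0 2) (hint 2 x)]
      rw [intervalIntegral.integral_congr (a := 2) (b := x) (g := fun _ => (0 : ℝ)),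
        intervalIntegral.integral_zero, add_zero]
      intro t ht
      rw [uIcc_of_le hx] at ht
      exact hBr t ht.1
    rw [hgD]
    simp only [D]
    rw [this, inv_mul_cancel₀ (by linarith)]
    ring
  · have h : HasDerivAt g (1 + -(I⁻¹ * B x)) x := by
      rw [show (g : ℝ → ℝ) = fun P => P + D P from funext hgD]
      exact (hasDerivAt_id x).add (hDd x)
    rw [h.deriv]
    have := mul_le_of_le_one_right hI0.le (hB1 x)
    linarith

theorem image_Icc_of_deriv_pos {f : ℝ ≃ ℝ} (h : ∀ x, 0 < deriv f x) (a b : ℝ) :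
    f '' Icc a b = Icc (f a) (f b) :=
  ((strictMono_of_deriv_pos h).orderIsoOfSurjective f f.surjective).image_Icc a b

theorem blockPerm_involutive (k : ℕ) (b : ℤ) : Function.Involutive (blockPerm k b) := by
  unfold blockPerm
  split_ifs
  · intro j; simp
  · exact fun _ => rfl

theorem blockPerm_comp (k : ℕ) (a b : ℤ) :
    blockPerm k a ∘ blockPerm k b = blockPerm k (a + b) := by
  funext j
  by_cases ha : Odd a <;> by_cases hb : Odd b <;>
    simp [blockPerm, Int.odd_add, ha, hb, ← Int.not_odd_iff_even]

theorem height_upperPos (k : ℕ) : height (upperPos k) - axisHeight k = 1 / 2 := by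
  unfold height upperPos axisHeight; split_ifs <;> norm_num

theorem height_upperPos_succ (k : ℕ) : height (upperPos k + 1) - axisHeight k = -1 / 2 := by
  unfold height upperPos axisHeight
  split_ifs <;> norm_num [show ((1 + 1 : Fin 4) : ℕ) = 2 from rfl]

theorem blockPerm_mem_iff (k : ℕ) (b : ℤ) (j : Fin 4) :
    (blockPerm k b j = upperPos k ∨ blockPerm k b j = upperPos k + 1) ↔
      (j = upperPos k ∨ j = upperPos k + 1) := by
  unfold blockPerm
  split_ifs
  · rw [Equiv.swap_apply_eq_iff, Equiv.swap_apply_eq_iff, Equiv.swap_apply_left,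
      Equiv.swap_apply_right, or_comm]
  · rfl

theorem blockPerm_of_not (k : ℕ) (b : ℤ) {j : Fin 4}
    (h : ¬(j = upperPos k ∨ j = upperPos k + 1)) : blockPerm k b j = j := by
  push Not at h
  unfold blockPerm
  split_ifs
  · exact Equiv.swap_apply_of_ne_of_ne h.1 h.2
  · rfl

theorem height_blockPerm (k : ℕ) (b : ℤ) {j : Fin 4} (h : j = upperPos k ∨ j = upperPos k + 1) :
    height (blockPerm k b j) - axisHeight k = (-1) ^ b * (height j - axisHeight k) := by
  unfold blockPerm
  split_ifs with hb
  · rw [hb.neg_one_zpow]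
    rcases h with rfl | rfl
    · rw [Equiv.swap_apply_left, height_upperPos, height_upperPos_succ]; norm_num
    · rw [Equiv.swap_apply_right, height_upperPos, height_upperPos_succ]; norm_num
  · rw [(Int.not_odd_iff_even.1 hb).neg_one_zpow, one_mul, id]

/-- A strand of a block continued by a strand of the next block, of the same type. -/
theorem blockStrand_add (k : ℕ) (a : ℤ) (θ : ℝ → ℝ) (j : Fin 4) (x : ℝ) :
    blockStrand k (fun x => (-1) ^ k * a * Real.pi + θ x) j x =
      blockStrand k θ (blockPerm k a j) x := by
  by_cases hj : j = upperPos k ∨ j = upperPos k + 1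
  · have he : ((-1) ^ k * a * Real.pi + θ x : ℝ) = θ x + (((-1) ^ k * a : ℤ) : ℝ) * Real.pi := by
      push_cast; ring
    have hs : ((-1 : ℝ) ^ ((-1) ^ k * a : ℤ)) = (-1) ^ a := by
      rcases Nat.even_or_odd k with hk | hk
      · rw [hk.neg_one_pow, one_mul]
      · rw [hk.neg_one_pow, neg_one_mul, zpow_neg, ← inv_zpow]
        norm_num
    simp only [blockStrand, if_pos hj, if_pos ((blockPerm_mem_iff k a j).2 hj)]
    rw [he, Real.cos_add_int_mul_pi, Real.sin_add_int_mul_pi, hs, height_blockPerm k a hj]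
    refine Prod.ext rfl (Prod.ext ?_ ?_)
    · change _ + _ = _ + _; ring
    · change _ * _ = _ * _; ring
  · rw [blockPerm_of_not k a hj]
    simp only [blockStrand, if_neg hj]

theorem blockStrand_congr (k : ℕ) {θ θ' : ℝ → ℝ} (j : Fin 4) {x : ℝ} (h : θ x = θ' x) :
    blockStrand k θ j x = blockStrand k θ' j x := by
  simp only [blockStrand, h]

theorem push_shift_blockArc (k : ℕ) {θ : ℝ → ℝ} (hθ : ContDiff ℝ ∞ θ) (j : Fin 4) (s a : ℝ) :
    push (shift a) '' orientedArc (blockStrand k θ j) (Icc 0 1) s =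
      orientedArc (blockStrand k (fun x => θ (x - a)) j) (Icc a (a + 1)) s := by
  have hθ' : ContDiff ℝ ∞ fun x => θ (x - a) := hθ.comp (by fun_prop)
  rw [push_orientedArc (isDiffeo_shift a).differentiable (differentiable_blockStrand k hθ j)]
  have h := orientedArc_comp (φ := fun x => x + a) (differentiable_blockStrand k hθ' j)
    (by fun_prop) (I := Icc 0 1) (ε := 1) (by norm_num) (fun t _ => by simp) s
  rw [one_mul, image_add_const_Icc, zero_add, add_comm 1 a] at h
  rw [← h]
  congr 1
  funext x
  simp only [Function.comp, blockStrand, add_sub_cancel_right, shift_apply]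
  split_ifs <;> simp

theorem naturalAngle_of_nonpos (k : ℕ) (b : ℤ) {x : ℝ} (hx : x ≤ 0) : naturalAngle k b x = 0 := by
  rw [naturalAngle, Real.smoothTransition.zero_of_nonpos hx, mul_zero]

theorem naturalAngle_of_one_le (k : ℕ) (b : ℤ) {x : ℝ} (hx : 1 ≤ x) :
    naturalAngle k b x = (-1) ^ k * b * Real.pi := by
  rw [naturalAngle, Real.smoothTransition.one_of_one_le hx, mul_one]

theorem iUnion_blockPerm {α : Type*} (k : ℕ) (a : ℤ) (d : Fin 4 → ℝ) (F : Fin 4 → ℝ → Set α) :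
    ⋃ j, F j ((d ∘ blockPerm k a) j) = ⋃ j, F (blockPerm k a j) (d j) := by
  rw [← (blockPerm_involutive k a).surjective.iUnion_comp]
  simp only [Function.comp, (blockPerm_involutive k a) _]

/-- On `[0, 1]` the second angle is still zero. On `[1, 2]` the first is constantly `a` half turns,
which only permutes the starting positions of the second block (`blockStrand_add`). So the sum of
the angles describes both blocks at once. -/
theorem block_union_block (k : ℕ) (a b : ℤ) (d : Fin 4 → ℝ) :
    block k (naturalAngle k a) d ∪ push (shift 1) '' block k (naturalAngle k b) (d ∘ blockPerm k a) =
      ⋃ j, orientedArc (blockStrand k (fun x => naturalAngle k a x + naturalAngle k b (x - 1)) j)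
        (Icc 0 2) (d j) := by
  have hb : ContDiff ℝ ∞ fun x => naturalAngle k b (x - 1) :=
    (contDiff_naturalAngle k b).comp (by fun_prop)
  have hab := (contDiff_naturalAngle k a).add hb
  simp only [block, image_iUnion]
  rw [iUnion_blockPerm k a d fun j s =>
      push (shift 1) '' orientedArc (blockStrand k (naturalAngle k b) j) (Icc 0 1) s,
    ← iUnion_union_distrib]
  refine iUnion_congr fun j => ?_
  rw [orientedArc_Icc_union _ zero_le_one one_le_two, push_shift_blockArc k
    (contDiff_naturalAngle k b), one_add_one_eq_two]
  congr 1
  · refine orientedArc_congr (differentiable_blockStrand k (contDiff_naturalAngle k a) j)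
      (differentiable_blockStrand k hab j) zero_lt_one (fun x hx => ?_) _
    refine blockStrand_congr k j ?_
    rw [naturalAngle_of_nonpos k b (by linarith [hx.2]), add_zero]
  · refine orientedArc_congr (differentiable_blockStrand k hb _)
      (differentiable_blockStrand k hab j) one_lt_two (fun x hx => ?_) _
    rw [← blockStrand_add]
    refine blockStrand_congr k j ?_
    rw [naturalAngle_of_one_le k a hx.1]

/-- Compressing `[0, 2]` to `[0, 1]` along the `x`-axis makes the two blocks one block with the
right total angle but an unusual profile, which `profTwist_equiv` replaces by the natural one. -/
theorem twist_twist (k : ℕ) (a b : ℤ) (T : OTangle) :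
    twist k a (twist k b T) ≈ twist k (a + b) T := by
  obtain ⟨f, hf, hf0, hf2, hfd⟩ := exists_compression
  let Θ : ℝ → ℝ := fun x => naturalAngle k a x + naturalAngle k b (x - 1)
  have hΘ : ContDiff ℝ ∞ Θ := (contDiff_naturalAngle k a).add
    ((contDiff_naturalAngle k b).comp (by fun_prop))
  have hfs0 : ∀ x ≤ 0, f.symm x = x := fun x hx => by rw [Equiv.symm_apply_eq, hf0 x hx]
  have hfs1 : ∀ x, 1 ≤ x → f.symm x = x + 1 := fun x hx => by
    rw [Equiv.symm_apply_eq, hf2 _ (by linarith)]; ring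
  have h1 : twist k a (twist k b T) ≈ profTwist k (a + b) (Θ ∘ f.symm) T := by
    let g : Space ≃ Space := Equiv.prodCongr f (Equiv.refl _)
    have hg : IsDiffeo g :=
      ⟨(hf.1.comp contDiff_fst).prodMk contDiff_snd, (hf.2.comp contDiff_fst).prodMk contDiff_snd⟩
    refine ⟨?_, g, hg, fun P hP => Prod.ext (hf0 _ hP) rfl, fun d hd => ?_⟩
    · ext d
      change (d ∘ blockPerm k a) ∘ blockPerm k b ∈ T.valid ↔ d ∘ blockPerm k (a + b) ∈ T.valid
      rw [Function.comp_assoc, blockPerm_comp]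
    · change push g '' (block _ _ _ ∪ push (shift 1) '' (block _ _ _ ∪ push (shift 1) '' _)) =
        block _ _ _ ∪ push (shift 1) '' _
      rw [Function.comp_assoc, blockPerm_comp, image_union (push (shift 1)), ← union_assoc,
        block_union_block, image_union]
      congr 1
      · rw [image_iUnion]
        refine iUnion_congr fun j => ?_
        have hΘf := hΘ.comp hf.2
        rw [push_orientedArc hg.differentiable (differentiable_blockStrand k hΘ j)]
        have := orientedArc_comp (φ := f) (differentiable_blockStrand k hΘf j)
          hf.differentiable (I := Icc 0 2) (ε := 1) (by norm_num)
          (fun t _ => by simpa using hfd t) (d j)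
        rw [image_Icc_of_deriv_pos hfd, one_mul, hf0 0 le_rfl, hf2 2 le_rfl,
          show (2 : ℝ) - 1 = 1 by norm_num] at this
        rw [← this]
        congr 1
        funext x
        simp only [Function.comp, blockStrand, Equiv.symm_apply_apply]
        split_ifs <;> rfl
      · rw [push_shift_shift, push_image_of_le_fst hg (a := 2) (c := -1) (fun P hP => ?_),
          push_shift_shift]
        · norm_num
        · rintro _ ⟨u, hu, rfl⟩
          rw [push_shift_fst]
          linarith [T.nonneg _ u hu]
        · refine Prod.ext ((hf2 _ hP).trans ?_) ?_
          · rw [shift_apply_fst]; ring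
          · simp [g, shift_apply]
  refine Setoid.trans h1 (profTwist_equiv (hΘ.comp hf.2) (contDiff_naturalAngle k _)
    (fun x hx => ?_) (fun x hx => ?_) T)
  · simp only [Function.comp, Θ]
    rw [hfs0 x hx, naturalAngle_of_nonpos k a hx, naturalAngle_of_nonpos k _ (by linarith),
      naturalAngle_of_nonpos k _ hx, add_zero]
  · simp only [Function.comp, Θ]
    rw [hfs1 x hx, naturalAngle_of_one_le k a (by linarith), naturalAngle_of_one_le k _
      (by linarith), naturalAngle_of_one_le k _ hx]
    push_cast; ring

/-- Untwisted blocks of both types are literally the same four segments, hence one and the same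
trivial block for `A` and `B`. -/
theorem twist_zero_eq (k l : ℕ) (T : OTangle) : twist k 0 T = twist l 0 T := by
  have h : ∀ k j, blockStrand k (naturalAngle k 0) j = fun x => (x, height j, 0) := by
    intro k j
    funext x
    simp [blockStrand, naturalAngle]
  have hb : ∀ d, block k (naturalAngle k 0) d = block l (naturalAngle l 0) d := fun d => by
    simp only [block, h]
  simp [twist, profTwist, hb, blockPerm]

/-! ### The functions `smoothTransition` and `smoothSign` -/

theorem expNegInvGlue_strictMonoOn : StrictMonoOn expNegInvGlue (Ici 0) := by
  intro x hx y _ hxy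
  have hy : 0 < y := lt_of_le_of_lt hx hxy
  rcases (show (0 : ℝ) ≤ x from hx).eq_or_lt with rfl | hx'
  · rw [expNegInvGlue.zero]
    exact expNegInvGlue.pos_of_pos hy
  · rw [expNegInvGlue, expNegInvGlue, if_neg hx'.not_ge, if_neg hy.not_ge]
    exact Real.exp_lt_exp.2 (neg_lt_neg (inv_strictAnti₀ hx' hxy))

theorem smoothTransition_strictMonoOn : StrictMonoOn Real.smoothTransition (Icc 0 1) := by
  intro x hx y hy hxy
  rw [Real.smoothTransition, Real.smoothTransition,
    div_lt_div_iff₀ (Real.smoothTransition.pos_denom x) (Real.smoothTransition.pos_denom y)]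
  have h1 := expNegInvGlue_strictMonoOn (show (0 : ℝ) ≤ x from hx.1) (show (0 : ℝ) ≤ y from hy.1) hxy
  have h2 := expNegInvGlue_strictMonoOn (show (0 : ℝ) ≤ 1 - y by linarith [hy.2])
    (show (0 : ℝ) ≤ 1 - x by linarith [hx.2]) (by linarith)
  have := mul_lt_mul'' h1 h2 (expNegInvGlue.nonneg _) (expNegInvGlue.nonneg _)
  linarith

theorem smoothTransition_one_sub (x : ℝ) :
    Real.smoothTransition (1 - x) = 1 - Real.smoothTransition x := by
  rw [Real.smoothTransition, Real.smoothTransition, sub_sub_cancel, eq_sub_iff_add_eq,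
    add_comm (expNegInvGlue (1 - x)), ← add_div, add_comm (expNegInvGlue (1 - x)),
    div_self (Real.smoothTransition.pos_denom x).ne']

/-- With `g = expNegInvGlue`, the function is `g(x) / (g(x) + g(1 - x))`, whose denominator is
critical at `1 / 2`, and `g' = 4 g` there. The positive value is needed at the tip of a cap, where
the `x`-coordinate is stationary and only the `y`-coordinate moves. -/
theorem hasDerivAt_smoothTransition_half : HasDerivAt Real.smoothTransition 2 (1 / 2) := by
  have h0 : HasDerivAt expNegInvGlue (4 * expNegInvGlue (1 / 2)) (1 / 2) := by
    have h : HasDerivAt (fun x : ℝ => Real.exp (-x⁻¹)) (4 * expNegInvGlue (1 / 2)) (1 / 2) := by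
      have := ((hasDerivAt_inv (x := (1 / 2 : ℝ)) (by norm_num)).fun_neg).exp
      refine this.congr_deriv ?_
      simp only [expNegInvGlue]
      rw [if_neg (by norm_num)]
      ring
    refine h.congr_of_eventuallyEq ?_
    filter_upwards [lt_mem_nhds (show (0 : ℝ) < 1 / 2 by norm_num)] with x hx
    rw [expNegInvGlue, if_neg (not_le.2 hx)]
  have h1 : HasDerivAt (fun x : ℝ => expNegInvGlue (1 - x)) (-(4 * expNegInvGlue (1 / 2)))
      (1 / 2) := by
    have h0' : HasDerivAt expNegInvGlue (4 * expNegInvGlue (1 / 2)) (1 - 1 / 2) := by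
      convert h0 using 1; norm_num
    exact (h0'.comp (1 / 2 : ℝ) ((hasDerivAt_id (1 / 2 : ℝ)).const_sub 1)).congr_deriv (by ring)
  have hpos : 0 < expNegInvGlue (1 / 2) := expNegInvGlue.pos_of_pos (by norm_num)
  refine (h0.fun_div (h0.fun_add h1) (Real.smoothTransition.pos_denom (1 / 2)).ne').congr_deriv ?_
  rw [show (1 : ℝ) - 1 / 2 = 1 / 2 by norm_num]
  field_simp
  ring

theorem contDiff_smoothSign : ContDiff ℝ ∞ smoothSign :=
  (contDiff_const.mul (Real.smoothTransition.contDiff.comp (by fun_prop))).sub contDiff_const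

theorem smoothSign_of_one_le {t : ℝ} (h : 1 ≤ t) : smoothSign t = 1 := by
  rw [smoothSign, Real.smoothTransition.one_of_one_le (by linarith)]; norm_num

theorem smoothSign_of_le {t : ℝ} (h : t ≤ -1) : smoothSign t = -1 := by
  rw [smoothSign, Real.smoothTransition.zero_of_nonpos (by linarith)]; norm_num

theorem smoothSign_neg (t : ℝ) : smoothSign (-t) = -smoothSign t := by
  rw [smoothSign, smoothSign, show (-t + 1) / 2 = 1 - (t + 1) / 2 by ring, smoothTransition_one_sub]
  ring

theorem smoothSign_zero : smoothSign 0 = 0 := by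
  have := smoothSign_neg 0
  rw [neg_zero] at this
  linarith

theorem smoothSign_monotone : Monotone smoothSign := by
  intro t u h
  have := Real.smoothTransition.monotone (show (t + 1) / 2 ≤ (u + 1) / 2 by linarith)
  simp only [smoothSign]
  linarith

theorem smoothSign_strictMonoOn : StrictMonoOn smoothSign (Icc (-1) 1) := by
  intro t ht u hu h
  have := smoothTransition_strictMonoOn (show (t + 1) / 2 ∈ Icc (0 : ℝ) 1 from
    ⟨by linarith [ht.1], by linarith [ht.2]⟩) (show (u + 1) / 2 ∈ Icc (0 : ℝ) 1 from
    ⟨by linarith [hu.1], by linarith [hu.2]⟩) (by linarith)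
  simp only [smoothSign]
  linarith

theorem smoothSign_le_one (t : ℝ) : smoothSign t ≤ 1 := by
  have := Real.smoothTransition.le_one ((t + 1) / 2)
  simp only [smoothSign]; linarith

theorem neg_one_le_smoothSign (t : ℝ) : -1 ≤ smoothSign t := by
  have := Real.smoothTransition.nonneg ((t + 1) / 2)
  simp only [smoothSign]; linarith

theorem smoothSign_eq_one_iff {t : ℝ} : smoothSign t = 1 ↔ 1 ≤ t := by
  refine ⟨fun h => ?_, smoothSign_of_one_le⟩
  have : Real.smoothTransition ((t + 1) / 2) = 1 := by
    rw [smoothSign] at h; linarith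
  linarith [Real.smoothTransition.eq_one_iff_one_le.1 this]

theorem smoothSign_eq_neg_one_iff {t : ℝ} : smoothSign t = -1 ↔ t ≤ -1 := by
  rw [← neg_inj, neg_neg, ← smoothSign_neg, smoothSign_eq_one_iff, le_neg]

theorem smoothSign_eq_zero_iff {t : ℝ} : smoothSign t = 0 ↔ t = 0 := by
  refine ⟨fun h => ?_, fun h => by rw [h, smoothSign_zero]⟩
  have h1 : -1 ≤ t := by
    by_contra h'
    rw [smoothSign_of_le (by linarith)] at h; norm_num at h
  have h2 : t ≤ 1 := by
    by_contra h'
    rw [smoothSign_of_one_le (by linarith)] at h; norm_num at h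
  exact smoothSign_strictMonoOn.injOn ⟨h1, h2⟩ (by norm_num) (h.trans smoothSign_zero.symm)

theorem hasDerivAt_smoothSign_zero : HasDerivAt smoothSign 2 0 := by
  have h : HasDerivAt (fun t : ℝ => 2⁻¹ * t + 1 / 2) (2⁻¹ * 1) 0 :=
    ((hasDerivAt_id (0 : ℝ)).const_mul 2⁻¹).add_const _
  have h' : HasDerivAt Real.smoothTransition 2 (2⁻¹ * 0 + 1 / 2) := by
    rw [mul_zero, zero_add]; exact hasDerivAt_smoothTransition_half
  have h1 := ((HasDerivAt.comp (0 : ℝ) h' h).const_mul 2).sub_const 1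
  have h2 : smoothSign = fun t => 2 * (Real.smoothTransition ∘ fun t => 2⁻¹ * t + 1 / 2) t - 1 := by
    funext t
    rw [smoothSign, Function.comp]
    congr 3
    ring
  rw [h2]
  exact h1.congr_deriv (by norm_num)

theorem sq_smoothSign_le {t u : ℝ} (h : t ^ 2 ≤ u ^ 2) : smoothSign t ^ 2 ≤ smoothSign u ^ 2 := by
  have habs : ∀ t, smoothSign |t| ^ 2 = smoothSign t ^ 2 := fun t => by
    rcases abs_choice t with h | h <;> rw [h]
    rw [smoothSign_neg, neg_sq]
  rw [← habs t, ← habs u]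
  have h0 : 0 ≤ smoothSign |t| := by
    rw [← smoothSign_zero]; exact smoothSign_monotone (abs_nonneg t)
  exact pow_le_pow_left₀ h0 (smoothSign_monotone (sq_le_sq.1 h)) 2

/-- Concentric caps are disjoint. -/
theorem concentric_caps_disjoint {t u : ℝ} (h : 1 - t ^ 2 = 2 * (1 - u ^ 2))
    (h' : smoothSign t ^ 2 = 9 * smoothSign u ^ 2) : False := by
  -- If `u² ≤ 1`, then `t² ≤ u²`, and monotonicity contradicts the factor `9` unless both values
  -- vanish; but two caps of different widths have different tips. If `u² ≥ 1`, the right side is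
  -- `9` and the left side at most `1`.
  rcases le_total (u ^ 2) 1 with hu | hu
  · have h1 := sq_smoothSign_le (t := t) (u := u) (by linarith)
    have h2 := sq_nonneg (smoothSign u)
    have h3 : smoothSign u = 0 := pow_eq_zero_iff (two_ne_zero) |>.1 (by linarith)
    have h4 : smoothSign t = 0 := pow_eq_zero_iff (two_ne_zero) |>.1 (by rw [h', h3]; norm_num)
    rw [smoothSign_eq_zero_iff] at h3 h4
    rw [h3, h4] at h
    norm_num at h
  · have h1 := sq_smoothSign_le (t := 1) (u := u) (by linarith)
    have h2 := sq_smoothSign_le (t := t) (u := max 1 |t|) (by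
      rw [← sq_abs t]; exact pow_le_pow_left₀ (abs_nonneg t) (le_max_right _ _) 2)
    rw [smoothSign_of_one_le le_rfl] at h1
    rw [smoothSign_of_one_le (le_max_left _ _)] at h2
    linarith

/-! ### Caps -/

theorem contDiff_rightCap (n : ℕ) (m r w : ℝ) : ContDiff ℝ ∞ (rightCap n m r w) := by
  have := contDiff_smoothSign
  unfold rightCap
  fun_prop

theorem differentiable_rightCap (n : ℕ) (m r w : ℝ) : Differentiable ℝ (rightCap n m r w) :=
  (contDiff_rightCap n m r w).differentiable (by simp)

theorem rightCap_fst_nonneg {m r w : ℝ} (hw : 0 ≤ w) {s : ℝ} {u : Space × Space}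
    (hu : u ∈ orientedArc (rightCap 0 m r w) (Icc (-1) 1) s) : 0 ≤ u.1.1 := by
  obtain ⟨t, ht, c, -, rfl⟩ := hu
  have : t ^ 2 ≤ 1 := by rw [sq_le_one_iff_abs_le_one, abs_le]; exact ht
  change 0 ≤ ((0 : ℕ) : ℝ) + w * (1 - t ^ 2)
  rw [Nat.cast_zero, zero_add]
  exact mul_nonneg hw (by linarith)

theorem shift_rightCap (a m r w t : ℝ) :
    shift a (rightCap 0 m r w t) = (a + w * (1 - t ^ 2), m + r * smoothSign t, 0) := by
  simp [shift_apply, rightCap, add_comm]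

/-- The arcs joining the positions `0, 1` and `2, 3`. -/
def capInf : OTangle where
  valid := {d | d 0 = -d 1 ∧ d 2 = -d 3}
  curves d := orientedArc (rightCap 0 1 (1 / 2) 1) (Icc (-1) 1) (d 1) ∪
    orientedArc (rightCap 0 (-1) (1 / 2) 1) (Icc (-1) 1) (d 3)
  nonneg := by
    rintro d u (hu | hu) <;> exact rightCap_fst_nonneg (by norm_num) hu

/-- The arcs joining the positions `1, 2` and `0, 3`. -/
def capZero : OTangle where
  valid := {d | d 1 = -d 2 ∧ d 0 = -d 3}
  curves d := orientedArc (rightCap 0 0 (1 / 2) 1) (Icc (-1) 1) (d 2) ∪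
    orientedArc (rightCap 0 0 (3 / 2) 2) (Icc (-1) 1) (d 3)
  nonneg := by
    rintro d u (hu | hu) <;> exact rightCap_fst_nonneg (by norm_num) hu

/-- A twist of the two ends of a cap can be undone by a rotation of the cap. -/
theorem twist_equiv_twist_zero (k : ℕ) (b : ℤ) (T : OTangle) {m r w : ℝ} {j : Fin 4}
    (hj : ¬(j = upperPos k ∨ j = upperPos k + 1))
    (hT : ∀ d, T.curves d =
      orientedArc (rightCap 0 (axisHeight k) (1 / 2) 1) (Icc (-1) 1) (d (upperPos k + 1)) ∪
      orientedArc (rightCap 0 m r w) (Icc (-1) 1) (d j))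
    (hv : ∀ d ∈ T.valid, d (upperPos k) = -d (upperPos k + 1))
    (hv' : ∀ d, d ∘ blockPerm k b ∈ T.valid ↔ d ∈ T.valid)
    {χ : ℝ × ℝ → ℝ} (hχ : ContDiff ℝ ∞ χ) (h1 : ∀ x ≤ 1, χ (x, 1 / 4) = 1)
    (h2 : ∀ x ≤ 1, ∀ ρ, 9 / 4 ≤ ρ → χ (x, ρ) = 0)
    (h3 : ∀ t ∈ Icc (-1 : ℝ) 1, χ (1 + 1 * (1 - t ^ 2), (1 / 2 * smoothSign t) ^ 2) = 1)
    (h4 : ∀ t ∈ Icc (-1 : ℝ) 1, χ (1 + w * (1 - t ^ 2),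
      (m + r * smoothSign t - axisHeight k) ^ 2) = 0) :
    twist k b T ≈ twist k 0 T := by
  -- The rotation by `-b` half turns, applied to the twisted pair and its cap only. Beyond `x = 1`
  -- the angle is constant, so the cap is turned rigidly onto itself, and an untwisted block remains
  -- in front of it.
  let ψ : ℝ × ℝ → ℝ := fun v => naturalAngle k (-b) v.1 * χ v
  have hψ : ContDiff ℝ ∞ ψ := ((contDiff_naturalAngle k (-b)).comp contDiff_fst).mul hχ
  have hg := isDiffeo_axisRotationEquiv (axisHeight k) hψ
  have h0p : blockPerm k 0 = id := by simp [blockPerm]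
  refine ⟨?_, axisRotationEquiv (axisHeight k) ψ, hg, fun P hP => axisRotation_eq_self ?_,
    fun d hd => ?_⟩
  · ext d
    change d ∘ blockPerm k b ∈ T.valid ↔ d ∘ blockPerm k 0 ∈ T.valid
    rw [hv', h0p, Function.comp_id]
  · simp [ψ, naturalAngle_of_nonpos k _ hP]
  · change push _ '' (_ ∪ _) = _ ∪ _
    have hd' : d ∈ T.valid := (hv' d).1 hd
    have hcap : ∀ m r w s, push (shift 1) '' orientedArc (rightCap 0 m r w) (Icc (-1) 1) s =
        orientedArc (shift 1 ∘ rightCap 0 m r w) (Icc (-1) 1) s := fun m r w s =>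
      push_orientedArc (isDiffeo_shift 1).differentiable (differentiable_rightCap _ _ _ _) _ _
    have hcapd : ∀ m r w, Differentiable ℝ (shift 1 ∘ rightCap 0 m r w) := fun m r w =>
      (isDiffeo_shift 1).differentiable.comp (differentiable_rightCap _ _ _ _)
    rw [image_union, hT, hT, image_union, image_union, image_union, hcap, hcap, hcap,
      push_orientedArc hg.differentiable (hcapd _ _ _),
      push_orientedArc hg.differentiable (hcapd _ _ _)]
    congr 1
    · simp only [block]
      rw [image_iUnion]
      refine iUnion_congr fun i => ?_
      have hi := differentiable_blockStrand k (contDiff_naturalAngle k b) i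
      rw [push_orientedArc hg.differentiable hi]
      refine orientedArc_congr (hg.differentiable.comp hi)
        (differentiable_blockStrand k (contDiff_naturalAngle k 0) i) zero_lt_one (fun x hx => ?_) _
      refine (axisRotation_blockStrand k _ ψ i x fun ρ hρ => ?_).trans ?_
      · simp [ψ, h2 x hx.2 ρ hρ]
      · refine blockStrand_congr k i ?_
        simp only [ψ]
        rw [h1 x hx.2]
        simp [naturalAngle]
    · congr 1
      · have key : ∀ t ∈ Icc (-1 : ℝ) 1, axisRotation (axisHeight k) ψ
            (shift 1 (rightCap 0 (axisHeight k) (1 / 2) 1 t)) =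
            (1 + 1 * (1 - t ^ 2), axisHeight k + (-1) ^ b * (1 / 2 * smoothSign t), 0) := by
          intro t ht
          have ht' : t ^ 2 ≤ 1 := by rw [sq_le_one_iff_abs_le_one, abs_le]; exact ht
          have h := axisRotation_polar (axisHeight k) ψ (1 + 1 * (1 - t ^ 2))
            (1 / 2 * smoothSign t) 0
          rw [Real.cos_zero, Real.sin_zero, mul_zero, mul_one, zero_add] at h
          rw [shift_rightCap, h]
          have : ψ (1 + 1 * (1 - t ^ 2), (1 / 2 * smoothSign t) ^ 2) =
              ((-((-1) ^ k * b) : ℤ) : ℝ) * Real.pi := by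
            simp only [ψ]
            rw [h3 t ht, naturalAngle_of_one_le k _ (by linarith)]
            push_cast; ring
          rw [this, Real.cos_int_mul_pi, Real.sin_int_mul_pi, zpow_neg, ← inv_zpow]
          have hs : ((-1 : ℝ)⁻¹ ^ ((-1) ^ k * b : ℤ)) = (-1) ^ b := by
            rcases Nat.even_or_odd k with hk | hk
            · rw [hk.neg_one_pow, one_mul]; norm_num
            · rw [hk.neg_one_pow, neg_one_mul, zpow_neg, ← inv_zpow]; norm_num
          rw [hs]
          refine Prod.ext rfl (Prod.ext ?_ ?_)
          · change _ + _ = _ + _; ring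
          · change _ = (0 : ℝ); ring
        -- An odd number of half turns reverses the parametrization of the cap. The exchange of the
        -- directions at its two ends, opposite by validity, restores the orientation.
        by_cases hb : Odd b
        · have hs := orientedArc_comp_of_eqOn (γ := axisRotationEquiv (axisHeight k) ψ ∘
              (shift 1 ∘ rightCap 0 (axisHeight k) (1 / 2) 1))
            (γ' := shift 1 ∘ rightCap 0 (axisHeight k) (1 / 2) 1) (φ := fun t => -t)
            (hg.differentiable.comp (hcapd _ _ _)) (hcapd _ _ _) (by fun_prop)
            (show (-1 : ℝ) < 1 by norm_num) (I := Icc (-1) 1) (ε := -1) (by norm_num)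
            (fun t _ => by simp) (by simp) (fun t ht => (key t ht).trans (by
              simp only [Function.comp, shift_rightCap, smoothSign_neg, hb.neg_one_zpow]
              refine Prod.ext ?_ (Prod.ext ?_ rfl)
              · simp
              · change _ + _ = _ + _; ring))
          rw [hs, h0p, Function.comp_id]
          congr 1
          have : blockPerm k b (upperPos k + 1) = upperPos k := by simp [blockPerm, hb]
          rw [Function.comp, this, hv d hd']
          ring
        · have hs : blockPerm k b = id := by simp [blockPerm, hb]
          rw [hs, h0p]
          refine orientedArc_congr (hg.differentiable.comp (hcapd _ _ _)) (hcapd _ _ _)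
            (by norm_num) (fun t ht => (key t ht).trans ?_) _
          rw [Function.comp, shift_rightCap, (Int.not_odd_iff_even.1 hb).neg_one_zpow,
            one_mul (1 / 2 * smoothSign t)]
      · have : d (blockPerm k b j) = d j := by rw [blockPerm_of_not k b hj]
        rw [Function.comp, this, h0p, Function.comp_id, hcap]
        refine orientedArc_congr (hg.differentiable.comp (hcapd _ _ _)) (hcapd _ _ _)
            (show (-1 : ℝ) < 1 by norm_num) (fun t ht => ?_) _
        refine axisRotation_eq_self ?_
        simp only [Function.comp, shift_rightCap]
        have := h4 t ht
        simp only [ψ]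
        rw [show ((0 : ℝ) ^ 2) = 0 by norm_num, add_zero, this, mul_zero]

/-- The other cap lies in `y ≤ -1/2`, at distance at least `3 / 2` from the axis `y = 1`, so a
purely radial cut-off is enough. -/
theorem twist_capInf (b : ℤ) : twist 1 b capInf ≈ twist 1 0 capInf := by
  have hu : upperPos 1 = 0 := by simp [upperPos]
  have ha : axisHeight 1 = 1 := by simp [axisHeight]
  refine twist_equiv_twist_zero 1 b capInf (j := 3) (m := -1) (r := 1 / 2) (w := 1)
    (by rw [hu]; decide) (fun d => by rw [hu, ha]; rfl) (fun d hd => by rw [hu]; exact hd.1) ?_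
    (contDiff_radialCutoff.comp contDiff_snd) (fun x _ => radialCutoff_of_le le_rfl)
    (fun x _ ρ hρ => radialCutoff_of_ge hρ) (fun t _ => radialCutoff_of_le ?_)
    (fun t _ => radialCutoff_of_ge ?_)
  · intro d
    unfold blockPerm
    split_ifs
    · simp only [capInf, mem_ofPred_eq, Function.comp, hu]
      rw [show Equiv.swap (0 : Fin 4) (0 + 1) 0 = 1 by decide,
        show Equiv.swap (0 : Fin 4) (0 + 1) 1 = 0 by decide,
        show Equiv.swap (0 : Fin 4) (0 + 1) 2 = 2 by decide,
        show Equiv.swap (0 : Fin 4) (0 + 1) 3 = 3 by decide, eq_neg_iff_add_eq_zero,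
        eq_neg_iff_add_eq_zero (a := d 0), add_comm]
    · rfl
  · nlinarith [smoothSign_le_one t, neg_one_le_smoothSign t]
  · rw [ha]
    nlinarith [smoothSign_le_one t, neg_one_le_smoothSign t]

/-- The outer cap crosses the axis at its tip, so no radial cut-off separates the caps. In the
coordinates `x` and squared distance from the axis they have disjoint compact profiles
(`concentric_caps_disjoint`), and a smooth Urysohn function of these two variables serves instead.
-/
theorem twist_capZero (b : ℤ) : twist 0 b capZero ≈ twist 0 0 capZero := by
  have hu : upperPos 0 = 1 := by simp [upperPos]
  have ha : axisHeight 0 = 0 := by simp [axisHeight]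
  have hc := contDiff_smoothSign.continuous
  obtain ⟨χ, hχ, hχ0, hχ1⟩ := exists_contDiff_zero_one (E := ℝ × ℝ)
    (s := {v | v.1 ≤ 1 ∧ 9 / 4 ≤ v.2} ∪
      (fun t : ℝ => (1 + 2 * (1 - t ^ 2), (3 / 2 * smoothSign t) ^ 2)) '' Icc (-1) 1)
    (t := {v | v.1 ≤ 1 ∧ v.2 ≤ 1 / 4} ∪
      (fun t : ℝ => (1 + 1 * (1 - t ^ 2), (1 / 2 * smoothSign t) ^ 2)) '' Icc (-1) 1)
    (((isClosed_le continuous_fst continuous_const).inter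
      (isClosed_le continuous_const continuous_snd)).union
      (isCompact_Icc.image (by fun_prop)).isClosed)
    (((isClosed_le continuous_fst continuous_const).inter
      (isClosed_le continuous_snd continuous_const)).union
      (isCompact_Icc.image (by fun_prop)).isClosed)
    (by
      rw [disjoint_left]
      rintro v (hv | ⟨t, ht, rfl⟩) (hv' | ⟨u, hu, hv'⟩)
      · linarith [hv.2, hv'.2]
      · have h := hv.2
        rw [← hv'] at h
        change 9 / 4 ≤ (1 / 2 * smoothSign u) ^ 2 at h
        nlinarith [smoothSign_le_one u, neg_one_le_smoothSign u]
      · have h := hv'.1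
        have h2 := hv'.2
        change 1 + 2 * (1 - t ^ 2) ≤ 1 at h
        change (3 / 2 * smoothSign t) ^ 2 ≤ 1 / 4 at h2
        have := sq_smoothSign_le (t := 1) (u := t) (by linarith)
        rw [smoothSign_of_one_le le_rfl] at this
        linarith
      · have h := congrArg Prod.fst hv'
        have h2 := congrArg Prod.snd hv'
        change 1 + 1 * (1 - u ^ 2) = 1 + 2 * (1 - t ^ 2) at h
        change (1 / 2 * smoothSign u) ^ 2 = (3 / 2 * smoothSign t) ^ 2 at h2
        exact concentric_caps_disjoint (t := u) (u := t) (by linarith) (by linarith))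
  refine twist_equiv_twist_zero 0 b capZero (j := 3) (m := 0) (r := 3 / 2) (w := 2)
    (by rw [hu]; decide) (fun d => by rw [hu, ha]; rfl) (fun d hd => by rw [hu]; exact hd.1) ?_
    hχ (fun x hx => hχ1 _ (Or.inl ⟨hx, le_rfl⟩))
    (fun x hx ρ hρ => hχ0 _ (Or.inl ⟨hx, hρ⟩)) (fun t ht => hχ1 _ (Or.inr ⟨t, ht, rfl⟩))
    (fun t ht => hχ0 _ (Or.inr ⟨t, ht, ?_⟩))
  · intro d
    unfold blockPerm
    split_ifs
    · simp only [capZero, mem_ofPred_eq, Function.comp, hu]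
      rw [show Equiv.swap (1 : Fin 4) (1 + 1) 0 = 0 by decide,
        show Equiv.swap (1 : Fin 4) (1 + 1) 1 = 2 by decide,
        show Equiv.swap (1 : Fin 4) (1 + 1) 2 = 1 by decide,
        show Equiv.swap (1 : Fin 4) (1 + 1) 3 = 3 by decide, eq_neg_iff_add_eq_zero,
        eq_neg_iff_add_eq_zero (a := d 1), add_comm (d 2)]
    · rfl
  · rw [ha, zero_add, sub_zero]

/-! ### Blocks with one half twist -/

/-- A smooth step from `0` to `1` which is constant outside `[1/3, 2/3]`. -/
def flatStep (x : ℝ) : ℝ := Real.smoothTransition (3 * x - 1)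

theorem contDiff_flatStep : ContDiff ℝ ∞ flatStep :=
  Real.smoothTransition.contDiff.comp (by fun_prop)

theorem flatStep_of_le {x : ℝ} (h : x ≤ 1 / 3) : flatStep x = 0 :=
  Real.smoothTransition.zero_of_nonpos (by linarith)

theorem flatStep_of_ge {x : ℝ} (h : 2 / 3 ≤ x) : flatStep x = 1 :=
  Real.smoothTransition.one_of_one_le (by linarith)

theorem flatStep_mem (x : ℝ) : flatStep x ∈ Icc (0 : ℝ) 1 :=
  ⟨Real.smoothTransition.nonneg _, Real.smoothTransition.le_one _⟩

def flatAngle (x : ℝ) : ℝ := Real.pi * flatStep x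

theorem contDiff_flatAngle : ContDiff ℝ ∞ flatAngle := contDiff_const.mul contDiff_flatStep

theorem flatAngle_of_le {x : ℝ} (h : x ≤ 1 / 3) : flatAngle x = 0 := by
  rw [flatAngle, flatStep_of_le h, mul_zero]

theorem flatAngle_of_ge {x : ℝ} (h : 2 / 3 ≤ x) : flatAngle x = Real.pi := by
  rw [flatAngle, flatStep_of_ge h, mul_one]

theorem sin_flatAngle_nonneg (x : ℝ) : 0 ≤ Real.sin (flatAngle x) :=
  Real.sin_nonneg_of_nonneg_of_le_pi (mul_nonneg Real.pi_pos.le (flatStep_mem x).1)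
    (mul_le_of_le_one_right Real.pi_pos.le (flatStep_mem x).2)

/-- A block with one half twist, in the direction of positive angles. -/
def flatTwist (k : ℕ) (T : OTangle) : OTangle := profTwist k ((-1) ^ k) flatAngle T

/-- The exponent `(-1) ^ k` cancels the sign in the natural angle: `A` and `B⁻¹` are both half turns
by `+π`. These are the two generators in the braid relation. -/
theorem twist_equiv_flatTwist (k : ℕ) (T : OTangle) : twist k ((-1) ^ k) T ≈ flatTwist k T := by
  have h : ((-1 : ℝ) ^ k) * (((-1) ^ k : ℤ) : ℝ) = 1 := by
    push_cast
    rw [← mul_pow]; norm_num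
  refine profTwist_equiv (contDiff_naturalAngle k _) contDiff_flatAngle (fun x hx => ?_)
    (fun x hx => ?_) T
  · rw [naturalAngle_of_nonpos k _ hx, flatAngle_of_le (by linarith)]
  · rw [naturalAngle_of_one_le k _ hx, flatAngle_of_ge (by linarith), h, one_mul]

theorem upperPos_zero : upperPos 0 = 1 := by simp [upperPos]

theorem upperPos_one : upperPos 1 = 0 := by simp [upperPos]

theorem blockPerm_zero_pow : blockPerm 0 ((-1) ^ 0) = Equiv.swap 1 2 := by
  simp [blockPerm, upperPos_zero]

theorem blockPerm_one_pow : blockPerm 1 ((-1) ^ 1) = Equiv.swap 0 1 := by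
  simp [blockPerm, upperPos_one]

theorem blockStrand_zero (θ : ℝ → ℝ) (x : ℝ) :
    blockStrand 0 θ 0 x = (x, 3 / 2, 0) ∧
    blockStrand 0 θ 1 x = (x, 1 / 2 * Real.cos (θ x), 1 / 2 * Real.sin (θ x)) ∧
    blockStrand 0 θ 2 x = (x, -1 / 2 * Real.cos (θ x), -1 / 2 * Real.sin (θ x)) ∧
    blockStrand 0 θ 3 x = (x, -3 / 2, 0) := by
  have h1 : height 1 = 1 / 2 := by norm_num [height]
  have h2 : height 2 = -1 / 2 := by norm_num [height]
  have h3 : height 3 = -3 / 2 := by norm_num [height]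
  have h0 : height 0 = 3 / 2 := by norm_num [height]
  have ha : axisHeight 0 = 0 := by simp [axisHeight]
  refine ⟨?_, ?_, ?_, ?_⟩ <;> simp [blockStrand, upperPos_zero, h0, h1, h2, h3, ha]

theorem blockStrand_one (θ : ℝ → ℝ) (x : ℝ) :
    blockStrand 1 θ 0 x = (x, 1 + 1 / 2 * Real.cos (θ x), 1 / 2 * Real.sin (θ x)) ∧
    blockStrand 1 θ 1 x = (x, 1 + -1 / 2 * Real.cos (θ x), -1 / 2 * Real.sin (θ x)) ∧
    blockStrand 1 θ 2 x = (x, -1 / 2, 0) ∧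
    blockStrand 1 θ 3 x = (x, -3 / 2, 0) := by
  have h1 : height 1 - 1 = -1 / 2 := by norm_num [height]
  have h2 : height 2 = -1 / 2 := by norm_num [height]
  have h3 : height 3 = -3 / 2 := by norm_num [height]
  have h0 : height 0 - 1 = 1 / 2 := by norm_num [height]
  have ha : axisHeight 1 = 1 := by simp [axisHeight]
  refine ⟨?_, ?_, ?_, ?_⟩ <;> simp [blockStrand, upperPos_one, h0, h1, h2, h3, ha]

/-! ### Braids with three crossings -/

/-- The displacement along a strand of a block with one half twist. -/
def displacement (k : ℕ) (j : Fin 4) (x : ℝ) : Space :=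
  blockStrand k flatAngle j x - (x, height j, 0)

theorem contDiff_displacement (k : ℕ) (j : Fin 4) : ContDiff ℝ ∞ (displacement k j) :=
  (contDiff_blockStrand k contDiff_flatAngle j).sub (by fun_prop)

theorem displacement_of_le (k : ℕ) (j : Fin 4) {x : ℝ} (hx : x ≤ 1 / 3) :
    displacement k j x = 0 := by
  simp only [displacement, blockStrand, flatAngle_of_le hx]
  split_ifs <;> simp

theorem displacement_of_ge (k : ℕ) (j : Fin 4) {x : ℝ} (hx : 2 / 3 ≤ x) :
    displacement k j x = (0, height (blockPerm k ((-1) ^ k) j) - height j, 0) := by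
  have hodd : Odd ((-1 : ℤ) ^ k) := Odd.pow (by decide)
  by_cases hj : j = upperPos k ∨ j = upperPos k + 1
  · have h := height_blockPerm k ((-1) ^ k) hj
    rw [hodd.neg_one_zpow] at h
    simp only [displacement, blockStrand, flatAngle_of_ge hx, if_pos hj, Real.cos_pi, Real.sin_pi]
    refine Prod.ext (sub_self _) (Prod.ext ?_ ?_)
    · change _ + _ - _ = _ - _
      linear_combination -h
    · change _ * (0 : ℝ) - 0 = 0
      ring
  · rw [blockPerm_of_not k _ hj]
    simp only [displacement, blockStrand, if_neg hj, sub_self]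
    rfl

/-- The strand of three successive blocks with one half twist each. -/
def braidStrand (k l m : ℕ) (j : Fin 4) (x : ℝ) : Space :=
  (x, height j, 0) + displacement k j x + displacement l (blockPerm k ((-1) ^ k) j) (x - 1) +
    displacement m (blockPerm l ((-1) ^ l) (blockPerm k ((-1) ^ k) j)) (x - 2)

theorem contDiff_braidStrand (k l m : ℕ) (j : Fin 4) : ContDiff ℝ ∞ (braidStrand k l m j) := by
  have h1 := contDiff_displacement k j
  have h2 := (contDiff_displacement l (blockPerm k ((-1) ^ k) j)).comp
    (show ContDiff ℝ ∞ fun x : ℝ => x - 1 by fun_prop)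
  have h3 := (contDiff_displacement m (blockPerm l ((-1) ^ l) (blockPerm k ((-1) ^ k) j))).comp
    (show ContDiff ℝ ∞ fun x : ℝ => x - 2 by fun_prop)
  exact (((by fun_prop : ContDiff ℝ ∞ fun x : ℝ => ((x, height j, 0) : Space)).add h1).add h2).add h3

theorem blockStrand_eq_displacement (k : ℕ) (j : Fin 4) (a x : ℝ) :
    blockStrand k (fun x => flatAngle (x - a)) j x =
      (x, height j, 0) + displacement k j (x - a) := by
  simp only [displacement, blockStrand]
  split_ifs <;> simp

/-- The displacement of a block is zero before it and afterwards the constant change of height due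
to its permutation. Summing the displacements therefore reproduces on each unit interval the strand
of the current block, and gives one smooth curve over `[0, 3]`. -/
theorem flatTwist_curves (k l m : ℕ) (T : OTangle) (d : Fin 4 → ℝ) :
    (flatTwist k (flatTwist l (flatTwist m T))).curves d =
      (⋃ j, orientedArc (braidStrand k l m j) (Icc 0 3) (d j)) ∪
        push (shift 3) '' T.curves
          (d ∘ blockPerm k ((-1) ^ k) ∘ blockPerm l ((-1) ^ l) ∘ blockPerm m ((-1) ^ m)) := by
  have hθ : ∀ a, ContDiff ℝ ∞ fun x => flatAngle (x - a) := fun a =>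
    contDiff_flatAngle.comp (by fun_prop)
  have hB : ∀ j, Differentiable ℝ (braidStrand k l m j) := fun j =>
    (contDiff_braidStrand k l m j).differentiable (by simp)
  change block k flatAngle d ∪ push (shift 1) '' (block l flatAngle (d ∘ blockPerm k _) ∪
    push (shift 1) '' (block m flatAngle ((d ∘ blockPerm k _) ∘ blockPerm l _) ∪
      push (shift 1) '' T.curves (((d ∘ blockPerm k _) ∘ blockPerm l _) ∘ blockPerm m _))) = _
  rw [image_union, image_union, image_union, push_shift_shift, push_shift_shift, push_shift_shift,
    ← union_assoc, ← union_assoc, show (1 : ℝ) + (1 + 1) = 3 by norm_num]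
  congr 1
  simp only [block, image_iUnion]
  rw [iUnion_blockPerm k _ d fun j s =>
      push (shift 1) '' orientedArc (blockStrand l flatAngle j) (Icc 0 1) s,
    iUnion_blockPerm l _ (d ∘ blockPerm k ((-1) ^ k)) fun j s =>
      push (shift (1 + 1)) '' orientedArc (blockStrand m flatAngle j) (Icc 0 1) s,
    iUnion_blockPerm k _ d fun j s => push (shift (1 + 1)) '' orientedArc
      (blockStrand m flatAngle (blockPerm l ((-1) ^ l) j)) (Icc 0 1) s,
    ← iUnion_union_distrib, ← iUnion_union_distrib]
  refine iUnion_congr fun j => ?_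
  rw [orientedArc_Icc_union _ (show (0 : ℝ) ≤ 2 by norm_num) (show (2 : ℝ) ≤ 3 by norm_num),
    orientedArc_Icc_union _ zero_le_one one_le_two, push_shift_blockArc l contDiff_flatAngle,
    push_shift_blockArc m contDiff_flatAngle, show (1 : ℝ) + 1 = 2 by norm_num,
    show (2 : ℝ) + 1 = 3 by norm_num]
  congr 1
  · congr 1
    · refine orientedArc_congr (differentiable_blockStrand k contDiff_flatAngle j) (hB j)
        zero_lt_one (fun x hx => ?_) _
      have := blockStrand_eq_displacement k j 0 x
      simp only [sub_zero] at this
      change blockStrand k (fun x => flatAngle x) j x = _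
      rw [this, braidStrand, displacement_of_le l _ (by linarith [hx.2]),
        displacement_of_le m _ (by linarith [hx.2]), add_zero, add_zero]
    · refine orientedArc_congr (differentiable_blockStrand l (hθ 1) _) (hB j)
        one_lt_two (fun x hx => ?_) _
      rw [blockStrand_eq_displacement, braidStrand, displacement_of_ge k _ (by linarith [hx.1]),
        displacement_of_le m _ (by linarith [hx.2]), add_zero]
      simp
  · refine orientedArc_congr (differentiable_blockStrand m (hθ 2) _) (hB j)
      (by norm_num) (fun x hx => ?_) _
    rw [blockStrand_eq_displacement, braidStrand, displacement_of_ge k _ (by linarith [hx.1]),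
      displacement_of_ge l _ (by linarith [hx.1])]
    simp

/-! ### The half turn of three strands -/

/-- The turn takes place over `[1/3, 8/3]`, the same interval on which a flat braid with three
crossings moves, so the two families of strands agree near both ends. -/
def halfTurnAngle (x : ℝ) : ℝ := Real.pi * Real.smoothTransition ((3 * x - 1) / 7)

theorem contDiff_halfTurnAngle : ContDiff ℝ ∞ halfTurnAngle :=
  contDiff_const.mul (Real.smoothTransition.contDiff.comp (by fun_prop))

/-- The strand number `j` of a half turn of the upper three strands. -/
def halfTurnStrand (j : Fin 4) (x : ℝ) : Space :=
  if j = 3 then (x, -3 / 2, 0) else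
    (x, 1 / 2 + (1 - (j : ℕ)) * Real.cos (halfTurnAngle x),
      (1 - (j : ℕ)) * Real.sin (halfTurnAngle x))

theorem contDiff_halfTurnStrand (j : Fin 4) : ContDiff ℝ ∞ (halfTurnStrand j) := by
  have h1 := contDiff_halfTurnAngle.cos
  have h2 := contDiff_halfTurnAngle.sin
  unfold halfTurnStrand
  split_ifs <;> fun_prop

/-- The common normal form of both sides of the braid relation. -/
def halfTurn (T : OTangle) : OTangle where
  valid := {d | d ∘ Equiv.swap 0 2 ∈ T.valid}
  curves d := (⋃ j, orientedArc (halfTurnStrand j) (Icc 0 3) (d j)) ∪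
    push (shift 3) '' T.curves (d ∘ Equiv.swap 0 2)
  nonneg := by
    rintro d u (hu | ⟨v, hv, rfl⟩)
    · obtain ⟨j, t, ht, c, -, rfl⟩ := mem_iUnion.1 hu
      have : (halfTurnStrand j t).1 = t := by unfold halfTurnStrand; split_ifs <;> rfl
      simpa [this] using ht.1
    · rw [push_shift_fst]
      linarith [T.nonneg _ v hv]

/-- Three strands which can be joined to the strands of a half turn by straight segments. -/
theorem exists_diffeo_halfTurn (p : Fin 4 → ℝ → Space) (hp : ∀ j, ContDiff ℝ ∞ (p j))
    (hx : ∀ j x, (p j x).1 = x)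
    (hend : ∀ j, ∀ x ∈ Icc (0 : ℝ) 3, x ∉ Icc (1 / 3 : ℝ) (8 / 3) → p j x = halfTurnStrand j x)
    (hlow : ∀ j ≠ 3, ∀ x, -1 ≤ (p j x).2.1)
    (hsep : ∀ i j : Fin 4, i < j → j < 3 → ∀ x ∈ Icc (0 : ℝ) 3,
      (0 < (p i x).2.1 - (p j x).2.1 ∧
        0 < (halfTurnStrand i x).2.1 - (halfTurnStrand j x).2.1) ∨
      ((p i x).2.1 - (p j x).2.1 < 0 ∧
        (halfTurnStrand i x).2.1 - (halfTurnStrand j x).2.1 < 0) ∨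
      (0 ≤ (p i x).2.2 - (p j x).2.2 ∧ 0 < (halfTurnStrand i x).2.2 - (halfTurnStrand j x).2.2 ∧
        ((p i x).2.2 - (p j x).2.2 = 0 → (p i x).2.1 - (p j x).2.1 ≠ 0))) :
    ∃ g : Space ≃ Space, IsDiffeo g ∧ (∀ P : Space, P.1 ≤ 0 → g P = P) ∧
      (∀ P : Space, 3 ≤ P.1 → g P = P) ∧ (∀ P : Space, P.2.1 ≤ -3 / 2 → g P = P) ∧
      ∀ j ≠ 3, ∀ x ∈ Icc (0 : ℝ) 3, g (p j x) = halfTurnStrand j x := by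
  have hmx : ∀ j x, (halfTurnStrand j x).1 = x := fun j x => by
    unfold halfTurnStrand; split_ifs <;> rfl
  have hmlow : ∀ j ≠ 3, ∀ x, -1 ≤ (halfTurnStrand j x).2.1 := by
    intro j hj x
    rw [halfTurnStrand, if_neg hj]
    have h1 := Real.cos_le_one (halfTurnAngle x)
    have h2 := Real.neg_one_le_cos (halfTurnAngle x)
    fin_cases j <;> simp at hj ⊢ <;> linarith
  let δ : Fin 3 → ℝ → Space := fun j x => halfTurnStrand j.castSucc x - p j.castSucc x
  have hδ : ∀ j, ContDiff ℝ ∞ (δ j) := fun j => (contDiff_halfTurnStrand _).sub (hp _)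
  have hfst : ∀ (s : ℝ) j x, (p (Fin.castSucc j) x + s • δ j x).1 = x := fun s j x => by
    simp [δ, hx, hmx]
  have hne : ∀ j : Fin 3, j.castSucc ≠ 3 := by decide
  -- The moving strands stay in `y ≥ -1`, so the diffeomorphism may also be required to fix `y ≤
  -- -3/2`, and with it the fourth strand.
  have hW : IsClosed {P : Space | P.1 ≤ 0 ∨ 3 ≤ P.1 ∨ P.2.1 ≤ -3 / 2} :=
    (isClosed_le continuous_fst continuous_const).union
      ((isClosed_le continuous_const continuous_fst).union
        (isClosed_le (continuous_fst.comp continuous_snd) continuous_const))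
  -- All strands are graphs over the `x`-axis, so two of them can only meet over the same `x`. There
  -- the difference vector runs along a segment which avoids the origin: `y` keeps its sign, or `z`
  -- is positive for `s > 0`.
  have hlt : ∀ s ∈ Icc (0 : ℝ) 1, ∀ i j : Fin 3, i < j → ∀ x ∈ Icc (0 : ℝ) 3,
      p i.castSucc x + s • δ i x ≠ p j.castSucc x + s • δ j x := by
    intro s hs i j hij x hx' he
    have hy := congrArg (fun P : Space => P.2.1) he
    have hz := congrArg (fun P : Space => P.2.2) he
    simp only [δ, Prod.snd_add, Prod.fst_add, Prod.smul_snd, Prod.smul_fst, Prod.snd_sub,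
      Prod.fst_sub, smul_eq_mul] at hy hz
    have hj3 : ∀ j : Fin 3, j.castSucc < 3 := by decide
    have h := hsep i.castSucc j.castSucc hij (hj3 j) x hx'
    generalize p i.castSucc x = A at *
    generalize p j.castSucc x = B at *
    generalize halfTurnStrand i.castSucc x = A' at *
    generalize halfTurnStrand j.castSucc x = B' at *
    have hy' : (1 - s) * (A.2.1 - B.2.1) + s * (A'.2.1 - B'.2.1) = 0 := by linear_combination hy
    have hz' : (1 - s) * (A.2.2 - B.2.2) + s * (A'.2.2 - B'.2.2) = 0 := by linear_combination hz
    have hs1 : 0 ≤ 1 - s := by linarith [hs.2]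
    rcases h with ⟨h1, h2⟩ | ⟨h1, h2⟩ | ⟨h1, h2, h3⟩
    · rcases hs.1.eq_or_lt with h0 | h0
      · subst h0; linarith
      · nlinarith [mul_nonneg hs1 h1.le, mul_pos h0 h2]
    · rcases hs.1.eq_or_lt with h0 | h0
      · subst h0; linarith
      · nlinarith [mul_nonneg hs1 (neg_nonneg.2 h1.le), mul_pos h0 (neg_pos.2 h2)]
    · rcases hs.1.eq_or_lt with h0 | h0
      · subst h0
        exact h3 (by linarith) (by linarith)
      · nlinarith [mul_nonneg hs1 h1, mul_pos h0 h2]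
  obtain ⟨g, hg, hgW, hgp⟩ := exists_diffeo_of_linear_homotopy (fun j : Fin 3 => p j.castSucc) δ
    (fun j => hp _) hδ (a := 0) (b := 3) (a' := 1 / 3) (b' := 8 / 3)
    (fun j x hx' h => sub_eq_zero.2 (hend _ x hx' h).symm) hW
    (fun s hs i j t ht u hu he => by
      have htu : t = u := by rw [← hfst s i t, ← hfst s j u, he]
      subst htu
      refine ⟨?_, rfl⟩
      rcases lt_trichotomy i j with h | h | h
      · exact (hlt s hs i j h t ht he).elim
      · exact h
      · exact (hlt s hs j i h t ht he.symm).elim)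
    (fun s _ j t _ h => by
      have hd : DifferentiableAt ℝ (fun x => p j.castSucc x + s • δ j x) t :=
        ((hp _).add ((hδ j).const_smul s)).differentiable (by simp) t
      have h1 := (hasFDerivAt_fst (𝕜 := ℝ) (p := p j.castSucc t + s • δ j t)).comp_hasDerivAt t
        hd.hasDerivAt
      rw [h] at h1
      have h2 : HasDerivAt (fun x : ℝ => x) 1 t := hasDerivAt_id t
      rw [show (Prod.fst ∘ fun x => p j.castSucc x + s • δ j x) = fun x => x from
        funext fun x => hfst s j x] at h1
      simpa using h2.unique h1)
    (fun s hs j t ht h => by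
      have h1 := hlow _ (hne j) t
      have h2 := hmlow _ (hne j) t
      rcases h with h | h | h
      · rw [hfst] at h; linarith [ht.2.1]
      · rw [hfst] at h; linarith [ht.2.2]
      · simp only [δ, Prod.snd_add, Prod.fst_add, Prod.smul_snd, Prod.smul_fst, Prod.snd_sub,
          Prod.fst_sub, smul_eq_mul] at h
        nlinarith [hs.1, hs.2])
  refine ⟨g, hg, fun P hP => hgW P (Or.inl hP), fun P hP => hgW P (Or.inr (Or.inl hP)),
    fun P hP => hgW P (Or.inr (Or.inr hP)), fun j hj x hx' => ?_⟩
  obtain ⟨i, rfl⟩ : ∃ i : Fin 3, i.castSucc = j :=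
    ⟨⟨j, by omega⟩, rfl⟩
  rw [hgp i x hx']
  simp [δ]

theorem braidStrand_zero_one_zero (x : ℝ) (c₀ c₁ c₂ s₀ s₁ s₂ : ℝ)
    (hc₀ : Real.cos (flatAngle x) = c₀) (hs₀ : Real.sin (flatAngle x) = s₀)
    (hc₁ : Real.cos (flatAngle (x - 1)) = c₁) (hs₁ : Real.sin (flatAngle (x - 1)) = s₁)
    (hc₂ : Real.cos (flatAngle (x - 2)) = c₂) (hs₂ : Real.sin (flatAngle (x - 2)) = s₂) :
    braidStrand 0 1 0 0 x = (x, 1 / 2 + 1 / 2 * c₁ + 1 / 2 * c₂, 1 / 2 * s₁ + 1 / 2 * s₂) ∧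
    braidStrand 0 1 0 1 x = (x, 1 / 2 + 1 / 2 * c₀ - 1 / 2 * c₂, 1 / 2 * s₀ - 1 / 2 * s₂) ∧
    braidStrand 0 1 0 2 x = (x, 1 / 2 - 1 / 2 * c₀ - 1 / 2 * c₁, -1 / 2 * s₀ - 1 / 2 * s₁) ∧
    braidStrand 0 1 0 3 x = (x, -3 / 2, 0) := by
  have e0 : Equiv.swap (1 : Fin 4) 2 0 = 0 := by decide
  have e1 : Equiv.swap (1 : Fin 4) 2 1 = 2 := by decide
  have e2 : Equiv.swap (1 : Fin 4) 2 2 = 1 := by decide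
  have e3 : Equiv.swap (1 : Fin 4) 2 3 = 3 := by decide
  have f0 : Equiv.swap (0 : Fin 4) 1 0 = 1 := by decide
  have f1 : Equiv.swap (0 : Fin 4) 1 1 = 0 := by decide
  have f2 : Equiv.swap (0 : Fin 4) 1 2 = 2 := by decide
  have f3 : Equiv.swap (0 : Fin 4) 1 3 = 3 := by decide
  have h1 : height 1 = 1 / 2 := by norm_num [height]
  have h2 : height 2 = -1 / 2 := by norm_num [height]
  have h3 : height 3 = -3 / 2 := by norm_num [height]
  have h0 : height 0 = 3 / 2 := by norm_num [height]
  refine ⟨?_, ?_, ?_, ?_⟩ <;>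
  simp only [braidStrand, displacement, blockPerm_zero_pow, blockPerm_one_pow, e0, e1, e2, e3, f0,
    f1, f2, f3, h0, h1, h2, h3, (blockStrand_zero _ _).1, (blockStrand_zero _ _).2.1,
    (blockStrand_zero _ _).2.2.1, (blockStrand_zero _ _).2.2.2, (blockStrand_one _ _).1,
    (blockStrand_one _ _).2.1, (blockStrand_one _ _).2.2.1, (blockStrand_one _ _).2.2.2, hc₀, hc₁,
    hc₂, hs₀, hs₁, hs₂, Prod.mk_sub_mk, Prod.mk_add_mk, Prod.mk.injEq] <;>
  refine ⟨by ring, by ring, by ring⟩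

theorem braidStrand_one_zero_one (x : ℝ) (c₀ c₁ c₂ s₀ s₁ s₂ : ℝ)
    (hc₀ : Real.cos (flatAngle x) = c₀) (hs₀ : Real.sin (flatAngle x) = s₀)
    (hc₁ : Real.cos (flatAngle (x - 1)) = c₁) (hs₁ : Real.sin (flatAngle (x - 1)) = s₁)
    (hc₂ : Real.cos (flatAngle (x - 2)) = c₂) (hs₂ : Real.sin (flatAngle (x - 2)) = s₂) :
    braidStrand 1 0 1 0 x = (x, 1 / 2 + 1 / 2 * c₀ + 1 / 2 * c₁, 1 / 2 * s₀ + 1 / 2 * s₁) ∧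
    braidStrand 1 0 1 1 x = (x, 1 / 2 - 1 / 2 * c₀ + 1 / 2 * c₂, -1 / 2 * s₀ + 1 / 2 * s₂) ∧
    braidStrand 1 0 1 2 x = (x, 1 / 2 - 1 / 2 * c₁ - 1 / 2 * c₂, -1 / 2 * s₁ - 1 / 2 * s₂) ∧
    braidStrand 1 0 1 3 x = (x, -3 / 2, 0) := by
  have e0 : Equiv.swap (1 : Fin 4) 2 0 = 0 := by decide
  have e1 : Equiv.swap (1 : Fin 4) 2 1 = 2 := by decide
  have e2 : Equiv.swap (1 : Fin 4) 2 2 = 1 := by decide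
  have e3 : Equiv.swap (1 : Fin 4) 2 3 = 3 := by decide
  have f0 : Equiv.swap (0 : Fin 4) 1 0 = 1 := by decide
  have f1 : Equiv.swap (0 : Fin 4) 1 1 = 0 := by decide
  have f2 : Equiv.swap (0 : Fin 4) 1 2 = 2 := by decide
  have f3 : Equiv.swap (0 : Fin 4) 1 3 = 3 := by decide
  have h1 : height 1 = 1 / 2 := by norm_num [height]
  have h2 : height 2 = -1 / 2 := by norm_num [height]
  have h3 : height 3 = -3 / 2 := by norm_num [height]
  have h0 : height 0 = 3 / 2 := by norm_num [height]
  refine ⟨?_, ?_, ?_, ?_⟩ <;>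
  simp only [braidStrand, displacement, blockPerm_zero_pow, blockPerm_one_pow, e0, e1, e2, e3, f0,
    f1, f2, f3, h0, h1, h2, h3, (blockStrand_zero _ _).1, (blockStrand_zero _ _).2.1,
    (blockStrand_zero _ _).2.2.1, (blockStrand_zero _ _).2.2.2, (blockStrand_one _ _).1,
    (blockStrand_one _ _).2.1, (blockStrand_one _ _).2.2.1, (blockStrand_one _ _).2.2.2, hc₀, hc₁,
    hc₂, hs₀, hs₁, hs₂, Prod.mk_sub_mk, Prod.mk_add_mk, Prod.mk.injEq] <;>
  refine ⟨by ring, by ring, by ring⟩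

theorem halfTurnStrand_eq (x : ℝ) (C S : ℝ) (hC : Real.cos (halfTurnAngle x) = C)
    (hS : Real.sin (halfTurnAngle x) = S) :
    halfTurnStrand 0 x = (x, 1 / 2 + C, S) ∧ halfTurnStrand 1 x = (x, 1 / 2, 0) ∧
    halfTurnStrand 2 x = (x, 1 / 2 - C, -S) ∧ halfTurnStrand 3 x = (x, -3 / 2, 0) := by
  subst hC hS
  refine ⟨?_, ?_, ?_, ?_⟩
  · simp [halfTurnStrand]
  · simp [halfTurnStrand]
  · rw [halfTurnStrand, if_neg (by decide), show (((2 : Fin 4) : ℕ) : ℝ) = 2 by norm_num]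
    refine Prod.ext rfl (Prod.ext ?_ ?_)
    · change _ + _ = _ - _; ring
    · change _ * _ = -_; ring
  · simp [halfTurnStrand]

theorem cos_sin_flatAngle_of_le {x : ℝ} (h : x ≤ 1 / 3) :
    Real.cos (flatAngle x) = 1 ∧ Real.sin (flatAngle x) = 0 := by
  rw [flatAngle_of_le h, Real.cos_zero, Real.sin_zero]; exact ⟨rfl, rfl⟩

theorem cos_sin_flatAngle_of_ge {x : ℝ} (h : 2 / 3 ≤ x) :
    Real.cos (flatAngle x) = -1 ∧ Real.sin (flatAngle x) = 0 := by
  rw [flatAngle_of_ge h, Real.cos_pi, Real.sin_pi]; exact ⟨rfl, rfl⟩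

theorem cos_sin_halfTurnAngle_of_le {x : ℝ} (h : x ≤ 1 / 3) :
    Real.cos (halfTurnAngle x) = 1 ∧ Real.sin (halfTurnAngle x) = 0 := by
  rw [halfTurnAngle, Real.smoothTransition.zero_of_nonpos (by linarith), mul_zero, Real.cos_zero,
    Real.sin_zero]
  exact ⟨rfl, rfl⟩

theorem cos_sin_halfTurnAngle_of_ge {x : ℝ} (h : 8 / 3 ≤ x) :
    Real.cos (halfTurnAngle x) = -1 ∧ Real.sin (halfTurnAngle x) = 0 := by
  rw [halfTurnAngle, Real.smoothTransition.one_of_one_le (by linarith), mul_one, Real.cos_pi,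
    Real.sin_pi]
  exact ⟨rfl, rfl⟩

theorem sin_halfTurnAngle_pos {x : ℝ} (h : 1 / 3 < x) (h' : x < 8 / 3) :
    0 < Real.sin (halfTurnAngle x) :=
  Real.sin_pos_of_pos_of_lt_pi
    (mul_pos Real.pi_pos (Real.smoothTransition.pos_of_pos (by linarith)))
    (mul_lt_of_lt_one_right Real.pi_pos (Real.smoothTransition.lt_one_of_lt_one (by linarith)))

theorem smoothTransition_half : Real.smoothTransition (1 / 2) = 1 / 2 := by
  have := smoothTransition_one_sub (1 / 2)
  rw [show (1 : ℝ) - 1 / 2 = 1 / 2 by norm_num] at this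
  linarith

theorem cos_halfTurnAngle_pos {x : ℝ} (h : 1 / 3 < x) (h' : x ≤ 2 / 3) :
    0 < Real.cos (halfTurnAngle x) := by
  have h1 := smoothTransition_strictMonoOn (show (3 * x - 1) / 7 ∈ Icc (0 : ℝ) 1 from
    ⟨by linarith, by linarith⟩) (show (1 / 2 : ℝ) ∈ Icc (0 : ℝ) 1 by norm_num) (by linarith)
  rw [smoothTransition_half] at h1
  have h2 := mul_lt_mul_of_pos_left h1 Real.pi_pos
  have h3 := mul_nonneg Real.pi_pos.le (Real.smoothTransition.nonneg ((3 * x - 1) / 7))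
  exact Real.cos_pos_of_mem_Ioo ⟨by rw [halfTurnAngle]; linarith [Real.pi_pos],
    by rw [halfTurnAngle]; linarith⟩

theorem cos_halfTurnAngle_neg {x : ℝ} (h : 7 / 3 ≤ x) (h' : x < 8 / 3) :
    Real.cos (halfTurnAngle x) < 0 := by
  have h1 := smoothTransition_strictMonoOn (show (1 / 2 : ℝ) ∈ Icc (0 : ℝ) 1 by norm_num)
    (show (3 * x - 1) / 7 ∈ Icc (0 : ℝ) 1 from ⟨by linarith, by linarith⟩) (by linarith)
  rw [smoothTransition_half] at h1
  have h2 := mul_lt_mul_of_pos_left h1 Real.pi_pos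
  have h3 := mul_le_of_le_one_right Real.pi_pos.le
    (Real.smoothTransition.le_one ((3 * x - 1) / 7))
  exact Real.cos_neg_of_pi_div_two_lt_of_lt (by rw [halfTurnAngle]; linarith)
    (by rw [halfTurnAngle]; linarith [Real.pi_pos])

/-- The segment from `(y, z)` to `(y', z')` avoids the origin, for one of three reasons. -/
def Joinable (y z y' z' : ℝ) : Prop :=
  (0 < y ∧ 0 < y') ∨ (y < 0 ∧ y' < 0) ∨ (0 ≤ z ∧ 0 < z' ∧ (z = 0 → y ≠ 0))

/-- The relative positions of the strands of a positive braid with three crossings, and of a half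
turn. -/
theorem braid_joinable {x c₀ c₁ c₂ s₀ s₁ s₂ C S : ℝ}
    (hc₀ : Real.cos (flatAngle x) = c₀) (hs₀ : Real.sin (flatAngle x) = s₀)
    (hc₁ : Real.cos (flatAngle (x - 1)) = c₁) (hs₁ : Real.sin (flatAngle (x - 1)) = s₁)
    (hc₂ : Real.cos (flatAngle (x - 2)) = c₂) (hs₂ : Real.sin (flatAngle (x - 2)) = s₂)
    (hC : Real.cos (halfTurnAngle x) = C) (hS : Real.sin (halfTurnAngle x) = S) :
    Joinable (1 / 2 * c₁ + c₂ - 1 / 2 * c₀) (1 / 2 * s₁ + s₂ - 1 / 2 * s₀) C S ∧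
    Joinable (c₁ + 1 / 2 * c₂ + 1 / 2 * c₀) (s₁ + 1 / 2 * s₂ + 1 / 2 * s₀) (2 * C) (2 * S) ∧
    Joinable (c₀ - 1 / 2 * c₂ + 1 / 2 * c₁) (s₀ - 1 / 2 * s₂ + 1 / 2 * s₁) C S := by
  have hs₀' : 0 ≤ s₀ := hs₀ ▸ sin_flatAngle_nonneg _
  have hs₁' : 0 ≤ s₁ := hs₁ ▸ sin_flatAngle_nonneg _
  have hs₂' : 0 ≤ s₂ := hs₂ ▸ sin_flatAngle_nonneg _
  have hq₀ : s₀ ^ 2 + c₀ ^ 2 = 1 := by rw [← hc₀, ← hs₀]; exact Real.sin_sq_add_cos_sq _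
  have hq₁ : s₁ ^ 2 + c₁ ^ 2 = 1 := by rw [← hc₁, ← hs₁]; exact Real.sin_sq_add_cos_sq _
  have hq₂ : s₂ ^ 2 + c₂ ^ 2 = 1 := by rw [← hc₂, ← hs₂]; exact Real.sin_sq_add_cos_sq _
  have hb₀ : c₀ ≤ 1 ∧ -1 ≤ c₀ := hc₀ ▸ ⟨Real.cos_le_one _, Real.neg_one_le_cos _⟩
  have hb₁ : c₁ ≤ 1 ∧ -1 ≤ c₁ := hc₁ ▸ ⟨Real.cos_le_one _, Real.neg_one_le_cos _⟩
  have hb₂ : c₂ ≤ 1 ∧ -1 ≤ c₂ := hc₂ ▸ ⟨Real.cos_le_one _, Real.neg_one_le_cos _⟩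
  have L₀ : ∀ h : x ≤ 1 / 3, c₀ = 1 ∧ s₀ = 0 := fun h => by
    rw [← hc₀, ← hs₀]; exact cos_sin_flatAngle_of_le h
  have G₀ : ∀ h : 2 / 3 ≤ x, c₀ = -1 ∧ s₀ = 0 := fun h => by
    rw [← hc₀, ← hs₀]; exact cos_sin_flatAngle_of_ge h
  have L₁ : ∀ h : x ≤ 4 / 3, c₁ = 1 ∧ s₁ = 0 := fun h => by
    rw [← hc₁, ← hs₁]; exact cos_sin_flatAngle_of_le (by linarith)
  have G₁ : ∀ h : 5 / 3 ≤ x, c₁ = -1 ∧ s₁ = 0 := fun h => by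
    rw [← hc₁, ← hs₁]; exact cos_sin_flatAngle_of_ge (by linarith)
  have L₂ : ∀ h : x ≤ 7 / 3, c₂ = 1 ∧ s₂ = 0 := fun h => by
    rw [← hc₂, ← hs₂]; exact cos_sin_flatAngle_of_le (by linarith)
  have G₂ : ∀ h : 8 / 3 ≤ x, c₂ = -1 ∧ s₂ = 0 := fun h => by
    rw [← hc₂, ← hs₂]; exact cos_sin_flatAngle_of_ge (by linarith)
  -- At most one crossing is in progress at any `x`, so two of the three cosines are `±1`. The pair
  -- that is crossing has difference vector `(c, s)`, up to a positive factor, on the upper half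
  -- circle; this never vanishes. Before the first crossing ends and after the last begins, the sign
  -- of `C` is known, which settles the other pairs; in between their `z`-differences are used.
  rcases le_or_gt x (1 / 3) with h0 | h0
  · have hC1 : C = 1 := hC ▸ (cos_sin_halfTurnAngle_of_le h0).1
    rw [(L₀ h0).1, (L₁ (by linarith)).1, (L₂ (by linarith)).1, hC1]
    refine ⟨Or.inl ?_, Or.inl ?_, Or.inl ?_⟩ <;> norm_num
  rcases le_or_gt (8 / 3) x with h5 | h5
  · have hC1 : C = -1 := hC ▸ (cos_sin_halfTurnAngle_of_ge h5).1
    rw [(G₀ (by linarith)).1, (G₁ (by linarith)).1, (G₂ h5).1, hC1]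
    refine ⟨Or.inr (Or.inl ?_), Or.inr (Or.inl ?_), Or.inr (Or.inl ?_)⟩ <;> norm_num
  have hSpos : 0 < S := hS ▸ sin_halfTurnAngle_pos h0 h5
  have hS2 : 0 < 2 * S := by linarith
  rcases le_or_gt x (2 / 3) with h1 | h1
  · have hC1 : 0 < C := hC ▸ cos_halfTurnAngle_pos h0 h1
    obtain ⟨rfl, rfl⟩ := L₁ (by linarith)
    obtain ⟨rfl, rfl⟩ := L₂ (by linarith)
    refine ⟨Or.inl ⟨by linarith, hC1⟩, Or.inl ⟨by linarith, by linarith⟩,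
      Or.inr (Or.inr ⟨by linarith, hSpos, fun hz hy => ?_⟩)⟩
    have : s₀ = 0 := by linarith
    subst this
    have : c₀ = 0 := by linarith
    subst this
    norm_num at hq₀
  obtain ⟨rfl, rfl⟩ := G₀ h1.le
  rcases le_or_gt x (7 / 3) with h4 | h4
  · obtain ⟨rfl, rfl⟩ := L₂ h4
    refine ⟨Or.inr (Or.inr ⟨by linarith, hSpos, fun hz hy => by linarith⟩),
      Or.inr (Or.inr ⟨by linarith, hS2, fun hz hy => ?_⟩),
      Or.inr (Or.inr ⟨by linarith, hSpos, fun hz hy => by linarith⟩)⟩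
    have : s₁ = 0 := by linarith
    subst this
    have : c₁ = 0 := by linarith
    subst this
    norm_num at hq₁
  · obtain ⟨rfl, rfl⟩ := G₁ (by linarith)
    have hC1 : C < 0 := hC ▸ cos_halfTurnAngle_neg h4.le h5
    refine ⟨Or.inr (Or.inr ⟨by linarith, hSpos, fun hz hy => ?_⟩),
      Or.inr (Or.inl ⟨by linarith, by linarith⟩), Or.inr (Or.inl ⟨by linarith, hC1⟩)⟩
    have : s₂ = 0 := by linarith
    subst this
    have : c₂ = 0 := by linarith
    subst this
    norm_num at hq₂

theorem flatTwist_equiv_halfTurn {k l m : ℕ}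
    (hperm : blockPerm k ((-1) ^ k) ∘ blockPerm l ((-1) ^ l) ∘ blockPerm m ((-1) ^ m) =
      Equiv.swap (0 : Fin 4) 2)
    (hx : ∀ j x, (braidStrand k l m j x).1 = x) (h3 : ∀ x, braidStrand k l m 3 x = (x, -3 / 2, 0))
    (hlow : ∀ j ≠ 3, ∀ x, -1 ≤ (braidStrand k l m j x).2.1)
    (hend : ∀ j, ∀ x ∈ Icc (0 : ℝ) 3, x ∉ Icc (1 / 3 : ℝ) (8 / 3) →
      braidStrand k l m j x = halfTurnStrand j x)
    (hsep : ∀ i j : Fin 4, i < j → j < 3 → ∀ x,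
      Joinable ((braidStrand k l m i x).2.1 - (braidStrand k l m j x).2.1)
        ((braidStrand k l m i x).2.2 - (braidStrand k l m j x).2.2)
        ((halfTurnStrand i x).2.1 - (halfTurnStrand j x).2.1)
        ((halfTurnStrand i x).2.2 - (halfTurnStrand j x).2.2)) (T : OTangle) :
    flatTwist k (flatTwist l (flatTwist m T)) ≈ halfTurn T := by
  obtain ⟨g, hg, hg0, hg3, hgl, hgp⟩ := exists_diffeo_halfTurn (braidStrand k l m)
    (contDiff_braidStrand k l m) hx hend hlow fun i j hij hj x _ => hsep i j hij hj x
  refine ⟨?_, g, hg, hg0, fun d hd => ?_⟩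
  · ext d
    change d ∘ blockPerm k _ ∘ blockPerm l _ ∘ blockPerm m _ ∈ T.valid ↔ d ∘ _ ∈ T.valid
    rw [hperm]
  · rw [flatTwist_curves, hperm, image_union]
    change _ = (⋃ j, orientedArc (halfTurnStrand j) (Icc 0 3) (d j)) ∪ _
    congr 1
    · rw [image_iUnion]
      refine iUnion_congr fun j => ?_
      have hB := (contDiff_braidStrand k l m j).differentiable (by simp)
      rw [push_orientedArc hg.differentiable hB]
      refine orientedArc_congr (hg.differentiable.comp hB)
        ((contDiff_halfTurnStrand j).differentiable (by simp)) (by norm_num) (fun x hx' => ?_) _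
      by_cases hj : j = 3
      · subst hj
        rw [Function.comp, h3, hgl _ le_rfl]
        simp [halfTurnStrand]
      · exact hgp j hj x hx'
    · rw [push_image_of_le_fst hg (a := 3) (c := 0) (fun P hP => by rw [hg3 P hP, shift_zero]; rfl),
        push_shift_zero]
      rintro _ ⟨u, hu, rfl⟩
      rw [push_shift_fst]
      linarith [T.nonneg _ u hu]

theorem flatTwist_zero_one_zero (T : OTangle) :
    flatTwist 0 (flatTwist 1 (flatTwist 0 T)) ≈ halfTurn T := by
  refine flatTwist_equiv_halfTurn ?_ ?_
    (fun x => (braidStrand_zero_one_zero x _ _ _ _ _ _ rfl rfl rfl rfl rfl rfl).2.2.2) ?_ ?_ ?_ T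
  · rw [blockPerm_zero_pow, blockPerm_one_pow]; decide
  · intro j x
    obtain ⟨h0, h1, h2, h3⟩ := braidStrand_zero_one_zero x _ _ _ _ _ _ rfl rfl rfl rfl rfl rfl
    fin_cases j <;> simp [h0, h1, h2, h3]
  · intro j hj x
    obtain ⟨h0, h1, h2, -⟩ := braidStrand_zero_one_zero x _ _ _ _ _ _ rfl rfl rfl rfl rfl rfl
    have a0 := Real.cos_le_one (flatAngle x)
    have a1 := Real.cos_le_one (flatAngle (x - 1))
    have a2 := Real.cos_le_one (flatAngle (x - 2))
    have b0 := Real.neg_one_le_cos (flatAngle x)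
    have b1 := Real.neg_one_le_cos (flatAngle (x - 1))
    have b2 := Real.neg_one_le_cos (flatAngle (x - 2))
    fin_cases j <;> simp [h0, h1, h2] at hj ⊢ <;> linarith
  · intro j x _ hx
    rcases le_or_gt x (1 / 3) with h | h
    · have q0 := cos_sin_flatAngle_of_le h
      have q1 := cos_sin_flatAngle_of_le (x := x - 1) (by linarith)
      have q2 := cos_sin_flatAngle_of_le (x := x - 2) (by linarith)
      have q := cos_sin_halfTurnAngle_of_le h
      obtain ⟨h0, h1, h2, h3⟩ := braidStrand_zero_one_zero x _ _ _ _ _ _ q0.1 q0.2 q1.1 q1.2 q2.1 q2.2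
      obtain ⟨m0, m1, m2, m3⟩ := halfTurnStrand_eq x _ _ q.1 q.2
      fin_cases j <;> simp only [Fin.zero_eta, Fin.mk_one, Fin.reduceFinMk, h0, h1, h2, h3, m0, m1,
        m2, m3, Prod.mk.injEq] <;> norm_num
    · have h' : 8 / 3 ≤ x := by
        by_contra h'
        exact hx ⟨h.le, (not_le.1 h').le⟩
      have q0 := cos_sin_flatAngle_of_ge (x := x) (by linarith)
      have q1 := cos_sin_flatAngle_of_ge (x := x - 1) (by linarith)
      have q2 := cos_sin_flatAngle_of_ge (x := x - 2) (by linarith)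
      have q := cos_sin_halfTurnAngle_of_ge h'
      obtain ⟨h0, h1, h2, h3⟩ := braidStrand_zero_one_zero x _ _ _ _ _ _ q0.1 q0.2 q1.1 q1.2 q2.1 q2.2
      obtain ⟨m0, m1, m2, m3⟩ := halfTurnStrand_eq x _ _ q.1 q.2
      fin_cases j <;> simp only [Fin.zero_eta, Fin.mk_one, Fin.reduceFinMk, h0, h1, h2, h3, m0, m1,
        m2, m3, Prod.mk.injEq] <;> norm_num
  · intro i j hij hj x
    obtain ⟨h0, h1, h2, -⟩ := braidStrand_zero_one_zero x _ _ _ _ _ _ rfl rfl rfl rfl rfl rfl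
    obtain ⟨m0, m1, m2, -⟩ := halfTurnStrand_eq x _ _ rfl rfl
    obtain ⟨k1, k2, k3⟩ := braid_joinable (x := x) rfl rfl rfl rfl rfl rfl rfl rfl
    have hcases : (i = 0 ∧ j = 1) ∨ (i = 0 ∧ j = 2) ∨ (i = 1 ∧ j = 2) := by
      clear h0 h1 h2 m0 m1 m2 k1 k2 k3
      revert i j; decide
    rcases hcases with ⟨rfl, rfl⟩ | ⟨rfl, rfl⟩ | ⟨rfl, rfl⟩
    · rw [h0, h1, m0, m1]
      convert k1 using 1 <;> ring
    · rw [h0, h2, m0, m2]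
      convert k2 using 1 <;> ring
    · rw [h1, h2, m1, m2]
      convert k3 using 1 <;> ring

/-- The same three relative motions occur as for the other word, with the pairs `0, 1` and `1, 2`
interchanged, because here the strands `0, 1` cross first. -/
theorem flatTwist_one_zero_one (T : OTangle) :
    flatTwist 1 (flatTwist 0 (flatTwist 1 T)) ≈ halfTurn T := by
  refine flatTwist_equiv_halfTurn ?_ ?_
    (fun x => (braidStrand_one_zero_one x _ _ _ _ _ _ rfl rfl rfl rfl rfl rfl).2.2.2) ?_ ?_ ?_ T
  · rw [blockPerm_zero_pow, blockPerm_one_pow]; decide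
  · intro j x
    obtain ⟨h0, h1, h2, h3⟩ := braidStrand_one_zero_one x _ _ _ _ _ _ rfl rfl rfl rfl rfl rfl
    fin_cases j <;> simp [h0, h1, h2, h3]
  · intro j hj x
    obtain ⟨h0, h1, h2, -⟩ := braidStrand_one_zero_one x _ _ _ _ _ _ rfl rfl rfl rfl rfl rfl
    have a0 := Real.cos_le_one (flatAngle x)
    have a1 := Real.cos_le_one (flatAngle (x - 1))
    have a2 := Real.cos_le_one (flatAngle (x - 2))
    have b0 := Real.neg_one_le_cos (flatAngle x)
    have b1 := Real.neg_one_le_cos (flatAngle (x - 1))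
    have b2 := Real.neg_one_le_cos (flatAngle (x - 2))
    fin_cases j <;> simp [h0, h1, h2] at hj ⊢ <;> linarith
  · intro j x _ hx
    rcases le_or_gt x (1 / 3) with h | h
    · have q0 := cos_sin_flatAngle_of_le h
      have q1 := cos_sin_flatAngle_of_le (x := x - 1) (by linarith)
      have q2 := cos_sin_flatAngle_of_le (x := x - 2) (by linarith)
      have q := cos_sin_halfTurnAngle_of_le h
      obtain ⟨h0, h1, h2, h3⟩ := braidStrand_one_zero_one x _ _ _ _ _ _ q0.1 q0.2 q1.1 q1.2 q2.1 q2.2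
      obtain ⟨m0, m1, m2, m3⟩ := halfTurnStrand_eq x _ _ q.1 q.2
      fin_cases j <;> simp only [Fin.zero_eta, Fin.mk_one, Fin.reduceFinMk, h0, h1, h2, h3, m0, m1,
        m2, m3, Prod.mk.injEq] <;> norm_num
    · have h' : 8 / 3 ≤ x := by
        by_contra h'
        exact hx ⟨h.le, (not_le.1 h').le⟩
      have q0 := cos_sin_flatAngle_of_ge (x := x) (by linarith)
      have q1 := cos_sin_flatAngle_of_ge (x := x - 1) (by linarith)
      have q2 := cos_sin_flatAngle_of_ge (x := x - 2) (by linarith)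
      have q := cos_sin_halfTurnAngle_of_ge h'
      obtain ⟨h0, h1, h2, h3⟩ := braidStrand_one_zero_one x _ _ _ _ _ _ q0.1 q0.2 q1.1 q1.2 q2.1 q2.2
      obtain ⟨m0, m1, m2, m3⟩ := halfTurnStrand_eq x _ _ q.1 q.2
      fin_cases j <;> simp only [Fin.zero_eta, Fin.mk_one, Fin.reduceFinMk, h0, h1, h2, h3, m0, m1,
        m2, m3, Prod.mk.injEq] <;> norm_num
  · intro i j hij hj x
    obtain ⟨h0, h1, h2, -⟩ := braidStrand_one_zero_one x _ _ _ _ _ _ rfl rfl rfl rfl rfl rfl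
    obtain ⟨m0, m1, m2, -⟩ := halfTurnStrand_eq x _ _ rfl rfl
    obtain ⟨k1, k2, k3⟩ := braid_joinable (x := x) rfl rfl rfl rfl rfl rfl rfl rfl
    have hcases : (i = 0 ∧ j = 1) ∨ (i = 0 ∧ j = 2) ∨ (i = 1 ∧ j = 2) := by
      clear h0 h1 h2 m0 m1 m2 k1 k2 k3
      revert i j; decide
    rcases hcases with ⟨rfl, rfl⟩ | ⟨rfl, rfl⟩ | ⟨rfl, rfl⟩
    · rw [h0, h1, m0, m1]
      convert k3 using 1 <;> ring
    · rw [h0, h2, m0, m2]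
      convert k2 using 1 <;> ring
    · rw [h1, h2, m1, m2]
      convert k1 using 1 <;> ring

theorem twist_equiv_flatTwist_three (k l m : ℕ) (T : OTangle) :
    twist k ((-1) ^ k) (twist l ((-1) ^ l) (twist m ((-1) ^ m) T)) ≈
      flatTwist k (flatTwist l (flatTwist m T)) :=
  Setoid.trans (twist_congr (Setoid.trans (twist_congr (twist_equiv_flatTwist m T))
    (twist_equiv_flatTwist l _))) (twist_equiv_flatTwist k _)

/-- The braid relation. -/
theorem twist_braid (T : OTangle) :
    twist 0 1 (twist 1 (-1) (twist 0 1 T)) ≈ twist 1 (-1) (twist 0 1 (twist 1 (-1) T)) := by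
  have h1 := twist_equiv_flatTwist_three 0 1 0 T
  have h2 := twist_equiv_flatTwist_three 1 0 1 T
  rw [pow_zero, pow_one] at h1 h2
  exact Setoid.trans (Setoid.trans h1 (flatTwist_zero_one_zero T))
    (Setoid.symm (Setoid.trans h2 (flatTwist_one_zero_one T)))

/-! ### Hairpins -/

/-- A curve which comes from the left along a graph over the `x`-axis, turns around in `x ≥ 1`, and
returns above its first part. -/
structure IsHairpin (γ : ℝ → Space) : Prop where
  contDiff : ContDiff ℝ ∞ γ
  strictMonoOn : StrictMonoOn (fun t => (γ t).2.1) (Icc (-1) 1)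
  lt : ∀ t, 1 ≤ t → (γ (-t)).2.1 < (γ t).2.1
  fst_eq : ∀ t, 1 ≤ t ^ 2 → (γ t).1 = 2 - t ^ 2
  one_le_fst : ∀ t, t ^ 2 ≤ 1 → 1 ≤ (γ t).1
  deriv_fst : ∀ t ≠ 0, t * (deriv γ t).1 < 0
  deriv_snd : 0 < (deriv γ 0).2.1

/-- The part `t² ≤ 1` lies in `x ≥ 1` and has increasing `y`. The branches lie in `x < 1`, where
equal `x` forces parameters `±t`, and the returning branch is strictly higher. -/
theorem IsHairpin.injective {γ : ℝ → Space} (h : IsHairpin γ) : Function.Injective γ := by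
  intro t u htu
  have hx : (γ t).1 = (γ u).1 := by rw [htu]
  have hy : (γ t).2.1 = (γ u).2.1 := by rw [htu]
  have key : ∀ t, t ^ 2 ≤ 1 → t ∈ Icc (-1 : ℝ) 1 := fun t ht =>
    abs_le.1 (sq_le_one_iff_abs_le_one t |>.1 ht)
  rcases le_or_gt (t ^ 2) 1 with ht | ht <;> rcases le_or_gt (u ^ 2) 1 with hu | hu
  · exact h.strictMonoOn.injOn (key t ht) (key u hu) hy
  · have := h.one_le_fst t ht
    rw [hx, h.fst_eq u hu.le] at this
    linarith
  · have := h.one_le_fst u hu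
    rw [← hx, h.fst_eq t ht.le] at this
    linarith
  · rw [h.fst_eq t ht.le, h.fst_eq u hu.le] at hx
    rcases sq_eq_sq_iff_eq_or_eq_neg.1 (show t ^ 2 = u ^ 2 by linarith) with h1 | h1
    · exact h1
    · subst h1
      rcases le_total 0 u with h0 | h0
      · have := h.lt u (by nlinarith)
        linarith
      · have := h.lt (-u) (by nlinarith)
        rw [neg_neg] at this
        linarith

theorem IsHairpin.deriv_ne_zero {γ : ℝ → Space} (h : IsHairpin γ) (t : ℝ) : deriv γ t ≠ 0 := by
  intro h0
  by_cases ht : t = 0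
  · subst ht
    have := h.deriv_snd
    rw [h0] at this
    exact lt_irrefl _ this
  · have := h.deriv_fst t ht
    rw [h0] at this
    simp at this

/-- All defining conditions are affine equations or inequalities in the curve, so they define a
convex set. This is the purpose of the notion: linear homotopies between hairpins consist of
embeddings. -/
theorem IsHairpin.interpolate {γ γ' : ℝ → Space} (h : IsHairpin γ) (h' : IsHairpin γ') {s : ℝ}
    (hs : s ∈ Icc (0 : ℝ) 1) : IsHairpin fun t => γ t + s • (γ' t - γ t) := by
  have hs0 := hs.1
  have hs1 : 0 ≤ 1 - s := by linarith [hs.2]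
  have hd : ∀ t, deriv (fun t => γ t + s • (γ' t - γ t)) t =
      deriv γ t + s • (deriv γ' t - deriv γ t) := fun t => by
    have h1 := (h.contDiff.differentiable (by simp) t).hasDerivAt
    have h2 := (h'.contDiff.differentiable (by simp) t).hasDerivAt
    exact (h1.add ((h2.sub h1).const_smul s)).deriv
  have hpos : ∀ {a b : ℝ}, 0 < a → 0 < b → 0 < a + s * (b - a) := by
    intro a b ha hb
    rcases hs0.eq_or_lt with h0 | h0
    · rw [← h0]; linarith
    · nlinarith [mul_nonneg hs1 ha.le, mul_pos h0 hb]
  refine ⟨h.contDiff.add ((h'.contDiff.sub h.contDiff).const_smul s), ?_, ?_, ?_, ?_, ?_, ?_⟩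
  · intro t ht u hu htu
    have := hpos (sub_pos.2 (h.strictMonoOn ht hu htu)) (sub_pos.2 (h'.strictMonoOn ht hu htu))
    simp only [Prod.snd_add, Prod.fst_add, Prod.smul_snd, Prod.smul_fst, Prod.snd_sub,
      Prod.fst_sub, smul_eq_mul]
    linarith
  · intro t ht
    have := hpos (sub_pos.2 (h.lt t ht)) (sub_pos.2 (h'.lt t ht))
    simp only [Prod.snd_add, Prod.fst_add, Prod.smul_snd, Prod.smul_fst, Prod.snd_sub,
      Prod.fst_sub, smul_eq_mul]
    linarith
  · intro t ht
    simp [h.fst_eq t ht, h'.fst_eq t ht]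
  · intro t ht
    have h1 := h.one_le_fst t ht
    have h2 := h'.one_le_fst t ht
    simp only [Prod.fst_add, Prod.smul_fst, Prod.fst_sub, smul_eq_mul]
    nlinarith
  · intro t ht
    have := hpos (neg_pos.2 (h.deriv_fst t ht)) (neg_pos.2 (h'.deriv_fst t ht))
    rw [hd]
    simp only [Prod.fst_add, Prod.smul_fst, Prod.fst_sub, smul_eq_mul]
    linarith
  · have := hpos h.deriv_snd h'.deriv_snd
    rw [hd]
    simp only [Prod.snd_add, Prod.fst_add, Prod.smul_snd, Prod.smul_fst, Prod.snd_sub,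
      Prod.fst_sub, smul_eq_mul]
    exact this

/-- A wide hairpin around the line `y = m`, which leaves the plane `z = 0` in the direction `e`. -/
def hook (m e t : ℝ) : Space :=
  (2 - t ^ 2, m + smoothSign (10 / 13 * t), e * (1 - smoothSign (10 / 13 * t) ^ 2))

theorem contDiff_hook (m e : ℝ) : ContDiff ℝ ∞ (hook m e) := by
  have : ContDiff ℝ ∞ fun t : ℝ => smoothSign (10 / 13 * t) :=
    contDiff_smoothSign.comp (by fun_prop)
  unfold hook
  fun_prop

/-- Derivative of a curve given by coordinates. -/
theorem deriv_coordinates {γ : ℝ → Space} (hγ : Differentiable ℝ γ) (t : ℝ) :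
    (deriv γ t).1 = deriv (fun t => (γ t).1) t ∧
      (deriv γ t).2.1 = deriv (fun t => (γ t).2.1) t := by
  have h := (hγ t).hasDerivAt
  have h1 := (hasFDerivAt_fst (𝕜 := ℝ) (p := γ t)).comp_hasDerivAt t h
  have h2 := (hasFDerivAt_snd (𝕜 := ℝ) (p := γ t)).comp_hasDerivAt t h
  have h3 := (hasFDerivAt_fst (𝕜 := ℝ) (p := (γ t).2)).comp_hasDerivAt t h2
  exact ⟨h1.deriv.symm, h3.deriv.symm⟩

/-- A criterion in terms of the coordinates. -/
theorem isHairpin_of_coordinates {x y z : ℝ → ℝ} (hγ : ContDiff ℝ ∞ fun t => ((x t, y t, z t) : Space))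
    (hy : StrictMonoOn y (Icc (-1) 1)) (hlt : ∀ t, 1 ≤ t → y (-t) < y t)
    (hx : ∀ t, 1 ≤ t ^ 2 → x t = 2 - t ^ 2) (hx1 : ∀ t, t ^ 2 ≤ 1 → 1 ≤ x t)
    (hxd : ∀ t ≠ 0, ∃ c, HasDerivAt x c t ∧ t * c < 0) {c : ℝ} (hyd : HasDerivAt y c 0)
    (hc : 0 < c) : IsHairpin fun t => (x t, y t, z t) := by
  have hd := deriv_coordinates (hγ.differentiable (by simp))
  refine ⟨hγ, hy, hlt, hx, hx1, fun t ht => ?_, ?_⟩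
  · obtain ⟨c, hc, hc'⟩ := hxd t ht
    rw [(hd t).1, hc.deriv]
    exact hc'
  · rw [(hd 0).2, hyd.deriv]
    exact hc

theorem exists_hasDerivAt_two_sub_sq (t : ℝ) (ht : t ≠ 0) :
    ∃ c, HasDerivAt (fun t : ℝ => 2 - t ^ 2) c t ∧ t * c < 0 := by
  refine ⟨_, (hasDerivAt_pow 2 t).const_sub 2, ?_⟩
  have := mul_self_pos.2 ht
  norm_num
  linarith

theorem isHairpin_hook (m e : ℝ) : IsHairpin (hook m e) := by
  refine isHairpin_of_coordinates (contDiff_hook m e) ?_ ?_ (fun t _ => rfl)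
    (fun t ht => by linarith) exists_hasDerivAt_two_sub_sq (c := 2 * (10 / 13)) ?_ (by norm_num)
  · intro t ht u hu htu
    have := smoothSign_strictMonoOn (show 10 / 13 * t ∈ Icc (-1 : ℝ) 1 from
      ⟨by linarith [ht.1], by linarith [ht.2]⟩) (show 10 / 13 * u ∈ Icc (-1 : ℝ) 1 from
      ⟨by linarith [hu.1], by linarith [hu.2]⟩) (by linarith)
    simpa using this
  · intro t ht
    have h := smoothSign_strictMonoOn (show (0 : ℝ) ∈ Icc (-1 : ℝ) 1 by norm_num)
      (show (10 / 13 : ℝ) ∈ Icc (-1 : ℝ) 1 by norm_num) (by norm_num)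
    have h' := smoothSign_monotone (show (10 / 13 : ℝ) ≤ 10 / 13 * t by linarith)
    rw [smoothSign_zero] at h
    simp only [mul_neg, smoothSign_neg]
    linarith
  · have h1 : HasDerivAt (fun t : ℝ => 10 / 13 * t) (10 / 13) 0 := by
      simpa using (hasDerivAt_id (0 : ℝ)).const_mul (10 / 13)
    have h2 : HasDerivAt smoothSign 2 (10 / 13 * 0) := by
      rw [mul_zero]; exact hasDerivAt_smoothSign_zero
    exact (HasDerivAt.comp (0 : ℝ) h2 h1).const_add m

/-- The curves `p`, `q` lie on opposite sides of `z = 0`, as do their target hooks. For positive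
time they could meet only where both hooks lie in `z = 0`, that is, on the fixed ends, and there the
`y`-coordinates differ. -/
theorem exists_diffeo_hooks {p q : ℝ → Space} (hp : IsHairpin p) (hq : IsHairpin q)
    (hpe : ∀ t, 13 / 10 ≤ |t| → p t = hook (1 / 2) (-1) t)
    (hqe : ∀ t, 13 / 10 ≤ |t| → q t = hook (-1 / 2) 1 t)
    (hpz : ∀ t, (p t).2.2 ≤ 0) (hqz : ∀ t, 0 ≤ (q t).2.2) (hpq : ∀ t u, p t ≠ q u) :
    ∃ g : Space ≃ Space, IsDiffeo g ∧ (∀ P : Space, P.1 ≤ 0 → g P = P) ∧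
      (∀ t ∈ Icc (-√2) (√2), g (p t) = hook (1 / 2) (-1) t) ∧
      (∀ t ∈ Icc (-√2) (√2), g (q t) = hook (-1 / 2) 1 t) := by
  let γ : Bool → ℝ → Space := fun i => if i then q else p
  let η : Bool → ℝ → Space := fun i => if i then hook (-1 / 2) 1 else hook (1 / 2) (-1)
  have hγ : ∀ i, IsHairpin (γ i) := by rintro (_ | _) <;> simpa [γ]
  have hη : ∀ i, IsHairpin (η i) := by rintro (_ | _) <;> simpa [η] using isHairpin_hook _ _
  have he : ∀ i t, 13 / 10 ≤ |t| → γ i t = η i t := by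
    rintro (_ | _)
    · exact hpe
    · exact hqe
  have hint : ∀ s ∈ Icc (0 : ℝ) 1, ∀ i, IsHairpin fun t => γ i t + s • (η i t - γ i t) :=
    fun s hs i => (hγ i).interpolate (hη i) hs
  have hdisj : ∀ s ∈ Icc (0 : ℝ) 1, ∀ t u, p t + s • (hook (1 / 2) (-1) t - p t) ≠
      q u + s • (hook (-1 / 2) 1 u - q u) := by
    intro s hs t u h
    rcases hs.1.eq_or_lt with h0 | h0
    · subst h0
      exact hpq t u (by simpa using h)
    · have hz := congrArg (fun P : Space => P.2.2) h
      simp only [Prod.snd_add, Prod.smul_snd, Prod.snd_sub, smul_eq_mul, hook] at hz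
      have hσ : ∀ t, smoothSign t ^ 2 ≤ 1 := fun t => by
        nlinarith [smoothSign_le_one t, neg_one_le_smoothSign t]
      have h1 : 0 ≤ 1 - s := by linarith [hs.2]
      have e1 : smoothSign (10 / 13 * t) ^ 2 = 1 := by
        nlinarith [mul_nonneg h1 (neg_nonneg.2 (hpz t)), mul_nonneg h1 (hqz u),
          hσ (10 / 13 * t), hσ (10 / 13 * u), mul_nonneg h0.le (sub_nonneg.2 (hσ (10 / 13 * u)))]
      have e2 : smoothSign (10 / 13 * u) ^ 2 = 1 := by
        nlinarith [mul_nonneg h1 (neg_nonneg.2 (hpz t)), mul_nonneg h1 (hqz u),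
          hσ (10 / 13 * t), hσ (10 / 13 * u), mul_nonneg h0.le (sub_nonneg.2 (hσ (10 / 13 * t)))]
      have habs : ∀ t, smoothSign (10 / 13 * t) ^ 2 = 1 → 13 / 10 ≤ |t| := by
        intro t ht
        rcases sq_eq_one_iff.1 ht with h | h
        · rw [smoothSign_eq_one_iff] at h
          exact le_trans (by linarith) (le_abs_self t)
        · rw [smoothSign_eq_neg_one_iff] at h
          exact le_trans (by linarith) (neg_le_abs t)
      rw [hpe t (habs t e1), hqe u (habs u e2)] at h
      have hy := congrArg (fun P : Space => P.2.1) h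
      simp only [sub_self, smul_zero, add_zero, hook] at hy
      rcases sq_eq_one_iff.1 e1 with h2 | h2 <;>
        rcases sq_eq_one_iff.1 e2 with h3 | h3 <;> rw [h2, h3] at hy <;> norm_num at hy
  obtain ⟨g, hg, hgW, hgγ⟩ := exists_diffeo_of_linear_homotopy γ (fun i t => η i t - γ i t)
    (fun i => (hγ i).contDiff) (fun i => (hη i).contDiff.sub (hγ i).contDiff) (a := -√2) (b := √2)
    (a' := -(13 / 10)) (b' := 13 / 10)
    (fun i t _ ht => by
      have : 13 / 10 ≤ |t| := by
        by_contra h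
        exact ht (abs_le.1 (not_le.1 h).le)
      rw [he i t this, sub_self])
    (W := {P : Space | P.1 ≤ 0}) (isClosed_le continuous_fst continuous_const)
    (fun s hs i j t _ u _ h => by
      rcases i with _ | _ <;> rcases j with _ | _
      · exact ⟨rfl, (hint s hs false).injective h⟩
      · exact (hdisj s hs t u h).elim
      · exact (hdisj s hs u t h.symm).elim
      · exact ⟨rfl, (hint s hs true).injective h⟩)
    (fun s hs i t _ => (hint s hs i).deriv_ne_zero t)
    (fun s hs i t ht h => by
      have h' : (γ i t + s • (η i t - γ i t)).1 ≤ 0 := h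
      rcases le_total (t ^ 2) 1 with h1 | h1
      · have := (hint s hs i).one_le_fst t h1
        linarith
      · rw [(hint s hs i).fst_eq t h1] at h'
        nlinarith [ht.2.1, ht.2.2])
  refine ⟨g, hg, hgW, fun t ht => ?_, fun t ht => ?_⟩
  · have := hgγ false t ht
    simpa [γ, η] using this
  · have := hgγ true t ht
    simpa [γ, η] using this

/-! ### Closing one half twist -/

/-- Along a hairpin, a step which belongs to the lower branch. -/
def turn (t : ℝ) : ℝ := 1 - (1 - flatStep (2 - t ^ 2)) * Real.smoothTransition (-t)

def turnCos (t : ℝ) : ℝ := Real.cos (Real.pi * turn t)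

def turnSin (t : ℝ) : ℝ := Real.sin (Real.pi * turn t)

theorem contDiff_turn : ContDiff ℝ ∞ turn := by
  have h1 : ContDiff ℝ ∞ fun t : ℝ => flatStep (2 - t ^ 2) := contDiff_flatStep.comp (by fun_prop)
  have h2 : ContDiff ℝ ∞ fun t : ℝ => Real.smoothTransition (-t) :=
    Real.smoothTransition.contDiff.comp contDiff_neg
  unfold turn
  fun_prop

theorem contDiff_turnCos : ContDiff ℝ ∞ turnCos := (contDiff_const.mul contDiff_turn).cos

theorem contDiff_turnSin : ContDiff ℝ ∞ turnSin := (contDiff_const.mul contDiff_turn).sin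

theorem turn_mem (t : ℝ) : turn t ∈ Icc (0 : ℝ) 1 := by
  have h1 := flatStep_mem (2 - t ^ 2)
  have h2 := Real.smoothTransition.nonneg (-t)
  have h3 := Real.smoothTransition.le_one (-t)
  constructor <;> unfold turn <;> nlinarith [h1.1, h1.2]

theorem turn_of_ge {t : ℝ} (h : -1 ≤ t) : turn t = 1 := by
  rcases le_total 0 t with h0 | h0
  · rw [turn, Real.smoothTransition.zero_of_nonpos (by linarith), mul_zero, sub_zero]
  · rw [turn, flatStep_of_ge (by nlinarith), sub_self, zero_mul, sub_zero]

theorem turn_of_le {t : ℝ} (h : t ≤ -1) : turn t = flatStep (2 - t ^ 2) := by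
  rw [turn, Real.smoothTransition.one_of_one_le (by linarith)]
  ring

theorem turnCos_of_ge {t : ℝ} (h : -1 ≤ t) : turnCos t = -1 := by
  rw [turnCos, turn_of_ge h, mul_one, Real.cos_pi]

theorem turnSin_of_ge {t : ℝ} (h : -1 ≤ t) : turnSin t = 0 := by
  rw [turnSin, turn_of_ge h, mul_one, Real.sin_pi]

theorem turnCos_of_le {t : ℝ} (h : t ≤ -1) : turnCos t = Real.cos (flatAngle (2 - t ^ 2)) := by
  rw [turnCos, turn_of_le h, flatAngle]

theorem turnSin_of_le {t : ℝ} (h : t ≤ -1) : turnSin t = Real.sin (flatAngle (2 - t ^ 2)) := by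
  rw [turnSin, turn_of_le h, flatAngle]

theorem turn_end {t : ℝ} (h : t ≤ -(13 / 10)) : turnCos t = 1 ∧ turnSin t = 0 := by
  rw [turnCos_of_le (by linarith), turnSin_of_le (by linarith), flatAngle_of_le (by nlinarith)]
  simp

theorem turnSin_nonneg (t : ℝ) : 0 ≤ turnSin t :=
  Real.sin_nonneg_of_nonneg_of_le_pi (mul_nonneg Real.pi_pos.le (turn_mem t).1)
    (mul_le_of_le_one_right Real.pi_pos.le (turn_mem t).2)

theorem turnCos_mem (t : ℝ) : turnCos t ∈ Icc (-1 : ℝ) 1 := ⟨Real.neg_one_le_cos _, Real.cos_le_one _⟩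

theorem turnCos_eq_or {t : ℝ} (h : turnSin t = 0) : turnCos t = 1 ∨ turnCos t = -1 := by
  have := Real.sin_sq_add_cos_sq (Real.pi * turn t)
  change turnSin t ^ 2 + turnCos t ^ 2 = 1 at this
  rw [h] at this
  exact sq_eq_one_iff.1 (by linarith)

theorem turnCos_or_neg (t : ℝ) : turnCos t = -1 ∨ turnCos (-t) = -1 := by
  rcases le_total (-1) t with h | h
  · exact Or.inl (turnCos_of_ge h)
  · exact Or.inr (turnCos_of_ge (by linarith))

/-- A change of parameter between arcs of widths `1` and `2`. -/
def stretch (t : ℝ) : ℝ :=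
  t + Real.smoothTransition (2 * t - 1) * (√((1 + t ^ 2) / 2) - t) -
    Real.smoothTransition (-2 * t - 1) * (√((1 + t ^ 2) / 2) + t)

theorem half_one_add_sq_ne_zero (t : ℝ) : (1 + t ^ 2) / 2 ≠ 0 := by positivity

theorem contDiff_stretch : ContDiff ℝ ∞ stretch := by
  have h1 : ContDiff ℝ ∞ fun t : ℝ => Real.smoothTransition (2 * t - 1) :=
    Real.smoothTransition.contDiff.comp (by fun_prop)
  have h2 : ContDiff ℝ ∞ fun t : ℝ => Real.smoothTransition (-2 * t - 1) :=
    Real.smoothTransition.contDiff.comp (by fun_prop)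
  have h3 : ContDiff ℝ ∞ fun t : ℝ => √((1 + t ^ 2) / 2) :=
    ContDiff.sqrt (by fun_prop) half_one_add_sq_ne_zero
  unfold stretch
  fun_prop

theorem stretch_neg (t : ℝ) : stretch (-t) = -stretch t := by
  simp only [stretch, neg_sq, mul_neg, neg_mul, neg_neg]
  ring

theorem stretch_of_abs_le {t : ℝ} (h : |t| ≤ 1 / 2) : stretch t = t := by
  have := abs_le.1 h
  rw [stretch, Real.smoothTransition.zero_of_nonpos (by linarith),
    Real.smoothTransition.zero_of_nonpos (by linarith)]
  ring

theorem stretch_of_one_le {t : ℝ} (h : 1 ≤ t) : stretch t = √((1 + t ^ 2) / 2) := by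
  rw [stretch, Real.smoothTransition.one_of_one_le (by linarith),
    Real.smoothTransition.zero_of_nonpos (by linarith)]
  ring

/-- Chosen so that `3 - 2 κ²`, the `x`-coordinate of the shifted cap of width `2`, becomes `2 - t²`
along the branches, as for a cap of width `1`. -/
theorem stretch_sq {t : ℝ} (h : 1 ≤ t ^ 2) : stretch t ^ 2 = (1 + t ^ 2) / 2 := by
  have key : ∀ t, 1 ≤ t → stretch t ^ 2 = (1 + t ^ 2) / 2 := fun t ht => by
    rw [stretch_of_one_le ht, Real.sq_sqrt (by positivity)]
  rcases le_total 0 t with h0 | h0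
  · exact key t (by nlinarith)
  · rw [← neg_sq, ← stretch_neg, key (-t) (by nlinarith), neg_sq]

theorem stretch_one : stretch 1 = 1 := by
  rw [stretch_of_one_le le_rfl]; norm_num

theorem deriv_smoothTransition_nonneg (x : ℝ) : 0 ≤ deriv Real.smoothTransition x :=
  Real.smoothTransition.monotone.deriv_nonneg

theorem deriv_smoothTransition_of_lt {x : ℝ} (h : 1 < x) : deriv Real.smoothTransition x = 0 := by
  have : Real.smoothTransition =ᶠ[𝓝 x] fun _ => 1 := by
    filter_upwards [lt_mem_nhds h] with y hy
    exact Real.smoothTransition.one_of_one_le (le_of_lt hy)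
  rw [this.deriv_eq, deriv_const]

/-- The derivative is an average of `1` and the slope of the square root, plus the slope of the
transition times `√((1 + t²)/2) - t`. The last term is nonnegative for `t ≤ 1`, and for `t > 1` the
transition is constant. -/
theorem deriv_stretch_of_nonneg {t : ℝ} (ht : 0 ≤ t) : 0 < deriv stretch t := by
  have hS : ∀ x, HasDerivAt Real.smoothTransition (deriv Real.smoothTransition x) x := fun x =>
    (Real.smoothTransition.contDiff (n := 1) |>.differentiable (by simp) x).hasDerivAt
  have h1 : HasDerivAt (fun t : ℝ => Real.smoothTransition (2 * t - 1))
      (deriv Real.smoothTransition (2 * t - 1) * 2) t := by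
    have : HasDerivAt (fun t : ℝ => 2 * t - 1) 2 t := by
      simpa using ((hasDerivAt_id t).const_mul 2).sub_const 1
    exact HasDerivAt.comp t (hS _) this
  have h3 : HasDerivAt (fun t : ℝ => √((1 + t ^ 2) / 2)) (t / (2 * √((1 + t ^ 2) / 2))) t := by
    have : HasDerivAt (fun t : ℝ => (1 + t ^ 2) / 2) t t := by
      have := ((hasDerivAt_pow 2 t).const_add 1).div_const 2
      refine this.congr_deriv ?_
      simp
    exact this.sqrt (half_one_add_sq_ne_zero t)
  have he : stretch =ᶠ[𝓝 t] fun t => t + Real.smoothTransition (2 * t - 1) *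
      (√((1 + t ^ 2) / 2) - t) := by
    filter_upwards [lt_mem_nhds (show -(1 / 2) < t by linarith)] with u hu
    rw [stretch, Real.smoothTransition.zero_of_nonpos (x := -2 * u - 1) (by linarith)]
    ring
  have hd := (hasDerivAt_id t).add (h1.mul (h3.sub (hasDerivAt_id t)))
  rw [he.deriv_eq, show (fun t => t + Real.smoothTransition (2 * t - 1) *
    (√((1 + t ^ 2) / 2) - t)) = (id + (fun t : ℝ => Real.smoothTransition (2 * t - 1)) *
      ((fun t : ℝ => √((1 + t ^ 2) / 2)) - id)) from rfl, hd.deriv]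
  simp only [Pi.sub_apply, id]
  have hs0 := Real.smoothTransition.nonneg (2 * t - 1)
  have hs1 := Real.smoothTransition.le_one (2 * t - 1)
  have hw : 0 < √((1 + t ^ 2) / 2) := Real.sqrt_pos.2 (by positivity)
  have hA : 0 ≤ deriv Real.smoothTransition (2 * t - 1) * 2 * (√((1 + t ^ 2) / 2) - t) := by
    rcases le_or_gt t 1 with h | h
    · refine mul_nonneg (mul_nonneg (deriv_smoothTransition_nonneg _) (by norm_num)) ?_
      rw [sub_nonneg]
      exact Real.le_sqrt_of_sq_le (by nlinarith)
    · rw [deriv_smoothTransition_of_lt (by linarith)]; simp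
  have hB : 0 < 1 + Real.smoothTransition (2 * t - 1) * (t / (2 * √((1 + t ^ 2) / 2)) - 1) := by
    rcases ht.eq_or_lt with h | h
    · rw [← h, Real.smoothTransition.zero_of_nonpos (by norm_num)]; norm_num
    · have : 0 < t / (2 * √((1 + t ^ 2) / 2)) := by positivity
      rcases hs0.eq_or_lt with h' | h'
      · rw [← h']; norm_num
      · nlinarith [mul_pos h' this]
  linarith

theorem deriv_stretch_pos (t : ℝ) : 0 < deriv stretch t := by
  rcases le_total 0 t with h | h
  · exact deriv_stretch_of_nonneg h
  · have h1 := deriv_stretch_of_nonneg (t := -t) (by linarith)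
    have h2 : deriv (fun t => stretch (-t)) t = deriv (fun t => -stretch t) t := by
      simp only [stretch_neg]
    rw [deriv_comp_neg, deriv.fun_neg] at h2
    linarith

theorem stretch_strictMono : StrictMono stretch := strictMono_of_deriv_pos deriv_stretch_pos

theorem stretch_mem {t : ℝ} (h : t ∈ Icc (-1 : ℝ) 1) : stretch t ∈ Icc (-1 : ℝ) 1 := by
  have h1 := stretch_strictMono.monotone h.1
  have h2 := stretch_strictMono.monotone h.2
  rw [stretch_neg, stretch_one] at h1
  rw [stretch_one] at h2
  exact ⟨h1, h2⟩

theorem image_stretch : stretch '' Icc (-1) 1 = Icc (-1) 1 := by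
  refine subset_antisymm (image_subset_iff.2 fun t ht => stretch_mem ht) ?_
  have := intermediate_value_Icc (show (-1 : ℝ) ≤ 1 by norm_num) contDiff_stretch.continuous.continuousOn
  rwa [stretch_neg, stretch_one] at this

theorem smoothSign_stretch {t : ℝ} (h : 1 ≤ t ^ 2) : smoothSign (stretch t) = smoothSign t := by
  rcases le_total 0 t with h0 | h0
  · have h1 : 1 ≤ t := by nlinarith
    have := stretch_strictMono.monotone h1
    rw [stretch_one] at this
    rw [smoothSign_of_one_le h1, smoothSign_of_one_le this]
  · have h1 : t ≤ -1 := by nlinarith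
    have := stretch_strictMono.monotone h1
    rw [stretch_neg, stretch_one] at this
    rw [smoothSign_of_le h1, smoothSign_of_le this]

/-! #### The four hairpins -/

/-- For `t ≤ -1` a hairpin follows one strand of the block to the right, for `-1 ≤ t ≤ 1` the cap,
and for `t ≥ 1` another strand back. "Lower" and "upper" mean `z ≤ 0` and `z ≥ 0`; the suffix names
the cap, closed after `A` for `∞` and after `B` for `0`. In both cases the lower hairpin runs from
position `2` to `0` and the upper one from `3` to `1`. -/
def lowerInf (t : ℝ) : Space :=
  (2 - t ^ 2, 1 / 2 + 1 / 2 * smoothSign t - 1 / 2 * turnCos t, -1 / 2 * turnSin t)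

def upperInf (t : ℝ) : Space :=
  (2 - t ^ 2, -1 / 2 + 1 / 2 * smoothSign t + 1 / 2 * turnCos (-t), 1 / 2 * turnSin (-t))

def lowerZero (t : ℝ) : Space :=
  (2 - t ^ 2, 1 / 2 + 1 / 2 * smoothSign t + 1 / 2 * turnCos (-t), -1 / 2 * turnSin (-t))

def upperZero (t : ℝ) : Space :=
  (3 - 2 * stretch t ^ 2, 3 / 2 * smoothSign (stretch t) - 1 / 2 * (1 + turnCos (-t)),
    1 / 2 * turnSin (-t))

theorem contDiff_hairpins : ContDiff ℝ ∞ lowerInf ∧ ContDiff ℝ ∞ upperInf ∧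
    ContDiff ℝ ∞ lowerZero ∧ ContDiff ℝ ∞ upperZero := by
  have h1 := contDiff_turnCos
  have h2 := contDiff_turnSin
  have h3 : ContDiff ℝ ∞ fun t : ℝ => turnCos (-t) := h1.comp contDiff_neg
  have h4 : ContDiff ℝ ∞ fun t : ℝ => turnSin (-t) := h2.comp contDiff_neg
  have h5 := contDiff_smoothSign
  have h6 := contDiff_stretch
  have h7 : ContDiff ℝ ∞ fun t : ℝ => smoothSign (stretch t) := h5.comp h6
  unfold lowerInf upperInf lowerZero upperZero
  exact ⟨by fun_prop, by fun_prop, by fun_prop, by fun_prop⟩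

theorem hasDerivAt_half_smoothSign (c : ℝ) :
    HasDerivAt (fun t => c + 1 / 2 * smoothSign t) 1 0 :=
  ((hasDerivAt_smoothSign_zero.const_mul (1 / 2)).const_add c).congr_deriv (by norm_num)

theorem strictMonoOn_half_smoothSign {y : ℝ → ℝ} {c r : ℝ} (hr : 0 < r)
    (h : ∀ t ∈ Icc (-1 : ℝ) 1, y t = c + r * smoothSign t) : StrictMonoOn y (Icc (-1) 1) := by
  intro t ht u hu htu
  rw [h t ht, h u hu]
  have := mul_lt_mul_of_pos_left (smoothSign_strictMonoOn ht hu htu) hr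
  linarith

theorem eventually_mem_Icc : ∀ᶠ t : ℝ in 𝓝 0, t ∈ Icc (-1 : ℝ) 1 :=
  Icc_mem_nhds (by norm_num) (by norm_num)

theorem isHairpin_lowerInf : IsHairpin lowerInf := by
  have hy : ∀ t ∈ Icc (-1 : ℝ) 1, 1 / 2 + 1 / 2 * smoothSign t - 1 / 2 * turnCos t =
      1 + 1 / 2 * smoothSign t := fun t ht => by
    rw [turnCos_of_ge ht.1]; ring
  refine isHairpin_of_coordinates contDiff_hairpins.1 (strictMonoOn_half_smoothSign (by norm_num) hy)
    (fun t ht => ?_) (fun t _ => rfl) (fun t ht => by linarith) exists_hasDerivAt_two_sub_sq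
    ((hasDerivAt_half_smoothSign 1).congr_of_eventuallyEq (eventually_mem_Icc.mono hy)) one_pos
  rw [smoothSign_neg, smoothSign_of_one_le ht, turnCos_of_ge (t := t) (by linarith)]
  linarith [(turnCos_mem (-t)).1]

theorem isHairpin_upperInf : IsHairpin upperInf := by
  have hy : ∀ t ∈ Icc (-1 : ℝ) 1, -1 / 2 + 1 / 2 * smoothSign t + 1 / 2 * turnCos (-t) =
      -1 + 1 / 2 * smoothSign t := fun t ht => by
    rw [turnCos_of_ge (t := -t) (by linarith [ht.2])]; ring
  refine isHairpin_of_coordinates contDiff_hairpins.2.1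
    (strictMonoOn_half_smoothSign (by norm_num) hy)
    (fun t ht => ?_) (fun t _ => rfl) (fun t ht => by linarith) exists_hasDerivAt_two_sub_sq
    ((hasDerivAt_half_smoothSign _).congr_of_eventuallyEq (eventually_mem_Icc.mono hy)) one_pos
  rw [smoothSign_neg, smoothSign_of_one_le ht, neg_neg, turnCos_of_ge (t := t) (by linarith)]
  linarith [(turnCos_mem (-t)).1]

theorem isHairpin_lowerZero : IsHairpin lowerZero := by
  have hy : ∀ t ∈ Icc (-1 : ℝ) 1, 1 / 2 + 1 / 2 * smoothSign t + 1 / 2 * turnCos (-t) =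
      0 + 1 / 2 * smoothSign t := fun t ht => by
    rw [turnCos_of_ge (t := -t) (by linarith [ht.2])]; ring
  refine isHairpin_of_coordinates contDiff_hairpins.2.2.1
    (strictMonoOn_half_smoothSign (by norm_num) hy)
    (fun t ht => ?_) (fun t _ => rfl) (fun t ht => by linarith) exists_hasDerivAt_two_sub_sq
    ((hasDerivAt_half_smoothSign _).congr_of_eventuallyEq (eventually_mem_Icc.mono hy)) one_pos
  rw [smoothSign_neg, smoothSign_of_one_le ht, neg_neg, turnCos_of_ge (t := t) (by linarith)]
  linarith [(turnCos_mem (-t)).1]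

theorem isHairpin_upperZero : IsHairpin upperZero := by
  have hy : ∀ t ∈ Icc (-1 : ℝ) 1, 3 / 2 * smoothSign (stretch t) - 1 / 2 * (1 + turnCos (-t)) =
      3 / 2 * smoothSign (stretch t) := fun t ht => by
    rw [turnCos_of_ge (t := -t) (by linarith [ht.2])]; ring
  refine isHairpin_of_coordinates contDiff_hairpins.2.2.2 (c := 3) ?_ (fun t ht => ?_)
    (fun t ht => by rw [stretch_sq ht]; ring) (fun t ht => ?_) (fun t ht => ?_) ?_ (by norm_num)
  · intro t ht u hu htu
    change _ - _ < _ - _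
    rw [hy t ht, hy u hu]
    have := smoothSign_strictMonoOn (stretch_mem ht) (stretch_mem hu) (stretch_strictMono htu)
    linarith
  · have h2 : 1 ≤ t ^ 2 := by nlinarith
    rw [smoothSign_stretch h2, smoothSign_stretch (by rwa [neg_sq]), smoothSign_neg,
      smoothSign_of_one_le ht, neg_neg, turnCos_of_ge (t := t) (by linarith)]
    linarith [(turnCos_mem (-t)).2]
  · have := stretch_mem (abs_le.1 (sq_le_one_iff_abs_le_one t |>.1 ht))
    nlinarith [this.1, this.2]
  · have h1 := (contDiff_stretch.differentiable (by simp) t).hasDerivAt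
    have h2 := ((h1.pow 2).const_mul 2).const_sub 3
    refine ⟨_, h2, ?_⟩
    have h3 := deriv_stretch_pos t
    have h4 : 0 < t * stretch t := by
      have h0 : stretch 0 = 0 := stretch_of_abs_le (by norm_num)
      rcases lt_or_gt_of_ne ht with h | h
      · have := stretch_strictMono h
        rw [h0] at this
        exact mul_pos_of_neg_of_neg h this
      · have := stretch_strictMono h
        rw [h0] at this
        exact mul_pos h this
    have := mul_pos h4 h3
    norm_num
    linarith
  · have h : HasDerivAt (fun t => 3 / 2 * smoothSign t) 3 0 :=
      (hasDerivAt_smoothSign_zero.const_mul (3 / 2)).congr_deriv (by norm_num)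
    refine h.congr_of_eventuallyEq ?_
    filter_upwards [Icc_mem_nhds (show -(1 / 2) < (0 : ℝ) by norm_num)
      (show (0 : ℝ) < 1 / 2 by norm_num)] with t ht
    rw [hy t ⟨by linarith [ht.1], by linarith [ht.2]⟩, stretch_of_abs_le (abs_le.2 ht)]

/-- The bound `13 / 10` lies between `√(5/3)`, beyond which `2 - t² ≤ 1/3` and the block is still
untwisted, and `√2`, where the plane `x = 0` is reached. The hooks become flat exactly from there
on. -/
theorem hairpins_end {t : ℝ} (h : 13 / 10 ≤ |t|) :
    lowerInf t = hook (1 / 2) (-1) t ∧ upperInf t = hook (-1 / 2) 1 t ∧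
      lowerZero t = hook (1 / 2) (-1) t ∧ upperZero t = hook (-1 / 2) 1 t := by
  have h2 : 1 ≤ t ^ 2 := by
    rw [← sq_abs]; nlinarith
  simp only [lowerInf, upperInf, lowerZero, upperZero, hook, smoothSign_stretch h2, stretch_sq h2]
  rcases le_abs.1 h with h | h
  · have h3 := turn_end (t := -t) (by linarith)
    rw [h3.1, h3.2, turnCos_of_ge (t := t) (by linarith), turnSin_of_ge (t := t) (by linarith),
      smoothSign_of_one_le (t := t) (by linarith), smoothSign_of_one_le (by linarith)]
    simp only [Prod.mk.injEq]
    norm_num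
    ring
  · have h3 := turn_end (t := t) (by linarith)
    rw [h3.1, h3.2, turnCos_of_ge (t := -t) (by linarith), turnSin_of_ge (t := -t) (by linarith),
      smoothSign_of_le (t := t) (by linarith), smoothSign_of_le (by linarith)]
    simp only [Prod.mk.injEq]
    norm_num
    ring

/-- A common point lies in `z = 0` and has `u = ±t`. There each cosine is `±1`, and the possible
values of `y` turn out to be distinct. -/
theorem lowerInf_ne_upperInf (t u : ℝ) : lowerInf t ≠ upperInf u := by
  intro h
  simp only [lowerInf, upperInf, Prod.mk.injEq] at h
  obtain ⟨hx, hy, hz⟩ := h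
  have hs := turnSin_nonneg t
  have hs' := turnSin_nonneg (-u)
  have h0 : turnSin t = 0 := by linarith
  rcases sq_eq_sq_iff_eq_or_eq_neg.1 (show u ^ 2 = t ^ 2 by linarith) with rfl | rfl
  · have h1 := turnCos_mem u
    have h2 := turnCos_mem (-u)
    rcases turnCos_or_neg u with h | h <;> linarith [h1.2, h2.2]
  · rw [neg_neg, smoothSign_neg] at hy
    rcases turnCos_eq_or h0 with h | h
    · have : t = 0 := smoothSign_eq_zero_iff.1 (by linarith)
      rw [this, turnCos_of_ge (by norm_num)] at h
      norm_num at h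
    · linarith [neg_one_le_smoothSign t]

/-- Along the branches only finitely many heights are possible in `z = 0`, and they do not match. On
the turning parts the two curves are the concentric caps. -/
theorem lowerZero_ne_upperZero (t u : ℝ) : lowerZero t ≠ upperZero u := by
  intro h
  simp only [lowerZero, upperZero, Prod.mk.injEq] at h
  obtain ⟨hx, hy, hz⟩ := h
  have hs := turnSin_nonneg (-t)
  have hs' := turnSin_nonneg (-u)
  have h0 := turnCos_eq_or (show turnSin (-t) = 0 by linarith)
  have h0' := turnCos_eq_or (show turnSin (-u) = 0 by linarith)
  rcases le_total 1 (u ^ 2) with hu | hu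
  · have hσ : smoothSign u = 1 ∨ smoothSign u = -1 := by
      rcases le_total 0 u with h | h
      · exact Or.inl (smoothSign_of_one_le (by nlinarith))
      · exact Or.inr (smoothSign_of_le (by nlinarith))
    rw [stretch_sq hu] at hx
    rw [smoothSign_stretch hu] at hy
    rcases sq_eq_sq_iff_eq_or_eq_neg.1 (show t ^ 2 = u ^ 2 by linarith) with rfl | rfl
    · rcases h0 with h | h <;> rcases hσ with h' | h' <;> linarith
    · rw [neg_neg] at hy h0
      rw [smoothSign_neg] at hy
      have := turnCos_or_neg u
      rcases h0 with h | h <;> rcases h0' with h' | h' <;> rcases hσ with h'' | h'' <;>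
        rcases this with h3 | h3 <;> linarith
  · have hu' := abs_le.1 (sq_le_one_iff_abs_le_one u |>.1 hu)
    have hκ := stretch_mem hu'
    rw [turnCos_of_ge (t := -u) (by linarith [hu'.2])] at hy
    have ht : t ^ 2 ≤ 1 := by nlinarith [hκ.1, hκ.2]
    have ht' := abs_le.1 (sq_le_one_iff_abs_le_one t |>.1 ht)
    rw [turnCos_of_ge (t := -t) (by linarith [ht'.2])] at hy
    refine concentric_caps_disjoint (t := t) (u := stretch u) (by linarith) ?_
    rw [show smoothSign t = 3 * smoothSign (stretch u) by linarith]
    ring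

/-- Cutting at `t = ±1` leaves two branches parametrized by `x = 2 - t²`, increasing on the first
and decreasing on the second; hence the sign `-s` for the returning strand. The parameters `±√2`
correspond to `x = 0`. -/
theorem orientedArc_eq_union_of_hairpin {γ β β' δ : ℝ → Space} {κ : ℝ → ℝ}
    (hγ : Differentiable ℝ γ) (hβ : Differentiable ℝ β) (hβ' : Differentiable ℝ β')
    (hδ : Differentiable ℝ δ) (hκ : Differentiable ℝ κ) (hκ' : ∀ t, 0 < deriv κ t)
    (hκi : κ '' Icc (-1) 1 = Icc (-1) 1) (h1 : ∀ t ≤ -1, γ t = β (2 - t ^ 2))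
    (h2 : ∀ t ∈ Icc (-1 : ℝ) 1, γ t = δ (κ t)) (h3 : ∀ t, 1 ≤ t → γ t = β' (2 - t ^ 2)) (s : ℝ) :
    orientedArc γ (Icc (-√2) (√2)) s = orientedArc β (Icc 0 1) s ∪
      orientedArc δ (Icc (-1) 1) s ∪ orientedArc β' (Icc 0 1) (-s) := by
  have hr : (1 : ℝ) < √2 := Real.lt_sqrt_of_sq_lt (by norm_num)
  have hr2 : √2 ^ 2 = 2 := Real.sq_sqrt (by norm_num)
  have hφ : Differentiable ℝ fun t : ℝ => 2 - t ^ 2 := by fun_prop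
  have hφd : ∀ t : ℝ, deriv (fun t : ℝ => 2 - t ^ 2) t = -(2 * t) := fun t => by
    simp
  have hsqrt : ∀ x ∈ Icc (0 : ℝ) 1, √(2 - x) ∈ Icc 1 (√2) ∧ √(2 - x) ^ 2 = 2 - x := fun x hx =>
    ⟨⟨Real.le_sqrt_of_sq_le (by linarith [hx.2]), Real.sqrt_le_sqrt (by linarith [hx.1])⟩,
      Real.sq_sqrt (by linarith [hx.2])⟩
  rw [orientedArc_Icc_union γ (show -√2 ≤ 1 by linarith) hr.le,
    orientedArc_Icc_union γ (show -√2 ≤ -1 by linarith) (show (-1 : ℝ) ≤ 1 by norm_num)]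
  congr 1
  · congr 1
    · refine (orientedArc_comp_of_eqOn (a := -√2) (b := -1) (ε := 1) hγ hβ hφ (by linarith) (by norm_num) (fun t ht => ?_) ?_
        (fun t ht => h1 t ht.2) s).trans (by rw [one_mul])
      · rw [hφd]; linarith [ht.2]
      · refine subset_antisymm (image_subset_iff.2 fun t ht => ⟨?_, ?_⟩) fun x hx => ?_
        · nlinarith [ht.1, ht.2]
        · nlinarith [ht.1, ht.2]
        · obtain ⟨⟨ha, hb⟩, hc⟩ := hsqrt x hx
          exact ⟨-√(2 - x), ⟨by linarith, by linarith⟩, by simp only [neg_sq, hc]; ring⟩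
    · exact (orientedArc_comp_of_eqOn (ε := 1) hγ hδ hκ (by norm_num) (by norm_num)
        (fun t _ => by rw [one_mul]; exact hκ' t) hκi h2 s).trans (by rw [one_mul])
  · rw [← neg_one_mul s]
    refine orientedArc_comp_of_eqOn hγ hβ' hφ hr (by norm_num) (fun t ht => ?_) ?_
      (fun t ht => h3 t ht.1) s
    · rw [hφd]; linarith [ht.1]
    · refine subset_antisymm (image_subset_iff.2 fun t ht => ⟨?_, ?_⟩) fun x hx => ?_
      · nlinarith [ht.1, ht.2]
      · nlinarith [ht.1, ht.2]
      · obtain ⟨h, hc⟩ := hsqrt x hx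
        exact ⟨√(2 - x), h, by simp only [hc]; ring⟩

/-- Two arcs hooked onto each other once. -/
def hooks : OTangle where
  valid := {d | d 0 = -d 2 ∧ d 1 = -d 3}
  curves d := orientedArc (hook (1 / 2) (-1)) (Icc (-√2) (√2)) (d 2) ∪
    orientedArc (hook (-1 / 2) 1) (Icc (-√2) (√2)) (d 3)
  nonneg := by
    have h : ∀ m e s, ∀ u ∈ orientedArc (hook m e) (Icc (-√2) (√2)) s, 0 ≤ u.1.1 := by
      rintro m e s u ⟨t, ht, c, -, rfl⟩
      have := abs_le.2 ht
      have h2 := Real.sq_sqrt (show (0 : ℝ) ≤ 2 by norm_num)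
      change 0 ≤ 2 - t ^ 2
      rw [sub_nonneg, ← h2]
      exact sq_le_sq' ht.1 ht.2
    rintro d u (hu | hu) <;> exact h _ _ _ u hu

theorem equiv_hooks {T : OTangle} (hT : T.valid = hooks.valid) {p q : ℝ → Space}
    (hp : IsHairpin p) (hq : IsHairpin q)
    (hpe : ∀ t, 13 / 10 ≤ |t| → p t = hook (1 / 2) (-1) t)
    (hqe : ∀ t, 13 / 10 ≤ |t| → q t = hook (-1 / 2) 1 t)
    (hpz : ∀ t, (p t).2.2 ≤ 0) (hqz : ∀ t, 0 ≤ (q t).2.2) (hpq : ∀ t u, p t ≠ q u)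
    (hc : ∀ d ∈ T.valid, T.curves d = orientedArc p (Icc (-√2) (√2)) (d 2) ∪
      orientedArc q (Icc (-√2) (√2)) (d 3)) : T ≈ hooks := by
  obtain ⟨g, hg, hg0, hgp, hgq⟩ := exists_diffeo_hooks hp hq hpe hqe hpz hqz hpq
  have hd : ∀ {γ : ℝ → Space}, IsHairpin γ → Differentiable ℝ γ := fun h =>
    h.contDiff.differentiable (by simp)
  have hr : -√2 < √2 := by
    have := Real.sqrt_pos.2 (show (0 : ℝ) < 2 by norm_num)
    linarith
  refine ⟨hT, g, hg, hg0, fun d hdv => ?_⟩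
  rw [hc d hdv, image_union, push_orientedArc hg.differentiable (hd hp),
    push_orientedArc hg.differentiable (hd hq)]
  exact congrArg₂ _
    (orientedArc_congr (hg.differentiable.comp (hd hp)) (hd (isHairpin_hook _ _)) hr hgp _)
    (orientedArc_congr (hg.differentiable.comp (hd hq)) (hd (isHairpin_hook _ _)) hr hgq _)

theorem iUnion_fin_four (s : Fin 4 → OrientedCurves) : ⋃ j, s j = s 0 ∪ s 1 ∪ s 2 ∪ s 3 := by
  ext u
  simp [Fin.exists_fin_succ, or_assoc]

theorem four_arcs (a b c d x y : OrientedCurves) :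
    a ∪ b ∪ c ∪ d ∪ (x ∪ y) = (c ∪ x ∪ a) ∪ (d ∪ y ∪ b) := by
  ext u
  simp only [mem_union]
  tauto

theorem twist_zero_one_capInf : twist 0 1 capInf ≈ hooks := by
  have h0 := twist_equiv_flatTwist 0 capInf
  rw [pow_zero] at h0
  refine Setoid.trans h0 ?_
  have hperm : blockPerm 0 ((-1) ^ 0) = Equiv.swap 1 2 := blockPerm_zero_pow
  have hdiff := fun k j => differentiable_blockStrand k contDiff_flatAngle j
  have hσ := differentiable_rightCap
  obtain ⟨c1, c2, c3, c4⟩ := contDiff_hairpins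
  refine equiv_hooks ?_ isHairpin_lowerInf isHairpin_upperInf (fun t h => (hairpins_end h).1)
    (fun t h => (hairpins_end h).2.1) (fun t => ?_) (fun t => ?_) lowerInf_ne_upperInf fun d hd => ?_
  · ext d
    change d ∘ blockPerm 0 _ ∈ capInf.valid ↔ d ∈ hooks.valid
    rw [hperm]
    rfl
  · have := turnSin_nonneg t
    simp only [lowerInf]; linarith
  · have := turnSin_nonneg (-t)
    simp only [upperInf]; linarith
  -- Validity says that the direction at the far end of each hairpin is opposite to that at its
  -- start, which is the sign acquired by the returning branch.
  · have hv : d 0 = -d 2 ∧ d 1 = -d 3 := by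
      have hd' : d ∘ blockPerm 0 ((-1) ^ 0) ∈ capInf.valid := hd
      rw [hperm] at hd'
      exact hd'
    change (⋃ j, _) ∪ push (shift 1) '' (orientedArc _ _ ((d ∘ blockPerm 0 ((-1) ^ 0)) 1) ∪
      orientedArc _ _ ((d ∘ blockPerm 0 ((-1) ^ 0)) 3)) = _
    rw [hperm, show (d ∘ Equiv.swap 1 2) 1 = d 2 from rfl,
      show (d ∘ Equiv.swap 1 2) 3 = d 3 from rfl, image_union, iUnion_fin_four, four_arcs,
      push_orientedArc (isDiffeo_shift 1).differentiable (hσ _ _ _ _),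
      push_orientedArc (isDiffeo_shift 1).differentiable (hσ _ _ _ _), hv.1, hv.2]
    have hs := (isDiffeo_shift 1).differentiable
    refine congrArg₂ _ (Eq.symm ?_) (Eq.symm ?_)
    · refine orientedArc_eq_union_of_hairpin (c1.differentiable (by simp)) (hdiff 0 2) (hdiff 0 0)
        (hs.comp (hσ _ _ _ _)) differentiable_id (fun t => by simp) (by simp) (fun t ht => ?_)
        (fun t ht => ?_) (fun t ht => ?_) _
      · rw [(blockStrand_zero _ _).2.2.1, lowerInf, turnCos_of_le ht, turnSin_of_le ht,
          smoothSign_of_le ht]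
        simp only [Prod.mk.injEq]; norm_num
      · rw [Function.comp, shift_rightCap, lowerInf, turnCos_of_ge ht.1, turnSin_of_ge ht.1]
        simp only [Prod.mk.injEq, id]; norm_num
        constructor <;> ring
      · rw [(blockStrand_zero _ _).1, lowerInf, turnCos_of_ge (by linarith),
          turnSin_of_ge (by linarith), smoothSign_of_one_le ht]
        norm_num
    · refine orientedArc_eq_union_of_hairpin (c2.differentiable (by simp)) (hdiff 0 3) (hdiff 0 1)
        (hs.comp (hσ _ _ _ _)) differentiable_id (fun t => by simp) (by simp) (fun t ht => ?_)
        (fun t ht => ?_) (fun t ht => ?_) _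
      · rw [(blockStrand_zero _ _).2.2.2, upperInf, turnCos_of_ge (by linarith),
          turnSin_of_ge (by linarith), smoothSign_of_le ht]
        norm_num
      · rw [Function.comp, shift_rightCap, upperInf, turnCos_of_ge (t := -t) (by linarith [ht.2]),
          turnSin_of_ge (t := -t) (by linarith [ht.2])]
        simp only [Prod.mk.injEq, id]; norm_num
        constructor <;> ring
      · rw [(blockStrand_zero _ _).2.1, upperInf, turnCos_of_le (t := -t) (by linarith),
          turnSin_of_le (t := -t) (by linarith), smoothSign_of_one_le ht, neg_sq]
        simp only [Prod.mk.injEq]; norm_num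

/-- Positive powers of `B` turn through negative angles, hence `-flatAngle`. The outer cap has width
`2` and is reparametrized by `stretch`. -/
theorem twist_one_one_capZero : twist 1 1 capZero ≈ hooks := by
  have hθ : ContDiff ℝ ∞ fun x => -flatAngle x := contDiff_flatAngle.neg
  refine Setoid.trans (profTwist_equiv (contDiff_naturalAngle 1 1) hθ (fun x hx => ?_)
    (fun x hx => ?_) _) ?_
  · rw [naturalAngle_of_nonpos _ _ hx, flatAngle_of_le (by linarith), neg_zero]
  · rw [naturalAngle_of_one_le _ _ hx, flatAngle_of_ge (by linarith)]
    simp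
  have hperm : blockPerm 1 1 = Equiv.swap 0 1 := by
    simp [blockPerm, upperPos_one]
  have hdiff := fun k j => differentiable_blockStrand k hθ j
  have hσ := differentiable_rightCap
  obtain ⟨c1, c2, c3, c4⟩ := contDiff_hairpins
  refine equiv_hooks ?_ isHairpin_lowerZero isHairpin_upperZero
    (fun t h => (hairpins_end h).2.2.1) (fun t h => (hairpins_end h).2.2.2) (fun t => ?_)
    (fun t => ?_) lowerZero_ne_upperZero fun d hd => ?_
  · ext d
    change d ∘ blockPerm 1 1 ∈ capZero.valid ↔ d ∈ hooks.valid
    rw [hperm]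
    rfl
  · have := turnSin_nonneg (-t)
    simp only [lowerZero]; linarith
  · have := turnSin_nonneg (-t)
    simp only [upperZero]; linarith
  · have hv : d 0 = -d 2 ∧ d 1 = -d 3 := by
      have hd' : d ∘ blockPerm 1 1 ∈ capZero.valid := hd
      rw [hperm] at hd'
      exact hd'
    change (⋃ j, _) ∪ push (shift 1) '' (orientedArc _ _ ((d ∘ blockPerm 1 1) 2) ∪
      orientedArc _ _ ((d ∘ blockPerm 1 1) 3)) = _
    rw [hperm, show (d ∘ Equiv.swap 0 1) 2 = d 2 from rfl,
      show (d ∘ Equiv.swap 0 1) 3 = d 3 from rfl, image_union, iUnion_fin_four, four_arcs,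
      push_orientedArc (isDiffeo_shift 1).differentiable (hσ _ _ _ _),
      push_orientedArc (isDiffeo_shift 1).differentiable (hσ _ _ _ _), hv.1, hv.2]
    have hs := (isDiffeo_shift 1).differentiable
    refine congrArg₂ _ (Eq.symm ?_) (Eq.symm ?_)
    · refine orientedArc_eq_union_of_hairpin (c3.differentiable (by simp)) (hdiff 1 2) (hdiff 1 0)
        (hs.comp (hσ _ _ _ _)) differentiable_id (fun t => by simp) (by simp) (fun t ht => ?_)
        (fun t ht => ?_) (fun t ht => ?_) _
      · rw [(blockStrand_one _ _).2.2.1, lowerZero, turnCos_of_ge (by linarith),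
          turnSin_of_ge (by linarith), smoothSign_of_le ht]
        norm_num
      · rw [Function.comp, shift_rightCap, lowerZero, turnCos_of_ge (t := -t) (by linarith [ht.2]),
          turnSin_of_ge (t := -t) (by linarith [ht.2])]
        simp only [Prod.mk.injEq, id]; norm_num
        ring
      · rw [(blockStrand_one _ _).1, lowerZero, turnCos_of_le (t := -t) (by linarith),
          turnSin_of_le (t := -t) (by linarith), smoothSign_of_one_le ht, neg_sq]
        simp only [Prod.mk.injEq, Real.cos_neg, Real.sin_neg]; norm_num
    · refine orientedArc_eq_union_of_hairpin (c4.differentiable (by simp)) (hdiff 1 3) (hdiff 1 1)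
        (hs.comp (hσ _ _ _ _)) (contDiff_stretch.differentiable (by simp)) deriv_stretch_pos
        image_stretch (fun t ht => ?_) (fun t ht => ?_) (fun t ht => ?_) _
      · have h2 : 1 ≤ t ^ 2 := by nlinarith
        rw [(blockStrand_one _ _).2.2.2, upperZero, turnCos_of_ge (by linarith),
          turnSin_of_ge (by linarith), smoothSign_stretch h2, stretch_sq h2, smoothSign_of_le ht]
        simp only [Prod.mk.injEq]; norm_num
        ring
      · rw [Function.comp, shift_rightCap, upperZero, turnCos_of_ge (t := -t) (by linarith [ht.2]),
          turnSin_of_ge (t := -t) (by linarith [ht.2])]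
        simp only [Prod.mk.injEq]; norm_num
        ring
      · have h2 : 1 ≤ t ^ 2 := by nlinarith
        rw [(blockStrand_one _ _).2.1, upperZero, turnCos_of_le (t := -t) (by linarith),
          turnSin_of_le (t := -t) (by linarith), smoothSign_stretch h2, stretch_sq h2,
          smoothSign_of_one_le ht, neg_sq]
        simp only [Prod.mk.injEq, Real.cos_neg, Real.sin_neg]; norm_num
        constructor <;> ring

theorem twist_one_capInf : twist 0 1 capInf ≈ twist 1 1 capZero :=
  Setoid.trans twist_zero_one_capInf (Setoid.symm twist_one_one_capZero)

/-! ### Mirror images -/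

/-- The reflection in the plane of the diagrams. -/
def reflection : Space ≃ Space where
  toFun P := (P.1, P.2.1, -P.2.2)
  invFun P := (P.1, P.2.1, -P.2.2)
  left_inv P := by simp
  right_inv P := by simp

theorem reflection_apply (x y z : ℝ) : reflection (x, y, z) = (x, y, -z) := rfl

theorem isDiffeo_reflection : IsDiffeo reflection := by
  have : ContDiff ℝ ∞ fun P : Space => ((P.1, P.2.1, -P.2.2) : Space) := by fun_prop
  exact ⟨this, this⟩

namespace OTangle

theorem equiv_of_curves_eq {T T' : OTangle} (hv : T.valid = T'.valid)
    (h : ∀ d, T.curves d = T'.curves d) : T ≈ T' :=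
  ⟨hv, Equiv.refl _, IsDiffeo.refl, fun _ _ => rfl, fun d _ => by rw [push_id, image_id, h]⟩

def mirror (T : OTangle) : OTangle where
  valid := T.valid
  curves d := push reflection '' T.curves d
  nonneg := by
    rintro d _ ⟨u, hu, rfl⟩
    exact T.nonneg d u hu

theorem mirror_congr {T T' : OTangle} (h : T ≈ T') : T.mirror ≈ T'.mirror := by
  obtain ⟨hv, g, hg, hf, h⟩ := h
  have hr := isDiffeo_reflection
  refine ⟨hv, (reflection.symm.trans g).trans reflection, (hr.symm.trans hg).trans hr,
    fun P hP => ?_, fun d hd => ?_⟩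
  · have : g (reflection.symm P) = reflection.symm P := hf _ hP
    simp [this]
  · change push _ '' (push _ '' _) = push _ '' _
    rw [push_image_trans (hr.symm.trans hg) hr, push_image_trans hr.symm hg, push_symm_image hr,
      h d hd]

end OTangle

/-- Reflection in the plane of the diagram reverses every rotation and commutes with the shift. The
caps are planar, so the relation for `-1` below follows from the one for `1`. -/
theorem twist_mirror (k : ℕ) (b : ℤ) (T : OTangle) :
    twist k (-b) T.mirror ≈ (twist k b T).mirror := by
  have hr := isDiffeo_reflection
  have hs := isDiffeo_shift 1
  have hp : blockPerm k (-b) = blockPerm k b := by simp [blockPerm]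
  refine OTangle.equiv_of_curves_eq ?_ fun d => ?_
  · ext d
    change d ∘ blockPerm k (-b) ∈ T.valid ↔ d ∘ blockPerm k b ∈ T.valid
    rw [hp]
  · change block k _ d ∪ push _ '' (push _ '' T.curves (d ∘ blockPerm k (-b))) =
      push _ '' (block k _ d ∪ push _ '' T.curves (d ∘ blockPerm k b))
    rw [hp, image_union, ← push_image_trans hr hs, ← push_image_trans hs hr]
    congr 1
    · unfold block
      rw [image_iUnion]
      refine iUnion_congr fun j => ?_
      rw [push_orientedArc hr.differentiable (differentiable_blockStrand k (contDiff_naturalAngle k b) j)]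
      congr 1
      funext x
      simp only [Function.comp, blockStrand, naturalAngle]
      split_ifs
      · rw [reflection_apply, Int.cast_neg, mul_neg, neg_mul, neg_mul, Real.cos_neg, Real.sin_neg,
          mul_neg]
      · rw [reflection_apply, neg_zero]
    · congr 2
      ext P <;> simp [reflection, shift]

theorem push_reflection_rightCap (m r w s : ℝ) :
    push reflection '' orientedArc (rightCap 0 m r w) (Icc (-1) 1) s =
      orientedArc (rightCap 0 m r w) (Icc (-1) 1) s := by
  rw [push_orientedArc isDiffeo_reflection.differentiable (differentiable_rightCap _ _ _ _)]
  congr 1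
  funext t
  rw [Function.comp, rightCap, reflection_apply, neg_zero]

theorem mirror_capInf : capInf.mirror ≈ capInf :=
  OTangle.equiv_of_curves_eq rfl fun d => by
    change push _ '' (_ ∪ _) = _ ∪ _
    rw [image_union, push_reflection_rightCap, push_reflection_rightCap]

theorem mirror_capZero : capZero.mirror ≈ capZero :=
  OTangle.equiv_of_curves_eq rfl fun d => by
    change push _ '' (_ ∪ _) = _ ∪ _
    rw [image_union, push_reflection_rightCap, push_reflection_rightCap]

theorem twist_neg_one_capInf : twist 0 (-1) capInf ≈ twist 1 (-1) capZero :=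
  calc twist 0 (-1) capInf ≈ twist 0 (-1) capInf.mirror := twist_congr (Setoid.symm mirror_capInf)
    _ ≈ (twist 0 1 capInf).mirror := twist_mirror 0 1 _
    _ ≈ (twist 1 1 capZero).mirror := OTangle.mirror_congr twist_one_capInf
    _ ≈ twist 1 (-1) capZero.mirror := Setoid.symm (twist_mirror 1 1 _)
    _ ≈ twist 1 (-1) capZero := twist_congr mirror_capZero

/-! ### Actions of the braid group on three strands -/

/-- Two one-parameter families of permutations of `Y` satisfying the braid relation, with two
points that satisfy the relations of `0` and `∞` under `A b : v ↦ 1 / (b + 1 / v)` and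
`B b : v ↦ v + b`. -/
structure FractionAction (Y : Type*) where
  A : ℤ → Y → Y
  B : ℤ → Y → Y
  zero : Y
  inf : Y
  A_zero : ∀ x, A 0 x = x
  B_zero : ∀ x, B 0 x = x
  A_add : ∀ a b x, A a (A b x) = A (a + b) x
  B_add : ∀ a b x, B a (B b x) = B (a + b) x
  braid : ∀ x, A 1 (B (-1) (A 1 x)) = B (-1) (A 1 (B (-1) x))
  A_one_base : A 1 zero = zero
  B_one_base : B 1 inf = inf
  A_one_inf : A 1 inf = B 1 zero
  A_neg_one_inf : A (-1) inf = B (-1) zero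

namespace FractionAction

variable {Y : Type*} (S : FractionAction Y)

theorem A_one_neg (x : Y) : S.A 1 (S.A (-1) x) = x := by rw [S.A_add, add_neg_cancel, S.A_zero]

theorem A_neg_one (x : Y) : S.A (-1) (S.A 1 x) = x := by rw [S.A_add, neg_add_cancel, S.A_zero]

theorem B_one_neg (x : Y) : S.B 1 (S.B (-1) x) = x := by rw [S.B_add, add_neg_cancel, S.B_zero]

theorem B_neg_one (x : Y) : S.B (-1) (S.B 1 x) = x := by rw [S.B_add, neg_add_cancel, S.B_zero]

theorem A_neg_base : S.A (-1) S.zero = S.zero := by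
  conv_lhs => rw [← S.A_one_base]
  exact S.A_neg_one _

theorem B_neg_base : S.B (-1) S.inf = S.inf := by
  conv_lhs => rw [← S.B_one_base]
  exact S.B_neg_one _

/-- The points `p / q` with `p, q ≥ 0` (for `e = 1`), and `-p / q` (for `e = -1`), by the Euclidean
algorithm. -/
def point (e : ℤ) (p q : ℕ) : Y :=
  if p = 0 then S.zero
  else if q = 0 then S.inf
  else if p ≤ q then S.A e (point e p (q - p)) else S.B e (point e (p - q) q)
termination_by p + q

theorem point_zero_left (e : ℤ) (q : ℕ) : S.point e 0 q = S.zero := by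
  rw [point, if_pos rfl]

theorem point_zero_right (e : ℤ) {p : ℕ} (hp : p ≠ 0) : S.point e p 0 = S.inf := by
  rw [point, if_neg hp, if_pos rfl]

theorem point_add_right {e : ℤ} (he : e = 1 ∨ e = -1) (p q : ℕ) :
    S.point e p (p + q) = S.A e (S.point e p q) := by
  rcases Nat.eq_zero_or_pos p with rfl | hp
  · rw [point_zero_left, point_zero_left]
    rcases he with rfl | rfl
    · exact S.A_one_base.symm
    · exact S.A_neg_base.symm
  · rw [point, if_neg hp.ne', if_neg (by omega), if_pos (by omega), Nat.add_sub_cancel_left]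

/-- The Euclidean algorithm resolves the tie `q / q` by `A`. The case `p = 0`, where `B` is wanted
instead, is exactly the relation `A^{±1} ∞ = B^{±1} 0`. -/
theorem point_add_left {e : ℤ} (he : e = 1 ∨ e = -1) {p q : ℕ} (h : p ≠ 0 ∨ q ≠ 0) :
    S.point e (p + q) q = S.B e (S.point e p q) := by
  rcases Nat.eq_zero_or_pos q with rfl | hq
  · rw [add_zero, point_zero_right S e (by simpa using h)]
    rcases he with rfl | rfl
    · exact S.B_one_base.symm
    · exact S.B_neg_base.symm
  rcases Nat.eq_zero_or_pos p with rfl | hp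
  · have := S.point_add_right he q 0
    rw [zero_add, point_zero_left]
    rw [add_zero, point_zero_right S e hq.ne'] at this
    rw [this]
    rcases he with rfl | rfl
    · exact S.A_one_inf
    · exact S.A_neg_one_inf
  · rw [point, if_neg (by omega), if_neg hq.ne', if_neg (by omega), Nat.add_sub_cancel]

/-- The half turn `v ↦ -1 / v`. -/
def half (x : Y) : Y := S.A 1 (S.B (-1) (S.A 1 x))

theorem half_zero : S.half S.zero = S.inf := by
  rw [half, S.A_one_base, ← S.A_neg_one_inf, S.A_one_neg]

theorem half_inf : S.half S.inf = S.zero := by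
  rw [half, S.A_one_inf, S.B_neg_one, S.A_one_base]

/-- This and the next three identities are the braid relation in the form that the half turn
conjugates `A^{±1}` into `B^{∓1}` and vice versa. -/
theorem half_A_neg (x : Y) : S.half (S.A (-1) x) = S.B 1 (S.half x) := by
  rw [half, half, S.A_one_neg, S.braid, S.B_one_neg]

theorem half_B_neg (x : Y) : S.half (S.B (-1) x) = S.A 1 (S.half x) := by
  rw [half, half, S.braid x]

theorem half_A (x : Y) : S.half (S.A 1 x) = S.B (-1) (S.half x) := by
  rw [half, half, S.braid]

theorem half_B (x : Y) : S.half (S.B 1 x) = S.A (-1) (S.half x) := by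
  rw [half, half, S.braid, S.B_neg_one, S.A_neg_one]

/-- The half turn exchanges `0` with `∞` and the two kinds of Euclidean steps, with a change of
sign, so it transforms the whole expansion of `p / q` into that of `-q / p`. -/
theorem half_point {e : ℤ} (he : e = 1 ∨ e = -1) (p q : ℕ) (h : p ≠ 0 ∨ q ≠ 0) :
    S.half (S.point e p q) = S.point (-e) q p := by
  have he' : -e = 1 ∨ -e = -1 := by omega
  induction hn : p + q using Nat.strong_induction_on generalizing p q with
  | _ n ih =>
    rcases Nat.eq_zero_or_pos p with rfl | hp
    · rw [point_zero_left, half_zero, point_zero_right S _ (by simpa using h)]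
    rcases Nat.eq_zero_or_pos q with rfl | hq
    · rw [point_zero_right S _ hp.ne', half_inf, point_zero_left]
    rcases le_or_gt p q with hpq | hpq
    · obtain ⟨r, rfl⟩ := Nat.exists_eq_add_of_le hpq
      have hr := ih (p + r) (by omega) p r (Or.inl hp.ne') rfl
      rw [S.point_add_right he, add_comm p r, S.point_add_left he' (Or.inr hp.ne'), ← hr]
      rcases he with rfl | rfl
      · exact S.half_A _
      · exact S.half_A_neg _
    · obtain ⟨r, rfl⟩ := Nat.exists_eq_add_of_le hpq.le
      have hr := ih (r + q) (by omega) r q (Or.inr hq.ne') rfl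
      rw [S.point_add_right he', add_comm q r, S.point_add_left he (Or.inr hq.ne'), ← hr]
      rcases he with rfl | rfl
      · exact S.half_B _
      · exact S.half_B_neg _

/-- The point `p / q`. -/
def frac (p q : ℤ) : Y := S.point (if 0 ≤ p * q then 1 else -1) p.natAbs q.natAbs

theorem frac_neg (p q : ℤ) : S.frac (-p) (-q) = S.frac p q := by
  simp [frac]

theorem frac_natCast (p q : ℕ) : S.frac p q = S.point 1 p q := by
  have : (0 : ℤ) ≤ p * q := by positivity
  rw [frac, if_pos this, Int.natAbs_natCast, Int.natAbs_natCast]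

theorem frac_natCast_neg {p q : ℕ} (h : p ≠ 0 ∨ q ≠ 0) : S.frac p (-q) = S.point (-1) p q := by
  rcases Nat.eq_zero_or_pos p with rfl | hp
  · rw [frac, Int.natAbs_natCast, point_zero_left, point_zero_left]
  rcases Nat.eq_zero_or_pos q with rfl | hq
  · rw [frac, Int.natAbs_natCast, Nat.cast_zero, neg_zero, Int.natAbs_zero,
      point_zero_right S _ hp.ne', point_zero_right S _ hp.ne']
  · have : (0 : ℤ) < p * q := by positivity
    rw [frac, if_neg (by rw [mul_neg]; omega), Int.natAbs_natCast, Int.natAbs_neg,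
      Int.natAbs_natCast]

theorem frac_zero_left (q : ℤ) : S.frac 0 q = S.zero := point_zero_left S _ _

theorem frac_zero_right {p : ℤ} (hp : p ≠ 0) : S.frac p 0 = S.inf :=
  point_zero_right S _ (by simpa using hp)

theorem frac_add_right_of_nonneg (p : ℕ) (q : ℤ) (h : p ≠ 0 ∨ q ≠ 0) :
    S.frac p (q + p) = S.A 1 (S.frac p q) := by
  rcases le_total 0 q with hq | hq
  · lift q to ℕ using hq
    rw [← Nat.cast_add, frac_natCast, frac_natCast, add_comm, S.point_add_right (Or.inl rfl)]
  · obtain ⟨r, rfl⟩ : ∃ r : ℕ, q = -r := ⟨q.natAbs, by omega⟩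
    rw [S.frac_natCast_neg (by simpa using h)]
    rcases le_or_gt p r with hpr | hpr
    · obtain ⟨t, rfl⟩ := Nat.exists_eq_add_of_le hpr
      rw [S.point_add_right (Or.inr rfl), A_one_neg, show (-((p + t : ℕ) : ℤ) + p) = -t by
        push_cast; ring]
      rcases Nat.eq_zero_or_pos p with rfl | hp
      · rw [point_zero_left, Nat.cast_zero, frac_zero_left]
      · exact S.frac_natCast_neg (Or.inl hp.ne')
    · obtain ⟨t, rfl⟩ := Nat.exists_eq_add_of_le hpr.le
      have ht : t ≠ 0 := by omega
      rw [show (-(r : ℤ) + ((r + t : ℕ) : ℤ)) = t by push_cast; ring, frac_natCast,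
        S.point_add_left (Or.inl rfl) (Or.inr ht)]
      -- Here the denominator passes from negative to positive. With `X` the point `-t / r`, the
      -- claim is `B (half X) = A (B⁻¹ X)`, which follows from `half X = B⁻¹ A B⁻¹ X`.
      have hh := S.half_point (Or.inr rfl) t r (Or.inl ht)
      rw [neg_neg] at hh
      rw [add_comm r t, S.point_add_left (Or.inr rfl) (Or.inl ht), ← hh, half, S.braid, S.B_one_neg]

theorem frac_add_right (p q : ℤ) (h : p ≠ 0 ∨ q ≠ 0) :
    S.frac p (q + p) = S.A 1 (S.frac p q) := by
  rcases le_total 0 p with hp | hp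
  · lift p to ℕ using hp
    exact S.frac_add_right_of_nonneg p q (by simpa using h)
  · obtain ⟨r, rfl⟩ : ∃ r : ℕ, p = -r := ⟨p.natAbs, by omega⟩
    have := S.frac_add_right_of_nonneg r (-q) (by simpa using h)
    rw [← S.frac_neg, ← S.frac_neg (-r) q, neg_neg, neg_add, neg_neg]
    exact this

theorem frac_add_left_of_nonneg (p : ℤ) (q : ℕ) (h : p ≠ 0 ∨ q ≠ 0) :
    S.frac (p + q) q = S.B 1 (S.frac p q) := by
  rcases le_total 0 p with hp | hp
  · lift p to ℕ using hp
    rw [← Nat.cast_add, frac_natCast, frac_natCast, S.point_add_left (Or.inl rfl) (by simpa using h)]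
  · obtain ⟨r, rfl⟩ : ∃ r : ℕ, p = -r := ⟨p.natAbs, by omega⟩
    rw [← S.frac_neg (-r), neg_neg, S.frac_natCast_neg (by simpa using h)]
    rcases le_or_gt q r with hqr | hqr
    · obtain ⟨t, rfl⟩ := Nat.exists_eq_add_of_le hqr
      have h' : t ≠ 0 ∨ q ≠ 0 := by
        rcases h with h | h
        · by_contra h0
          push Not at h0
          simp [h0] at h
        · exact Or.inr h
      rw [add_comm q t, S.point_add_left (Or.inr rfl) h', B_one_neg,
        show (-((t + q : ℕ) : ℤ) + q) = -t by push_cast; ring, ← S.frac_neg, neg_neg]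
      exact S.frac_natCast_neg h'
    · obtain ⟨t, rfl⟩ := Nat.exists_eq_add_of_le hqr.le
      have ht : t ≠ 0 := by omega
      rw [show (-(r : ℤ) + ((r + t : ℕ) : ℤ)) = t by push_cast; ring, frac_natCast, add_comm r t,
        S.point_add_right (Or.inl rfl)]
      -- Again a change of sign. With `X` the point `t / r`, the claim is `A X = B (A⁻¹ (half X))`,
      -- clear from `half X = A B⁻¹ A X`.
      have hh := S.half_point (Or.inl rfl) t r (Or.inl ht)
      rw [add_comm t r, S.point_add_right (Or.inr rfl), ← hh, half, S.A_neg_one, S.B_one_neg]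

theorem frac_add_left (p q : ℤ) (h : p ≠ 0 ∨ q ≠ 0) :
    S.frac (p + q) q = S.B 1 (S.frac p q) := by
  rcases le_total 0 q with hq | hq
  · lift q to ℕ using hq
    exact S.frac_add_left_of_nonneg p q (by simpa using h)
  · obtain ⟨r, rfl⟩ : ∃ r : ℕ, q = -r := ⟨q.natAbs, by omega⟩
    have := S.frac_add_left_of_nonneg (-p) r (by simpa using h)
    rw [← S.frac_neg, ← S.frac_neg p (-r), neg_neg, neg_add, neg_neg]
    exact this

theorem frac_add_mul_right (p q : ℤ) (h : p ≠ 0 ∨ q ≠ 0) (b : ℤ) :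
    S.frac p (q + b * p) = S.A b (S.frac p q) := by
  have hne : ∀ b : ℤ, p ≠ 0 ∨ q + b * p ≠ 0 := fun b => by
    rcases eq_or_ne p 0 with h0 | h0
    · subst h0
      simpa using h
    · exact Or.inl h0
  induction b using Int.induction_on with
  | zero => rw [zero_mul, add_zero, S.A_zero]
  | succ n ih =>
    rw [add_comm (n : ℤ) 1, ← S.A_add, ← ih, ← S.frac_add_right _ _ (hne n)]
    congr 1; ring
  | pred n ih =>
    have := S.frac_add_right p (q + (-n - 1) * p) (hne _)
    rw [show q + (-(n : ℤ) - 1) * p + p = q + -(n : ℤ) * p by ring, ih] at this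
    rw [sub_eq_neg_add, ← S.A_add, this, S.A_neg_one, ← sub_eq_neg_add]

theorem frac_add_mul_left (p q : ℤ) (h : p ≠ 0 ∨ q ≠ 0) (b : ℤ) :
    S.frac (p + b * q) q = S.B b (S.frac p q) := by
  have hne : ∀ b : ℤ, p + b * q ≠ 0 ∨ q ≠ 0 := fun b => by
    rcases eq_or_ne q 0 with h0 | h0
    · subst h0
      simpa using h
    · exact Or.inr h0
  induction b using Int.induction_on with
  | zero => rw [zero_mul, add_zero, S.B_zero]
  | succ n ih =>
    rw [add_comm (n : ℤ) 1, ← S.B_add, ← ih, ← S.frac_add_left _ _ (hne n)]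
    congr 1; ring
  | pred n ih =>
    have := S.frac_add_left (p + (-n - 1) * q) q (hne _)
    rw [show p + (-(n : ℤ) - 1) * q + q = p + -(n : ℤ) * q by ring, ih] at this
    rw [sub_eq_neg_add, ← S.B_add, this, S.B_neg_one, ← sub_eq_neg_add]

end FractionAction

/-! ### Blocks depend only on the parity of their number. -/

theorem twist_of_even {k : ℕ} (hk : Even k) (b : ℤ) (T : OTangle) : twist k b T = twist 0 b T := by
  have h1 : upperPos k = upperPos 0 := by simp [upperPos, hk]
  have h2 : axisHeight k = axisHeight 0 := by simp [axisHeight, hk]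
  have h3 : naturalAngle k b = naturalAngle 0 b := by
    funext x
    simp [naturalAngle, hk.neg_one_pow]
  have h4 : blockPerm k b = blockPerm 0 b := by simp [blockPerm, h1]
  have h5 : blockStrand k (naturalAngle k b) = blockStrand 0 (naturalAngle 0 b) := by
    rw [h3]
    funext j x
    simp only [blockStrand, h1, h2]
  simp only [twist, profTwist, block, h4, h5]

theorem twist_of_odd {k : ℕ} (hk : ¬Even k) (b : ℤ) (T : OTangle) : twist k b T = twist 1 b T := by
  have h1 : upperPos k = upperPos 1 := by simp [upperPos, hk]
  have h2 : axisHeight k = axisHeight 1 := by simp [axisHeight, hk]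
  have h3 : naturalAngle k b = naturalAngle 1 b := by
    funext x
    simp [naturalAngle, (Nat.not_even_iff_odd.1 hk).neg_one_pow]
  have h4 : blockPerm k b = blockPerm 1 b := by simp [blockPerm, h1]
  have h5 : blockStrand k (naturalAngle k b) = blockStrand 1 (naturalAngle 1 b) := by
    rw [h3]
    funext j x
    simp only [blockStrand, h1, h2]
  simp only [twist, profTwist, block, h4, h5]

/-! ### Classes of tangles -/

/-- Twisting of equivalence classes of tangles. -/
def classTwist (k : ℕ) (b : ℤ) : Quotient OTangle.setoid → Quotient OTangle.setoid :=
  Quotient.map (twist k b) fun _ _ h => twist_congr h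

theorem classTwist_mk (k : ℕ) (b : ℤ) (T : OTangle) :
    classTwist k b (Quotient.mk _ T) = Quotient.mk _ (twist k b T) := rfl

theorem classTwist_add (k : ℕ) (a b : ℤ) (x : Quotient OTangle.setoid) :
    classTwist k a (classTwist k b x) = classTwist k (a + b) x := by
  induction x using Quotient.inductionOn with
  | h T => exact Quotient.sound (twist_twist k a b T)

theorem classTwist_zero (k : ℕ) (x : Quotient OTangle.setoid) :
    classTwist k 0 x = classTwist 0 0 x := by
  induction x using Quotient.inductionOn with
  | h T => rw [classTwist_mk, classTwist_mk, twist_zero_eq k 0]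

theorem classTwist_zero_classTwist (k : ℕ) (b : ℤ) (x : Quotient OTangle.setoid) :
    classTwist 0 0 (classTwist k b x) = classTwist k b x := by
  rw [← classTwist_zero k, classTwist_add, zero_add]

/-- Classes of tangles that absorb a trivial block. -/
abbrev TangleClass : Type := {x : Quotient OTangle.setoid // classTwist 0 0 x = x}

def TangleClass.twist (k : ℕ) (b : ℤ) (x : TangleClass) : TangleClass :=
  ⟨classTwist k b x.1, classTwist_zero_classTwist k b x.1⟩

/-- An arbitrary `OTangle`, for instance one without curves, need not absorb a trivial block,
whereas an action requires `A 0 = id`. Prepending a trivial block is idempotent on classes and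
commutes with twisting, so it projects onto the classes for which this holds. -/
def TangleClass.of (T : OTangle) : TangleClass :=
  ⟨classTwist 0 0 (Quotient.mk _ T), classTwist_zero_classTwist 0 0 _⟩

theorem TangleClass.val_twist (k : ℕ) (b : ℤ) (x : TangleClass) :
    (TangleClass.twist k b x).1 = classTwist k b x.1 := rfl

theorem TangleClass.val_of (T : OTangle) :
    (TangleClass.of T).1 = classTwist 0 0 (Quotient.mk _ T) := rfl

theorem TangleClass.twist_of (k : ℕ) (b : ℤ) (T : OTangle) :
    TangleClass.twist k b (TangleClass.of T) = TangleClass.of (_root_.twist k b T) := by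
  apply Subtype.ext
  rw [val_twist, val_of, val_of, ← classTwist_mk, classTwist_zero_classTwist, ← classTwist_zero k, classTwist_add, add_zero]

theorem TangleClass.of_eq {T T' : OTangle} (h : T ≈ T') : TangleClass.of T = TangleClass.of T' := by
  have : (Quotient.mk _ T : Quotient OTangle.setoid) = Quotient.mk _ T' := Quotient.sound h
  rw [TangleClass.of, TangleClass.of]
  simp only [this]

theorem TangleClass.of_twist_zero (k : ℕ) (T : OTangle) :
    TangleClass.of (_root_.twist k 0 T) = TangleClass.of T := by
  apply Subtype.ext
  rw [val_of, val_of, ← classTwist_mk, classTwist_zero_classTwist, classTwist_zero]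

theorem TangleClass.induction {P : TangleClass → Prop} (h : ∀ T, P (TangleClass.of T))
    (x : TangleClass) : P x := by
  obtain ⟨x, hx⟩ := x
  induction x using Quotient.inductionOn with
  | h T =>
    have : (⟨Quotient.mk _ T, hx⟩ : TangleClass) = TangleClass.of T := Subtype.ext hx.symm
    rw [this]
    exact h T

def tangleAction : FractionAction TangleClass where
  A := TangleClass.twist 0
  B := TangleClass.twist 1
  zero := TangleClass.of capZero
  inf := TangleClass.of capInf
  A_zero x := Subtype.ext x.2
  B_zero x := Subtype.ext ((classTwist_zero 1 x.1).trans x.2)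
  A_add a b x := Subtype.ext (classTwist_add 0 a b x.1)
  B_add a b x := Subtype.ext (classTwist_add 1 a b x.1)
  braid x := by
    induction x using TangleClass.induction with
    | h T =>
      simp only [TangleClass.twist_of]
      exact TangleClass.of_eq (twist_braid T)
  A_one_base := by
    rw [TangleClass.twist_of, TangleClass.of_eq (twist_capZero 1), TangleClass.of_twist_zero]
  B_one_base := by
    rw [TangleClass.twist_of, TangleClass.of_eq (twist_capInf 1), TangleClass.of_twist_zero]
  A_one_inf := by
    rw [TangleClass.twist_of, TangleClass.twist_of, TangleClass.of_eq twist_one_capInf]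
  A_neg_one_inf := by
    rw [TangleClass.twist_of, TangleClass.twist_of, TangleClass.of_eq twist_neg_one_capInf]

/-! ### The tangle of a continued fraction -/

/-- The part of the natural diagram starting with the block number `k`. -/
def tangle : ℕ → List ℤ → OTangle
  | k, [] => if Even k then capZero else capInf
  | k, b :: l => twist k b (tangle (k + 1) l)

/-- Numerator and denominator of a continued fraction. -/
def convergent : List ℤ → ℤ × ℤ
  | [] => (0, 1)
  | b :: l => ((convergent l).2, (convergent l).1 + b * (convergent l).2)

theorem isCoprime_convergent (l : List ℤ) : IsCoprime (convergent l).1 (convergent l).2 := by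
  induction l with
  | nil => exact isCoprime_zero_left.2 isUnit_one
  | cons b l ih => exact (IsCoprime.add_mul_right_left_iff.2 ih).symm

theorem convergent_ne_zero (l : List ℤ) : (convergent l).1 ≠ 0 ∨ (convergent l).2 ≠ 0 := by
  by_contra h
  push Not at h
  have := isCoprime_convergent l
  rw [h.1, h.2] at this
  exact not_isCoprime_zero_zero this

theorem recip_coe (x : ℚ) :
    recip (x : WithTop ℚ) = if x = 0 then ⊤ else ((x⁻¹ : ℚ) : WithTop ℚ) := rfl

theorem recip_add (b p q : ℤ) (hne : p ≠ 0 ∨ q ≠ 0) :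
    recip (((b : ℚ) : WithTop ℚ) + if q = 0 then ⊤ else ((p / q : ℚ) : WithTop ℚ)) =
      if p + b * q = 0 then ⊤ else ((q / (p + b * q : ℤ) : ℚ) : WithTop ℚ) := by
  by_cases hq : q = 0
  · have hp : p ≠ 0 := by simpa [hq] using hne
    rw [if_pos hq, if_neg (by simpa [hq] using hp), hq]
    simp [recip]
  · have hq' : (q : ℚ) ≠ 0 := by exact_mod_cast hq
    rw [if_neg hq, ← WithTop.coe_add, recip_coe]
    have : (b : ℚ) + p / q = (p + b * q) / q := by
      field_simp
      ring
    rw [this]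
    by_cases h0 : p + b * q = 0
    · have h0' : (p : ℚ) + b * q = 0 := by exact_mod_cast h0
      rw [if_pos h0, if_pos (by rw [h0', zero_div])]
    · have h0' : (p : ℚ) + b * q ≠ 0 := by exact_mod_cast h0
      rw [if_neg h0, if_neg (div_ne_zero h0' hq'), inv_div]
      push_cast
      rfl

theorem contFrac_eq (l : List ℤ) : contFrac l =
    if (convergent l).2 = 0 then ⊤
    else (((convergent l).1 / (convergent l).2 : ℚ) : WithTop ℚ) := by
  induction l with
  | nil => simp [contFrac, convergent]
  | cons b l ih =>
    rw [contFrac, ih]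
    exact recip_add b _ _ (convergent_ne_zero l)

theorem convergent_eq_or {l : List ℤ} {p q : ℤ} (hpq : IsCoprime p q) (hq : q ≠ 0)
    (h : contFrac l = (((p : ℚ) / (q : ℚ) : ℚ) : WithTop ℚ)) :
    convergent l = (p, q) ∨ convergent l = (-p, -q) := by
  rw [contFrac_eq] at h
  split_ifs at h with h0
  · exact absurd h WithTop.top_ne_coe
  rw [WithTop.coe_eq_coe, div_eq_div_iff (by exact_mod_cast h0) (by exact_mod_cast hq)] at h
  have h' : (convergent l).1 * q = p * (convergent l).2 := by exact_mod_cast h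
  have hc := isCoprime_convergent l
  have d1 : q ∣ (convergent l).2 :=
    hpq.symm.dvd_of_dvd_mul_left (by rw [← h']; exact dvd_mul_left _ _)
  have d2 : (convergent l).2 ∣ q :=
    hc.symm.dvd_of_dvd_mul_left (by rw [h']; exact dvd_mul_left _ _)
  rcases Int.associated_iff.1 (associated_of_dvd_dvd d1 d2) with h1 | h1
  · left
    refine Prod.ext ?_ h1.symm
    rw [h1] at h'
    exact mul_right_cancel₀ h0 h'
  · right
    have h2 : (convergent l).2 = -q := by rw [h1, neg_neg]
    refine Prod.ext ?_ h2
    rw [h2, mul_neg, ← neg_mul] at h'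
    exact mul_right_cancel₀ hq h'

/-- Removing the first term inverts the fraction, which matches the alternation of blocks: a
remainder starting with a `B`-block represents `q / p`. Both kinds of steps thus become the single
recursion of `convergent`. -/
theorem of_tangle (l : List ℤ) : ∀ k, TangleClass.of (tangle k l) =
    if Even k then tangleAction.frac (convergent l).1 (convergent l).2
    else tangleAction.frac (convergent l).2 (convergent l).1 := by
  induction l with
  | nil =>
    intro k
    simp only [tangle, convergent]
    rw [tangleAction.frac_zero_left, tangleAction.frac_zero_right one_ne_zero]
    split_ifs <;> rfl
  | cons b l ih =>
    intro k
    have h := ih (k + 1)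
    have hne := convergent_ne_zero l
    by_cases hk : Even k
    · rw [if_neg (Nat.even_add_one.not.2 (not_not.2 hk))] at h
      rw [if_pos hk, tangle, twist_of_even hk, ← TangleClass.twist_of, h, convergent]
      exact (tangleAction.frac_add_mul_right _ _ hne.symm b).symm
    · rw [if_pos (Nat.even_add_one.2 hk)] at h
      rw [if_neg hk, tangle, twist_of_odd hk, ← TangleClass.twist_of, h, convergent]
      exact (tangleAction.frac_add_mul_left _ _ hne b).symm

theorem tangle_equiv {b c : List ℤ} {p q : ℤ} (hpq : IsCoprime p q) (hq : q ≠ 0)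
    (hb : b ≠ []) (hc : c ≠ []) (hpb : contFrac b = (((p : ℚ) / (q : ℚ) : ℚ) : WithTop ℚ))
    (hpc : contFrac c = (((p : ℚ) / (q : ℚ) : ℚ) : WithTop ℚ)) : tangle 0 b ≈ tangle 0 c := by
  have key : ∀ l : List ℤ, l ≠ [] → contFrac l = (((p : ℚ) / (q : ℚ) : ℚ) : WithTop ℚ) →
      Quotient.mk OTangle.setoid (tangle 0 l) = (tangleAction.frac p q).1 := by
    intro l hl h
    have h1 := of_tangle l 0
    rw [if_pos Even.zero] at h1
    have h2 : tangleAction.frac (convergent l).1 (convergent l).2 = tangleAction.frac p q := by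
      rcases convergent_eq_or hpq hq h with h | h <;> rw [h]
      exact tangleAction.frac_neg p q
    rw [← h2, ← h1]
    -- A nonempty diagram begins with a block, which absorbs the trivial one, so the projected class
    -- is the class of the tangle itself.
    obtain ⟨a, l, rfl⟩ := List.exists_cons_of_ne_nil hl
    exact (classTwist_zero_classTwist 0 a (Quotient.mk _ (tangle 1 l))).symm
  exact Quotient.exact ((key b hb hpb).trans (key c hc hpc).symm)

/-- The directions which are compatible with arcs of given parity. -/
def parityValid (p q : ℤ) : Set (Fin 4 → ℝ) :=
  if Even q then {d | d 0 = -d 1 ∧ d 2 = -d 3}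
  else if Even p then {d | d 1 = -d 2 ∧ d 0 = -d 3} else {d | d 0 = -d 2 ∧ d 1 = -d 3}

theorem neg_comm_and {a b c d : ℝ} : a = -b ∧ c = -d ↔ b = -a ∧ c = -d := by
  rw [eq_neg_iff_add_eq_zero, eq_neg_iff_add_eq_zero (a := b), add_comm]

/-- The arcs pair up the four ends in one of three ways, according to the class of `p / q` in the
projective line over `𝔽₂`; an odd power of `A` acts on this line as the transposition of the middle
ends acts on the pairings. -/
theorem parityValid_A {p q : ℤ} (h : ¬(Even p ∧ Even q)) (b : ℤ) :
    {d | d ∘ blockPerm 0 b ∈ parityValid p q} = parityValid p (q + b * p) := by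
  by_cases hb : Odd b
  · have hs : blockPerm 0 b = Equiv.swap 1 2 := by simp [blockPerm, hb, upperPos_zero]
    have hb' : ¬Even b := Int.not_even_iff_odd.2 hb
    ext d
    rw [hs, mem_ofPred_eq]
    unfold parityValid
    by_cases hp : Even p <;> by_cases hq : Even q
    · exact (h ⟨hp, hq⟩).elim
    · rw [if_neg hq, if_pos hp, if_neg (by simp [Int.even_add, hp, hq])]
      exact neg_comm_and
    · rw [if_pos hq, if_neg (by simp [hp, hq, hb', parity_simps]), if_neg hp]
      exact Iff.rfl
    · rw [if_neg hq, if_neg hp, if_pos (by simp [parity_simps, hp, hq, hb'])]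
      exact Iff.rfl
  · have hs : blockPerm 0 b = id := by simp [blockPerm, hb]
    have hb' : Even b := Int.not_odd_iff_even.1 hb
    rw [hs]
    simp [parityValid, Int.even_add, hb']

theorem parityValid_B {p q : ℤ} (h : ¬(Even p ∧ Even q)) (b : ℤ) :
    {d | d ∘ blockPerm 1 b ∈ parityValid p q} = parityValid (p + b * q) q := by
  by_cases hb : Odd b
  · have hs : blockPerm 1 b = Equiv.swap 0 1 := by simp [blockPerm, hb, upperPos_one]
    have hb' : ¬Even b := Int.not_even_iff_odd.2 hb
    ext d
    rw [hs, mem_ofPred_eq]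
    unfold parityValid
    by_cases hp : Even p <;> by_cases hq : Even q
    · exact (h ⟨hp, hq⟩).elim
    · rw [if_neg hq, if_pos hp, if_neg hq, if_neg (by simp [parity_simps, hp, hq, hb'])]
      exact Iff.rfl
    · rw [if_pos hq, if_pos hq]
      exact neg_comm_and
    · rw [if_neg hq, if_neg hp, if_neg hq, if_pos (by simp [parity_simps, hp, hq, hb'])]
      exact Iff.rfl
  · have hs : blockPerm 1 b = id := by simp [blockPerm, hb]
    have hb' : Even b := Int.not_odd_iff_even.1 hb
    rw [hs]
    simp [parityValid, Int.even_add, hb']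

theorem tangle_valid (l : List ℤ) : ∀ k, (tangle k l).valid =
    if Even k then parityValid (convergent l).1 (convergent l).2
    else parityValid (convergent l).2 (convergent l).1 := by
  induction l with
  | nil =>
    intro k
    simp only [tangle, convergent]
    split_ifs <;> simp [parityValid, capZero, capInf]
  | cons b l ih =>
    intro k
    have h := ih (k + 1)
    have hne : ¬(Even (convergent l).1 ∧ Even (convergent l).2) := fun hne => by
      have := (isCoprime_convergent l).isUnit_of_dvd' hne.1.two_dvd hne.2.two_dvd
      exact absurd this (by decide)
    by_cases hk : Even k
    · rw [if_neg (Nat.even_add_one.not.2 (not_not.2 hk))] at h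
      rw [if_pos hk, tangle, twist_of_even hk, convergent, ← parityValid_A (fun h => hne h.symm), ← h]
      rfl
    · rw [if_pos (Nat.even_add_one.2 hk)] at h
      rw [if_neg hk, tangle, twist_of_odd hk, convergent, ← parityValid_B hne, ← h]
      rfl

/-! ### The link of a tangle -/

theorem dir_succ (b : List ℤ) (k : ℕ) : dir b (k + 1) = dir b k ∘ blockPerm k (b.getD k 0) := by
  rw [dir, blockPerm]
  split_ifs <;> rfl

theorem push_shift_block (k : ℕ) (b : ℤ) (d : Fin 4 → ℝ) :
    push (shift k) '' block k (naturalAngle k b) d =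
      ⋃ j : Fin 4, orientedArc (strand k b j) (Icc (k : ℝ) (k + 1)) (d j) := by
  rw [block, image_iUnion]
  exact iUnion_congr fun j => push_shift_blockArc k (contDiff_naturalAngle k b) j _ _

theorem push_shift_rightCap (n : ℕ) (m r w s : ℝ) :
    push (shift n) '' orientedArc (rightCap 0 m r w) (Icc (-1) 1) s =
      orientedArc (rightCap n m r w) (Icc (-1) 1) s := by
  rw [push_orientedArc (isDiffeo_shift _).differentiable (differentiable_rightCap _ _ _ _)]
  congr 1
  funext t
  rw [Function.comp, shift_rightCap]
  rfl

/-- Induction on the number `m` of remaining blocks, from the right end of the diagram. Each step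
moves one block from the nested shifts of `tangle` to its absolute position. -/
theorem push_shift_tangle (b : List ℤ) (m k : ℕ) (h : k + m = b.length) :
    push (shift k) '' (tangle k (b.drop k)).curves (dir b k) =
      (⋃ i ∈ Finset.Ico k b.length, ⋃ j : Fin 4,
        orientedArc (strand i (b.getD i 0) j) (Icc (i : ℝ) (i + 1)) (dir b i j)) ∪
      rightClosure b := by
  induction m generalizing k with
  | zero =>
    rw [add_zero] at h
    subst h
    rw [List.drop_length, Finset.Ico_self, rightClosure, tangle]
    simp only [Finset.notMem_empty, iUnion_of_empty, iUnion_empty, empty_union]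
    rcases Nat.even_or_odd b.length with he | ho
    · rw [if_pos he, if_neg (Nat.not_odd_iff_even.2 he)]
      change push _ '' (_ ∪ _) = _
      rw [image_union, push_shift_rightCap, push_shift_rightCap]
    · rw [if_neg (Nat.not_even_iff_odd.2 ho), if_pos ho]
      change push _ '' (_ ∪ _) = _
      rw [image_union, push_shift_rightCap, push_shift_rightCap]
  | succ m ih =>
    have hk : k < b.length := by omega
    have h1 := ih (k + 1) (by omega)
    rw [List.drop_eq_getElem_cons hk, tangle]
    rw [dir_succ, List.getD_eq_getElem _ _ hk] at h1
    change push _ '' (_ ∪ push _ '' _) = _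
    rw [image_union, push_shift_shift, push_shift_block, add_comm (1 : ℝ), ← Nat.cast_add_one, h1,
      ← union_assoc, ← List.getD_eq_getElem _ 0 hk]
    congr 1
    rw [← Finset.insert_Ico_add_one_left_eq_Ico hk, Finset.set_biUnion_insert, Nat.cast_add_one]

theorem positiveNaturalLink_eq (b : List ℤ) : positiveNaturalLink b =
    orientedArc (leftCap 1) (Icc (-1) 1) 1 ∪ orientedArc (leftCap (-1)) (Icc (-1) 1) 1 ∪
      (tangle 0 b).curves ![1, -1, 1, -1] := by
  have h := push_shift_tangle b b.length 0 (zero_add _)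
  rw [Nat.cast_zero, push_shift_zero, List.drop_zero] at h
  change (tangle 0 b).curves ![1, -1, 1, -1] = _ at h
  rw [h, positiveNaturalLink, Finset.range_eq_Ico, union_assoc]

theorem leftCap_fst_nonpos {m s : ℝ} {u : Space × Space}
    (hu : u ∈ orientedArc (leftCap m) (Icc (-1) 1) s) : u.1.1 ≤ 0 := by
  obtain ⟨t, ht, c, -, rfl⟩ := hu
  change t ^ 2 - 1 ≤ 0
  nlinarith [ht.1, ht.2]

/-- The diffeomorphism between the tangles fixes `x ≤ 0`: it keeps the left caps and their tangents,
and it is the identity near `(-1, 0, 0)`, which is the centre needed for the homotheties. -/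
theorem orientedIsotopic_of_equiv {b c : List ℤ} (h : tangle 0 b ≈ tangle 0 c)
    (hv : ![1, -1, 1, -1] ∈ (tangle 0 b).valid) :
    OrientedIsotopic (positiveNaturalLink b) (positiveNaturalLink c) := by
  obtain ⟨-, g, hg, hg0, hc⟩ := h
  have hloc : ∀ᶠ P in 𝓝 ((-1, 0, 0) : Space), g P = P := by
    have : ∀ᶠ P : Space in 𝓝 ((-1, 0, 0) : Space), P.1 < 0 :=
      continuous_fst.continuousAt.eventually (gt_mem_nhds (by norm_num))
    exact this.mono fun P hP => hg0 P hP.le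
  have := orientedIsotopic_of_diffeo hg _ hloc (positiveNaturalLink b)
  rwa [positiveNaturalLink_eq b, image_union, hc _ hv,
    push_image_of_fst_le hg hg0 (by rintro u (hu | hu) <;> exact leftCap_fst_nonpos hu),
    ← positiveNaturalLink_eq b, ← positiveNaturalLink_eq c] at this

end

/-! ### Conclusion. -/

theorem lemma3 (p q : ℤ) (hpq : IsCoprime p q) (hq : q ≠ 0) (hq_even : Even q)
    (b c : List ℤ) (hb : ∀ x ∈ b, x ≠ 0) (hc : ∀ x ∈ c, x ≠ 0)
    (hpb : contFrac b = (((p : ℚ) / (q : ℚ) : ℚ) : WithTop ℚ))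
    (hpc : contFrac c = (((p : ℚ) / (q : ℚ) : ℚ) : WithTop ℚ)) :
    OrientedIsotopic (positiveNaturalLink b) (positiveNaturalLink c) := by
  have key : ∀ l : List ℤ, contFrac l = (((p : ℚ) / (q : ℚ) : ℚ) : WithTop ℚ) →
      Even (convergent l).2 := fun l hl => by
    rcases convergent_eq_or hpq hq hl with h | h <;> rw [h]
    · exact hq_even
    · exact hq_even.neg
  have hne : ∀ l : List ℤ, contFrac l = (((p : ℚ) / (q : ℚ) : ℚ) : WithTop ℚ) → l ≠ [] := by
    rintro l hl rfl
    -- The empty continued fraction is `0 / 1`, with odd denominator.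
    exact absurd (key [] hl) (by decide)
  refine orientedIsotopic_of_equiv (tangle_equiv hpq hq (hne b hpb) (hne c hpc) hpb hpc) ?_
  -- For even denominator the arcs of the tangle require opposite directions at the ends `0, 1` and
  -- at the ends `2, 3`; two upward left caps provide just this.
  rw [tangle_valid, if_pos Even.zero, parityValid, if_pos (key b hpb)]
  simp
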